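/- The augmented square antiprism graph has nine vertices: a central vertex $v_0$ and the vertices $a_0,\dots,a_3$ and $b_0,\dots,b_3$ of two quadrilaterals. Its edges are $a_ka_{k+1}$, $b_kb_{k+1}$, $b_ka_k$, $b_ka_{k+1}$ (indices modulo $4$), and the edges that join $v_0$ to all other vertices. Let $G$ and $G'$ be two instances of this graph, with vertices $v_0,a_k,b_k$ and $v_0',a_k',b_k'$. An extension $G\oplus G'$ is obtained as follows: for some $i,j$, the pair $\{a_i,a_{i+1}\}$ is identified with the pair $\{a_j',a_{j+1}'\}$ (in either of the two ways), and an edge $b_ib_j'$ is added. (By the symmetry of the antiprism, it does not matter which of its quadrilaterals is called $a$.) A straight-line RAC drawing of a graph maps its vertices to distinct points of the plane and its edges to straight-line segments that contain no vertices other than their ends, such that any two edges that meet in an interior point of both are perpendicular. The combinatorial embedding of a drawing of a connected graph consists of: the pairs of edges that cross, the order of the crossings along each edge, the cyclic order of the edges around each vertex and around each crossing, and the outer face; drawings that are mirror images of each other are regarded as having the same combinatorial embedding. The vertices are labelled. A RAC combinatorial embedding of a graph is the combinatorial embedding of one of its straight-line RAC drawings. **Theorem.** Every extension $G\oplus G'$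 of two instances of the augmented square antiprism graph has exactly one RAC combinatorial embedding. Moreover, in every straight-line RAC drawing of $G\oplus G'$, the shared vertices lie on the outer quadrilateral of each copy, and neither copy is drawn inside the other: the quadrilateral $a_0a_1a_2a_3$ is drawn as a simple polygon whose interior contains $v_0,b_0,\dots,b_3$, the quadrilateral $a_0'a_1'a_2'a_3'$ is drawn as a simple polygon whose interior contains $v_0',b_0',\dots,b_3'$, and the interiors of these two polygons are disjoint. -/

import Mathlib

open scoped Topology

namespace RAC

/-! ## The graphs -/

/-- The nine vertices of the augmented square antiprism graph: the central vertex and the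
vertices of the two quadrilaterals, both numbered cyclically. -/
inductive AntiprismVertex : Type
  | center : AntiprismVertex
  | top (i : ZMod 4) : AntiprismVertex
  | bot (i : ZMod 4) : AntiprismVertex

open AntiprismVertex

/-- One orientation of each edge (the symmetric closure is taken below).  The vertex `bot i` is the
common neighbour, on the second quadrilateral, of the consecutive vertices `top i`, `top (i + 1)`
of the first one. -/
def antiprismRel : AntiprismVertex → AntiprismVertex → Prop
  | center, _ => True
  | top i, top j => j = i + 1
  | bot i, bot j => j = i + 1
  | bot i, top j => j = i ∨ j = i + 1
  | _, _ => False

/-- The augmented square antiprism graph: the skeleton of the square antiprism together with a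
central vertex adjacent to all the others. -/
def augmentedSquareAntiprism : SimpleGraph AntiprismVertex :=
  SimpleGraph.fromRel antiprismRel

/-- `H` is the extension `G ⊕ G'` of the two instances `G`, `G'` of the augmented square antiprism
graph that are placed in `H` by `φ` and `φ'`: a pair of consecutive vertices of a quadrilateral of
`G` is identified with such a pair of `G'` (in either of the two ways), nothing else is shared, and
one edge is added, which joins the common neighbours of the two shared vertices on the other
quadrilateral of `G` and on the other quadrilateral of `G'`.
The automorphism group of the augmented square antiprism graph is transitive on the eight edges of
its quadrilaterals, so it is no restriction that the quadrilateral in question is called `top`. -/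
structure IsExtension {V : Type*} (H : SimpleGraph V) (φ φ' : AntiprismVertex ↪ V)
    (i j : ZMod 4) : Prop where
  glue : ({φ (top i), φ (top (i + 1))} : Set V) = {φ' (top j), φ' (top (j + 1))}
  shared : Set.range φ ∩ Set.range φ' = {φ (top i), φ (top (i + 1))}
  cover : Set.range φ ∪ Set.range φ' = Set.univ
  graph : H = augmentedSquareAntiprism.map φ ⊔ augmentedSquareAntiprism.map φ' ⊔
    SimpleGraph.edge (φ (bot i)) (φ' (bot j))

/-! ## Straight-line RAC drawings in the plane `ℂ` -/

section Drawing

variable {V : Type*}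

/-- The edges `uv` and `xy` of the straight-line drawing `p` of `H` cross. -/
def Crosses (H : SimpleGraph V) (p : V → ℂ) (u v x y : V) : Prop :=
  H.Adj u v ∧ H.Adj x y ∧ s(u, v) ≠ s(x, y) ∧
    (openSegment ℝ (p u) (p v) ∩ openSegment ℝ (p x) (p y)).Nonempty

/-- `p` is a straight-line RAC drawing of `H`: vertices are distinct points, no edge passes through
a vertex other than its ends, and crossing edges are perpendicular (so that edges do not overlap
either, not even edges with a common end). -/
structure IsRACDrawing (H : SimpleGraph V) (p : V → ℂ) : Prop where
  injective : Function.Injective p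
  vertex_edge : ∀ u v w : V, H.Adj u v → p w ∈ segment ℝ (p u) (p v) → w = u ∨ w = v
  right_angle : ∀ u v x y : V, Crosses H p u v x y → inner ℝ (p v - p u) (p y - p x) = 0

/-! ## Combinatorial embeddings -/

/-- The determinant of two plane vectors; it is positive if the counterclockwise angle from `z` to
`w` lies strictly between `0` and `π`. -/
def det (z w : ℂ) : ℝ := z.re * w.im - z.im * w.re

/-- The directions of `a`, `b`, `c` are distinct and occur in this counterclockwise cyclic order:
at least two of the three consecutive counterclockwise angles lie strictly between `0` and `π`. -/
def CyclicOrder (a b c : ℂ) : Prop :=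
  (0 < det a b ∧ 0 < det b c) ∨ (0 < det b c ∧ 0 < det c a) ∨ (0 < det c a ∧ 0 < det a b)

/-- The point of the segment from `p u` to `p v` with parameter `t`. -/
noncomputable def pointOn (p : V → ℂ) (u v : V) (t : ℝ) : ℂ := AffineMap.lineMap (p u) (p v) t

/-- The union of all the edges of the drawing. -/
def carrier (H : SimpleGraph V) (p : V → ℂ) : Set ℂ :=
  {z | ∃ u v : V, H.Adj u v ∧ z ∈ segment ℝ (p u) (p v)}

/-- The unbounded region of the complement of the drawing. -/
def outerFace (H : SimpleGraph V) (p : V → ℂ) : Set ℂ :=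
  {z | z ∉ carrier H p ∧ ¬ Bornology.IsBounded (connectedComponentIn (carrier H p)ᶜ z)}

/-- The (oriented, labelled) combinatorial data of a drawing of a connected graph, i.e. the
planarization with its rotation system and its outer face. -/
@[ext] structure PlaneData (V : Type*) where
  /-- `crossing u v x y`: the edges `uv` and `xy` cross. -/
  crossing : V → V → V → V → Prop
  /-- `order u v x y x' y'`: going from `u` to `v` along the edge `uv`, the crossing with `xy`
  comes before the crossing with `x'y'`. -/
  order : V → V → V → V → V → V → Prop
  /-- `rotation u x y z`: the edges `ux`, `uy`, `uz` leave `u` in this counterclockwise cyclic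
  order. -/
  rotation : V → V → V → V → Prop
  /-- `crossingSign u v x y`: the edge `uv` is crossed by `xy` from right to left, which is the
  rotation at this crossing. -/
  crossingSign : V → V → V → V → Prop
  /-- `outerLeft u v S`: the outer face lies to the left of that piece of the edge `uv`, directed
  from `u` to `v` and cut at its crossings, which comes after exactly the crossings with the edges
  in `S` (given as ordered pairs of ends, in both orders). -/
  outerLeft : V → V → Set (V × V) → Prop

/-- The combinatorial data of the straight-line drawing `p` of `H`. -/
def planeData (H : SimpleGraph V) (p : V → ℂ) : PlaneData V where
  crossing u v x y := Crosses H p u v x y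
  order u v x y x' y' := Crosses H p u v x y ∧ Crosses H p u v x' y' ∧
    ∃ s t : ℝ, 0 < s ∧ s < t ∧ t < 1 ∧
      pointOn p u v s ∈ segment ℝ (p x) (p y) ∧ pointOn p u v t ∈ segment ℝ (p x') (p y')
  rotation u x y z := H.Adj u x ∧ H.Adj u y ∧ H.Adj u z ∧
    CyclicOrder (p x - p u) (p y - p u) (p z - p u)
  crossingSign u v x y := Crosses H p u v x y ∧ 0 < det (p v - p u) (p y - p x)
  outerLeft u v S := H.Adj u v ∧ ∃ t : ℝ, 0 < t ∧ t < 1 ∧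
    (∀ x y : V, Crosses H p u v x y → pointOn p u v t ∉ segment ℝ (p x) (p y)) ∧
    S = {e : V × V | Crosses H p u v e.1 e.2 ∧
      ∃ s : ℝ, 0 < s ∧ s < t ∧ pointOn p u v s ∈ segment ℝ (p e.1) (p e.2)} ∧
    ∀ᶠ ε : ℝ in 𝓝[>] 0, pointOn p u v t + (ε : ℂ) * (Complex.I * (p v - p u)) ∈ outerFace H p

/-- The mirror image of a drawing. -/
def mirror (p : V → ℂ) : V → ℂ := fun v => (starRingEnd ℂ) (p v)

/-- The combinatorial embedding of a drawing: its combinatorial data up to reflection, i.e. the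
unordered pair of the data of the drawing and of its mirror image. -/
def combinatorialEmbedding (H : SimpleGraph V) (p : V → ℂ) : Sym2 (PlaneData V) :=
  s(planeData H p, planeData H (mirror p))

/-- The RAC combinatorial embeddings of `H`: those of its straight-line RAC drawings. -/
def racEmbeddings (H : SimpleGraph V) : Set (Sym2 (PlaneData V)) :=
  {E | ∃ p : V → ℂ, IsRACDrawing H p ∧ combinatorialEmbedding H p = E}

/-! ## The position of the two copies -/

/-- The points enclosed by a set `C` in the plane; for a simple closed curve, its interior. -/
def enclosed (C : Set ℂ) : Set ℂ :=
  {z | z ∉ C ∧ Bornology.IsBounded (connectedComponentIn Cᶜ z)}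

/-- The closed polygon formed in the drawing `p` by the quadrilateral `top` of the copy `φ`. -/
def topQuad (φ : AntiprismVertex ↪ V) (p : V → ℂ) : Set ℂ :=
  ⋃ k : ZMod 4, segment ℝ (p (φ (top k))) (p (φ (top (k + 1))))

/-- In the drawing `p`, the quadrilateral `top` is the outer quadrilateral of the copy `φ`: it is
drawn without crossings of its edges, and the five other vertices of the copy lie in its
interior. -/
structure TopIsOuter (H : SimpleGraph V) (φ : AntiprismVertex ↪ V) (p : V → ℂ) : Prop where
  planar : ∀ k l : ZMod 4, ¬ Crosses H p (φ (top k)) (φ (top (k + 1))) (φ (top l)) (φ (top (l + 1)))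
  center_mem : p (φ center) ∈ enclosed (topQuad φ p)
  bot_mem : ∀ k : ZMod 4, p (φ (bot k)) ∈ enclosed (topQuad φ p)

end Drawing

end RAC

/-!
The extension is a graph on sixteen vertices, and everything follows from the fact that crossing
edges are perpendicular, used in two ways. No edge crosses two edges with a common end
(`IsRACDrawing.fan`). Thus an edge with one end inside a triangle of the graph leaves it through a
side which no other edge at the same vertex uses (`IsRACDrawing.exit`, `IsRACDrawing.enter`), and
four edges cannot leave a triangle from a vertex inside (`IsRACDrawing.four_exits`). Moreover, a
vertex outside a triangle of the graph has at most one neighbour inside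
(`IsRACDrawing.unique_inside`), because edges to two such neighbours would be perpendicular to two
sides of the triangle that both face the vertex.

For a single copy, number the vertices other than the centre `o` by `c 0, …, c 7`, alternating
between the two quadrilaterals, so that vertices at cyclic distance one or two are adjacent
(`IsAntiprism`). The edges between consecutive vertices are not crossed by edges at `o`
(`IsAntiprism.not_crosses_rim`), and the triangles formed by them with `o` contain no vertex
(`IsAntiprism.not_inside_rim`), so that the vertices wind around `o` in their cyclic order
(`IsAntiprism.pos_of_pos`). Mark the vertices whose edge to `o` is crossed by the edge between their
two neighbours. No two consecutive vertices are marked, and three consecutive vertices are not all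
unmarked. Apart from one exceptional pattern, which would make two opposite angles of a
quadrilateral around `o` reflex, the marks therefore alternate (`IsAntiprism.Pos.alternate`): one of
the quadrilaterals surrounds the other one, and the edges from `o` to its vertices cross the sides
of the other one.

For two copies, the connectivity of each of them shows that a triangle of one copy contains no
further vertices of the other one, if it leaves a shared vertex outside
(`IsAntiprism.outside_of_outside`). This forces the shared vertices onto the outer quadrilaterals
(`IsGluedPair.outer`), and it makes all triangles that are used below empty. The triangle over the
shared side is an exception, since it has both shared vertices as corners; there the added edge,
called the link, is needed (`IsAntiprism.outside_of_shared`). Now an edge that crosses a side of an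
empty triangle ends at the opposite corner, the link crosses the shared side, and all crossings are
known (`IsPairDrawing.crossing_congr`). An empty triangle with an uncrossed side is moreover a
sector between consecutive edges at the opposite corner, which determines the rotations
(`IsPairDrawing.rotation_congr`).

The outer quadrilateral of a copy is star-shaped with respect to the centre, and its interior is
described by linear inequalities (`StarQuad.enclosed_boundary`). The two interiors do not meet
(`IsPairDrawing.disjoint_inside`), and apart from the crossing of the link they contain all edges
except the sides of the outer quadrilaterals. So the outer face can only touch the six unshared
sides from their outer sides (`IsPairDrawing.eq_of_leftPoint_mem`); it touches one of them, and it
passes from each of them to the next one around their common end (`IsPairDrawing.leftOuter`).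
Altogether, drawings in which both copies wind counterclockwise have the same combinatorial data
(`IsPairDrawing.planeData_eq`), and every drawing, or its mirror image, is of this kind
(`IsGluedPair.pairDrawing_or`). An explicit drawing with integer coordinates shows that there is one
(`IsGluedPair.exists_drawing`).
-/

open scoped Topology

namespace RAC

/-! ### Signed areas and triangles -/

/-- Twice the signed area of the triangle `abc`; it is positive if `a`, `b`, `c` are in
counterclockwise order. -/
def orient (a b c : ℂ) : ℝ := det (b - a) (c - a)

theorem orient_def (a b c : ℂ) :
    orient a b c = (b.re - a.re) * (c.im - a.im) - (b.im - a.im) * (c.re - a.re) := by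
  simp [orient, det]

theorem orient_rotate (a b c : ℂ) : orient b c a = orient a b c := by
  simp only [orient_def]; ring

theorem orient_swap (a b c : ℂ) : orient a c b = -orient a b c := by
  simp only [orient_def]; ring

theorem orient_swap' (a b c : ℂ) : orient b a c = -orient a b c := by
  simp only [orient_def]; ring

theorem inner_eq (z w : ℂ) : inner ℝ z w = z.re * w.re + z.im * w.im := by
  rw [Complex.inner]; simp; ring

theorem mem_segment_iff {a b z : ℂ} : z ∈ segment ℝ a b ↔ ∃ t : ℝ, 0 ≤ t ∧ t ≤ 1 ∧
    z.re = a.re + t * (b.re - a.re) ∧ z.im = a.im + t * (b.im - a.im) := by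
  rw [segment_eq_image']
  constructor
  · rintro ⟨t, ⟨h0, h1⟩, rfl⟩
    exact ⟨t, h0, h1, by simp, by simp⟩
  · rintro ⟨t, h0, h1, hre, him⟩
    exact ⟨t, ⟨h0, h1⟩, by apply Complex.ext <;> simp [hre, him]⟩

theorem mem_openSegment_iff {a b z : ℂ} : z ∈ openSegment ℝ a b ↔ ∃ t : ℝ, 0 < t ∧ t < 1 ∧
    z.re = a.re + t * (b.re - a.re) ∧ z.im = a.im + t * (b.im - a.im) := by
  rw [openSegment_eq_image']
  constructor
  · rintro ⟨t, ⟨h0, h1⟩, rfl⟩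
    exact ⟨t, h0, h1, by simp, by simp⟩
  · rintro ⟨t, h0, h1, hre, him⟩
    exact ⟨t, ⟨h0, h1⟩, by apply Complex.ext <;> simp [hre, him]⟩

/-- Two consecutive acute angles make up less than a straight angle. -/
theorem det_pos_of_acute {a z b : ℂ} (h1 : 0 < det a z) (h2 : 0 < det z b)
    (h3 : 0 < inner ℝ z a) (h4 : 0 < inner ℝ z b) : 0 < det a b := by
  have hz : 0 < z.re ^ 2 + z.im ^ 2 := by
    by_contra h
    have h5 : z.re = 0 := by nlinarith [sq_nonneg z.re, sq_nonneg z.im]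
    have h6 : z.im = 0 := by nlinarith [sq_nonneg z.re, sq_nonneg z.im]
    simp [det, h5, h6] at h1
  have key : (z.re ^ 2 + z.im ^ 2) * det a b = det a z * inner ℝ z b + inner ℝ z a * det z b := by
    simp only [det, inner_eq]; ring
  have : 0 < (z.re ^ 2 + z.im ^ 2) * det a b := by rw [key]; positivity
  exact pos_of_mul_pos_right this hz.le

/-- The point `z` lies in the open triangle `abc` (of either orientation). -/
def InTri (a b c z : ℂ) : Prop :=
  (0 < orient a b z ∧ 0 < orient b c z ∧ 0 < orient c a z) ∨
    (orient a b z < 0 ∧ orient b c z < 0 ∧ orient c a z < 0)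

theorem InTri.rotate {a b c z : ℂ} (h : InTri a b c z) : InTri b c a z := by
  unfold InTri at *; tauto

theorem InTri.swap {a b c z : ℂ} (h : InTri a b c z) : InTri b a c z := by
  unfold InTri at *
  rw [orient_swap' a b z, orient_swap' c a z, orient_swap' b c z]
  rcases h with ⟨h1, h2, h3⟩ | ⟨h1, h2, h3⟩
  · right; refine ⟨?_, ?_, ?_⟩ <;> linarith
  · left; refine ⟨?_, ?_, ?_⟩ <;> linarith

theorem orient_add (a b c z : ℂ) :
    orient a b z + orient b c z + orient c a z = orient a b c := by
  simp only [orient_def]; ring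

/-- A point of the line `ab` on the inner side of the other two sides of a triangle `abc` lies
between `a` and `b`. -/
theorem mem_segment_of_orient {a b c z : ℂ} (hS : 0 < orient a b c) (h0 : orient a b z = 0)
    (h1 : 0 ≤ orient b c z) (h2 : 0 ≤ orient c a z) : z ∈ segment ℝ a b := by
  have hadd := orient_add a b c z
  rw [mem_segment_iff]
  refine ⟨orient c a z / orient a b c, by positivity, ?_, ?_, ?_⟩
  · rw [div_le_one hS]; linarith
  · field_simp
    simp only [orient_def] at *
    linear_combination (c.re - a.re) * h0
  · field_simp
    simp only [orient_def] at *
    linear_combination (c.im - a.im) * h0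

/-- Positive quantities that change affinely, and do not all stay positive, reach a first time at
which one of them vanishes. -/
theorem exists_first_zero {ι : Type*} [Finite ι] {f g : ι → ℝ} (hf : ∀ i, 0 < f i)
    (hg : ∃ i, g i ≤ 0) : ∃ t : ℝ, 0 < t ∧ t ≤ 1 ∧ (∀ i, 0 ≤ f i + t * (g i - f i)) ∧
      ∃ i, f i + t * (g i - f i) = 0 := by
  obtain ⟨j, hj⟩ := hg
  have : Nonempty ι := ⟨j⟩
  obtain ⟨m, hm⟩ := Finite.exists_max (fun i => (f i - g i) / f i)
  have h1 : 1 ≤ (f m - g m) / f m := by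
    refine le_trans ?_ (hm j)
    rw [le_div_iff₀ (hf j)]; linarith
  have hmp : 0 < (f m - g m) / f m := by linarith
  refine ⟨((f m - g m) / f m)⁻¹, by positivity, inv_le_one_of_one_le₀ h1, fun i => ?_, m, ?_⟩
  · have h2 := hm i
    have h3 : ((f m - g m) / f m)⁻¹ * ((f i - g i) / f i) ≤ 1 := by
      rw [inv_mul_le_iff₀ hmp]; simpa using h2
    have h4 : f i + ((f m - g m) / f m)⁻¹ * (g i - f i)
        = f i * (1 - ((f m - g m) / f m)⁻¹ * ((f i - g i) / f i)) := by
      have := (hf i).ne'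
      field_simp
      ring
    rw [h4]
    exact mul_nonneg (hf i).le (by linarith)
  · have h5 : f m - g m ≠ 0 := by
      intro h; rw [h] at hmp; simp at hmp
    have := (hf m).ne'
    field_simp
    ring

theorem orient_lineMap (a b x y : ℂ) (t : ℝ) :
    orient a b (x + t * (y - x)) = orient a b x + t * (orient a b y - orient a b x) := by
  simp [orient_def]; ring

/-- The first point of the segment from a point of an open triangle to a point outside that lies
on the boundary of the triangle. -/
theorem exists_exit_pos {a b c x y : ℂ} (h1 : 0 < orient a b x) (h2 : 0 < orient b c x)
    (h3 : 0 < orient c a x) (hy : ¬ InTri a b c y) : ∃ t : ℝ, 0 < t ∧ t ≤ 1 ∧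
      (x + t * (y - x) ∈ segment ℝ a b ∨ x + t * (y - x) ∈ segment ℝ b c ∨
        x + t * (y - x) ∈ segment ℝ c a) := by
  have hS : 0 < orient a b c := by have := orient_add a b c x; linarith
  obtain ⟨t, ht0, ht1, hall, i, hi⟩ := exists_first_zero
    (f := ![orient a b x, orient b c x, orient c a x])
    (g := ![orient a b y, orient b c y, orient c a y])
    (by intro i; fin_cases i <;> simpa) (by
      by_contra hc
      push Not at hc
      exact hy (Or.inl ⟨hc 0, hc 1, hc 2⟩))
  have e0 := hall 0
  have e1 := hall 1
  have e2 := hall 2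
  simp only [Matrix.cons_val_zero, Matrix.cons_val_one, Matrix.cons_val,
    ← orient_lineMap] at e0 e1 e2
  refine ⟨t, ht0, ht1, ?_⟩
  have hS2 : 0 < orient b c a := by rwa [orient_rotate]
  have hS3 : 0 < orient c a b := by rwa [orient_rotate]
  fin_cases i
  · left
    simp only [Fin.zero_eta, Matrix.cons_val_zero, ← orient_lineMap] at hi
    exact mem_segment_of_orient hS hi e1 e2
  · right; left
    simp only [Fin.mk_one, Matrix.cons_val_one, Matrix.cons_val_zero, ← orient_lineMap] at hi
    exact mem_segment_of_orient hS2 hi e2 e0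
  · right; right
    simp only [Fin.reduceFinMk, Matrix.cons_val, ← orient_lineMap] at hi
    exact mem_segment_of_orient hS3 hi e0 e1

theorem exists_exit {a b c x y : ℂ} (hx : InTri a b c x) (hy : ¬ InTri a b c y) :
    ∃ t : ℝ, 0 < t ∧ t ≤ 1 ∧
      (x + t * (y - x) ∈ segment ℝ a b ∨ x + t * (y - x) ∈ segment ℝ b c ∨
        x + t * (y - x) ∈ segment ℝ c a) := by
  rcases hx with ⟨h1, h2, h3⟩ | ⟨h1, h2, h3⟩
  · exact exists_exit_pos h1 h2 h3 hy
  · obtain ⟨t, h0, h1, h⟩ := exists_exit_pos (a := b) (b := a) (c := c) (x := x) (y := y)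
      (by rw [orient_swap']; linarith) (by rw [orient_swap']; linarith)
      (by rw [orient_swap']; linarith) (fun h => hy h.swap)
    refine ⟨t, h0, h1, ?_⟩
    rw [segment_symm ℝ a b, segment_symm ℝ b c, segment_symm ℝ c a]
    tauto

/-! ### Crossings in a straight-line RAC drawing -/

section Drawing

variable {V : Type*} {H : SimpleGraph V} {p : V → ℂ}

theorem Crosses.symm {u v x y : V} (h : Crosses H p u v x y) : Crosses H p x y u v :=
  ⟨h.2.1, h.1, h.2.2.1.symm, by rw [Set.inter_comm]; exact h.2.2.2⟩

theorem Crosses.swap_left {u v x y : V} (h : Crosses H p u v x y) : Crosses H p v u x y :=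
  ⟨h.1.symm, h.2.1, by rw [Sym2.eq_swap]; exact h.2.2.1, by
    rw [openSegment_symm]; exact h.2.2.2⟩

theorem Crosses.swap_right {u v x y : V} (h : Crosses H p u v x y) : Crosses H p u v y x :=
  h.symm.swap_left.symm

/-- Two distinct edges with a common end leave it in different directions. -/
theorem IsRACDrawing.not_same_direction (hp : IsRACDrawing H p) {x y z : V} (hy : H.Adj x y)
    (hz : H.Adj x z) (hne : y ≠ z) {k : ℝ} (hk : 0 < k)
    (hre : (p z).re - (p x).re = k * ((p y).re - (p x).re))
    (him : (p z).im - (p x).im = k * ((p y).im - (p x).im)) : False := by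
  rcases le_total k 1 with h | h
  · have : p z ∈ segment ℝ (p x) (p y) :=
      mem_segment_iff.2 ⟨k, hk.le, h, by linarith, by linarith⟩
    rcases hp.vertex_edge _ _ _ hy this with h | h
    · exact hz.ne h.symm
    · exact hne h.symm
  · have : p y ∈ segment ℝ (p x) (p z) := by
      refine mem_segment_iff.2 ⟨k⁻¹, by positivity, inv_le_one_of_one_le₀ h, ?_, ?_⟩
      · rw [hre]; field_simp; ring
      · rw [him]; field_simp; ring
    rcases hp.vertex_edge _ _ _ hz this with h | h
    · exact hy.ne h.symm
    · exact hne h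

theorem det_ne_zero_of_inner {a b : ℂ} (ha : a ≠ 0) (hb : b ≠ 0) (h : inner ℝ a b = 0) :
    det a b ≠ 0 := by
  intro hd
  rw [inner_eq] at h
  simp only [det] at hd
  have h1 : (a.re ^ 2 + a.im ^ 2) * (b.re ^ 2 + b.im ^ 2) = 0 := by
    linear_combination (a.re * b.re + a.im * b.im) * h + (a.re * b.im - a.im * b.re) * hd
  rcases mul_eq_zero.1 h1 with h2 | h2
  · exact ha (Complex.ext (by simp; nlinarith [sq_nonneg a.re, sq_nonneg a.im])
      (by simp; nlinarith [sq_nonneg a.re, sq_nonneg a.im]))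
  · exact hb (Complex.ext (by simp; nlinarith [sq_nonneg b.re, sq_nonneg b.im])
      (by simp; nlinarith [sq_nonneg b.re, sq_nonneg b.im]))

/-- The parameters of a crossing. -/
theorem IsRACDrawing.cross_param (hp : IsRACDrawing H p) {u v x y : V}
    (h : Crosses H p u v x y) : ∃ s t D : ℝ, 0 < s ∧ s < 1 ∧ 0 < t ∧ t < 1 ∧ D ≠ 0 ∧
      D = det (p v - p u) (p y - p x) ∧
      orient (p u) (p v) (p x) = -(t * D) ∧ orient (p u) (p v) (p y) = (1 - t) * D ∧
      orient (p x) (p y) (p u) = s * D ∧ orient (p x) (p y) (p v) = -((1 - s) * D) ∧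
      (p u).re + s * ((p v).re - (p u).re) = (p x).re + t * ((p y).re - (p x).re) ∧
      (p u).im + s * ((p v).im - (p u).im) = (p x).im + t * ((p y).im - (p x).im) := by
  obtain ⟨z, hz1, hz2⟩ := h.2.2.2
  obtain ⟨s, hs0, hs1, hs2, hs3⟩ := mem_openSegment_iff.1 hz1
  obtain ⟨t, ht0, ht1, ht2, ht3⟩ := mem_openSegment_iff.1 hz2
  have e1 := hs2.symm.trans ht2
  have e2 := hs3.symm.trans ht3
  refine ⟨s, t, _, hs0, hs1, ht0, ht1, ?_, rfl, ?_, ?_, ?_, ?_, e1, e2⟩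
  · exact det_ne_zero_of_inner (sub_ne_zero.2 fun e => h.1.ne (hp.injective e).symm)
      (sub_ne_zero.2 fun e => h.2.1.ne (hp.injective e).symm) (hp.right_angle _ _ _ _ h)
  · simp only [orient_def, det, Complex.sub_re, Complex.sub_im]
    linear_combination ((p v).im - (p u).im) * e1 - ((p v).re - (p u).re) * e2
  · simp only [orient_def, det, Complex.sub_re, Complex.sub_im]
    linear_combination ((p v).im - (p u).im) * e1 - ((p v).re - (p u).re) * e2
  · simp only [orient_def, det, Complex.sub_re, Complex.sub_im]
    linear_combination -((p y).im - (p x).im) * e1 + ((p y).re - (p x).re) * e2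
  · simp only [orient_def, det, Complex.sub_re, Complex.sub_im]
    linear_combination -((p y).im - (p x).im) * e1 + ((p y).re - (p x).re) * e2

theorem IsRACDrawing.not_crosses_adjacent (hp : IsRACDrawing H p) {u v y : V} :
    ¬ Crosses H p u v u y := by
  intro h
  obtain ⟨s, t, D, -, -, ht, -, hD, -, h1, -⟩ := hp.cross_param h
  have : orient (p u) (p v) (p u) = 0 := by simp [orient_def]
  rw [this] at h1
  exact mul_ne_zero ht.ne' hD (by linarith)

/-- No edge crosses two edges with a common end: these would both be perpendicular to it. -/
theorem IsRACDrawing.fan (hp : IsRACDrawing H p) {u v x y z : V} (hy : Crosses H p u v x y)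
    (hz : Crosses H p u v x z) : y = z := by
  by_contra hne
  have i1 := hp.right_angle _ _ _ _ hy
  have i2 := hp.right_angle _ _ _ _ hz
  obtain ⟨s, t, D, -, -, ht, -, hD, hDe, h1, -⟩ := hp.cross_param hy
  obtain ⟨s', t', D', -, -, ht', -, hD', hDe', h1', -⟩ := hp.cross_param hz
  have hN : ((p v).re - (p u).re) ^ 2 + ((p v).im - (p u).im) ^ 2 ≠ 0 := by
    intro h0
    have h2 : (p v).re - (p u).re = 0 := by
      nlinarith [sq_nonneg ((p v).re - (p u).re), sq_nonneg ((p v).im - (p u).im)]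
    have h3 : (p v).im - (p u).im = 0 := by
      nlinarith [sq_nonneg ((p v).re - (p u).re), sq_nonneg ((p v).im - (p u).im)]
    exact hy.1.ne (hp.injective (Complex.ext (by linarith) (by linarith)))
  rw [inner_eq] at i1 i2
  simp only [det, Complex.sub_re, Complex.sub_im] at *
  -- the two edges leave `x` in the same direction
  have hk : 0 < D' / D := by
    have : D' / D = t / t' := by
      rw [div_eq_div_iff hD ht'.ne']; linarith
    rw [this]; positivity
  refine hp.not_same_direction hy.2.1 hz.2.1 hne hk ?_ ?_
  · rw [div_mul_eq_mul_div, eq_div_iff hD]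
    apply mul_left_cancel₀ hN
    rw [hDe, hDe']
    linear_combination ((((p v).re - (p u).re) * ((p y).im - (p x).im)
      - ((p v).im - (p u).im) * ((p y).re - (p x).re))
      * ((p v).re - (p u).re)) * i2
      - ((((p v).re - (p u).re) * ((p z).im - (p x).im)
      - ((p v).im - (p u).im) * ((p z).re - (p x).re))
      * ((p v).re - (p u).re)) * i1
  · rw [div_mul_eq_mul_div, eq_div_iff hD]
    apply mul_left_cancel₀ hN
    rw [hDe, hDe']
    linear_combination ((((p v).re - (p u).re) * ((p y).im - (p x).im)
      - ((p v).im - (p u).im) * ((p y).re - (p x).re))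
      * ((p v).im - (p u).im)) * i2
      - ((((p v).re - (p u).re) * ((p z).im - (p x).im)
      - ((p v).im - (p u).im) * ((p z).re - (p x).re))
      * ((p v).im - (p u).im)) * i1

/-- An interior point of the edge `xy` that lies on the edge `ab` is a crossing. -/
theorem IsRACDrawing.crosses_of_mem (hp : IsRACDrawing H p) {x y a b : V} (hxy : H.Adj x y)
    (hab : H.Adj a b) (ha : a ≠ x ∧ a ≠ y) (hb : b ≠ x ∧ b ≠ y) {z : ℂ}
    (hz : z ∈ openSegment ℝ (p x) (p y)) (hz' : z ∈ segment ℝ (p a) (p b)) :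
    Crosses H p x y a b := by
  refine ⟨hxy, hab, ?_, z, hz, ?_⟩
  · intro h
    rcases Sym2.eq_iff.1 h with ⟨h1, -⟩ | ⟨-, h1⟩
    · exact ha.1 h1.symm
    · exact ha.2 h1.symm
  · have hs := openSegment_subset_segment ℝ (p x) (p y) hz
    refine mem_openSegment_of_ne_left_right ?_ ?_ hz'
    · rintro rfl
      rcases hp.vertex_edge _ _ _ hxy hs with h | h
      exacts [ha.1 h, ha.2 h]
    · rintro rfl
      rcases hp.vertex_edge _ _ _ hxy hs with h | h
      exacts [hb.1 h, hb.2 h]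

/-- An edge from the inside of a triangle of the graph to its outside crosses one of the sides. -/
theorem IsRACDrawing.exit (hp : IsRACDrawing H p) {a b c x y : V} (hab : H.Adj a b)
    (hbc : H.Adj b c) (hca : H.Adj c a) (hxy : H.Adj x y) (ha : a ≠ y) (hb : b ≠ y)
    (hc : c ≠ y) (hx : InTri (p a) (p b) (p c) (p x)) (hy : ¬ InTri (p a) (p b) (p c) (p y)) :
    Crosses H p x y a b ∨ Crosses H p x y b c ∨ Crosses H p x y c a := by
  have hax : a ≠ x := by rintro rfl; simp [InTri, orient_def] at hx
  have hbx : b ≠ x := by rintro rfl; simp [InTri, orient_def] at hx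
  have hcx : c ≠ x := by rintro rfl; simp [InTri, orient_def] at hx
  obtain ⟨t, h0, h1, h⟩ := exists_exit hx hy
  have hlt : t < 1 := by
    rcases h1.lt_or_eq with h1 | rfl
    · exact h1
    · exfalso
      have e : p x + ((1 : ℝ) : ℂ) * (p y - p x) = p y := by push_cast; ring
      rw [e] at h
      rcases h with h | h | h
      · rcases hp.vertex_edge _ _ _ hab h with h | h
        exacts [ha h.symm, hb h.symm]
      · rcases hp.vertex_edge _ _ _ hbc h with h | h
        exacts [hb h.symm, hc h.symm]
      · rcases hp.vertex_edge _ _ _ hca h with h | h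
        exacts [hc h.symm, ha h.symm]
  have hz : p x + (t : ℂ) * (p y - p x) ∈ openSegment ℝ (p x) (p y) :=
    mem_openSegment_iff.2 ⟨t, h0, hlt, by simp, by simp⟩
  rcases h with h | h | h
  · exact Or.inl (hp.crosses_of_mem hxy hab ⟨hax, ha⟩ ⟨hbx, hb⟩ hz h)
  · exact Or.inr (Or.inl (hp.crosses_of_mem hxy hbc ⟨hbx, hb⟩ ⟨hcx, hc⟩ hz h))
  · exact Or.inr (Or.inr (hp.crosses_of_mem hxy hca ⟨hcx, hc⟩ ⟨hax, ha⟩ hz h))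

theorem Crosses.ne (hp : IsRACDrawing H p) {u v x y : V} (h : Crosses H p u v x y) :
    u ≠ x ∧ u ≠ y ∧ v ≠ x ∧ v ≠ y := by
  refine ⟨?_, ?_, ?_, ?_⟩ <;> rintro rfl
  · exact hp.not_crosses_adjacent h
  · exact hp.not_crosses_adjacent h.swap_right
  · exact hp.not_crosses_adjacent h.swap_left
  · exact hp.not_crosses_adjacent h.swap_left.swap_right

/-- Auxiliary form of `IsRACDrawing.enter`, for the end `x` on the side of `c`. -/
theorem IsRACDrawing.enter_pos (hp : IsRACDrawing H p) {a b c x y : V}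
    (hbc : H.Adj b c) (hca : H.Adj c a) (hxy : Crosses H p x y a b) (hcx : c ≠ x) (hcy : c ≠ y)
    (hS : 0 < orient (p a) (p b) (p c)) (hx : 0 < orient (p a) (p b) (p x)) :
    InTri (p a) (p b) (p c) (p x) := by
  by_contra hin
  obtain ⟨hxa, hxb, hya, hyb⟩ := Crosses.ne hp hxy
  obtain ⟨s, t, D, hs0, hs1, ht0, ht1, -, -, -, -, hx', -, e1, e2⟩ := hp.cross_param hxy
  have hnot : ¬ (0 < orient (p b) (p c) (p x) ∧ 0 < orient (p c) (p a) (p x)) :=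
    fun h => hin (Or.inl ⟨hx, h.1, h.2⟩)
  set z : ℂ := p x + (s : ℂ) * (p y - p x) with hz
  have hzre : z.re = (p a).re + t * ((p b).re - (p a).re) := by rw [← e1]; simp [hz]
  have hzim : z.im = (p a).im + t * ((p b).im - (p a).im) := by rw [← e2]; simp [hz]
  have g0 : orient (p a) (p b) z = 0 := by simp only [orient_def, hzre, hzim]; ring
  have g1 : orient (p b) (p c) z = (1 - t) * orient (p a) (p b) (p c) := by
    simp only [orient_def, hzre, hzim]; ring
  have g2 : orient (p c) (p a) z = t * orient (p a) (p b) (p c) := by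
    simp only [orient_def, hzre, hzim]; ring
  obtain ⟨r, hr0, hr1, hall, i, hi⟩ := exists_first_zero
    (f := ![orient (p b) (p c) z, orient (p c) (p a) z])
    (g := ![orient (p b) (p c) (p x), orient (p c) (p a) (p x)])
    (by
      have : 0 < 1 - t := by linarith
      intro i; fin_cases i
      · simp only [Fin.zero_eta, Matrix.cons_val_zero, g1]; positivity
      · simp only [Fin.mk_one, Matrix.cons_val_one, Matrix.cons_val_zero, g2]; positivity) (by
      by_contra hc
      push Not at hc
      exact hnot ⟨hc 0, hc 1⟩)
  have k0 := hall 0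
  have k1 := hall 1
  simp only [Matrix.cons_val_zero, Matrix.cons_val_one, ← orient_lineMap] at k0 k1
  have k2 : 0 ≤ orient (p a) (p b) (z + r * (p x - z)) := by
    rw [orient_lineMap, g0]; nlinarith
  -- the point at which the segment from the crossing to `x` leaves the triangle
  have hw : z + (r : ℂ) * (p x - z) ∈ segment ℝ (p x) (p y) := by
    refine mem_segment_iff.2 ⟨s * (1 - r), by nlinarith, by nlinarith, ?_, ?_⟩
    · simp [hz]; ring
    · simp [hz]; ring
  have hw' : z + (r : ℂ) * (p x - z) ∈ openSegment ℝ (p x) (p y) ∨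
      z + (r : ℂ) * (p x - z) = p x := by
    rcases hr1.lt_or_eq with h | rfl
    · left
      refine mem_openSegment_iff.2 ⟨s * (1 - r), by nlinarith, by nlinarith, ?_, ?_⟩
      · simp [hz]; ring
      · simp [hz]; ring
    · right; push_cast; ring
  have hSb : 0 < orient (p b) (p c) (p a) := by rwa [orient_rotate]
  have hSc : 0 < orient (p c) (p a) (p b) := by rwa [orient_rotate]
  fin_cases i
  · simp only [Fin.zero_eta, Matrix.cons_val_zero, ← orient_lineMap] at hi
    have hm := mem_segment_of_orient hSb hi k1 k2
    rcases hw' with hw' | hw'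
    · have := hp.crosses_of_mem hxy.1 hbc ⟨hxb.symm, hyb.symm⟩ ⟨hcx, hcy⟩ hw' hm
      exact hca.ne (hp.fan hxy.swap_right this).symm
    · rw [hw'] at hm
      rcases hp.vertex_edge _ _ _ hbc hm with h | h
      exacts [hxb h, hcx h.symm]
  · simp only [Fin.mk_one, Matrix.cons_val_one, Matrix.cons_val_zero, ← orient_lineMap] at hi
    have hm := mem_segment_of_orient hSc hi k2 k0
    rcases hw' with hw' | hw'
    · have := hp.crosses_of_mem hxy.1 hca.symm ⟨hxa.symm, hya.symm⟩ ⟨hcx, hcy⟩ hw'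
        (by rwa [segment_symm])
      exact hbc.ne (hp.fan hxy this)
    · rw [hw'] at hm
      rcases hp.vertex_edge _ _ _ hca hm with h | h
      exacts [hcx h.symm, hxa h]

/-- One of three collinear points lies between the two others. -/
theorem exists_pos_between {a b c : ℂ} (h : orient a b c = 0) :
    a ∈ segment ℝ b c ∨ b ∈ segment ℝ c a ∨ c ∈ segment ℝ a b := by
  have hcol : Collinear ℝ {a, b, c} := by
    by_cases hab : a = b
    · subst hab; simpa using collinear_pair ℝ a c
    rw [collinear_iff_of_mem (p₀ := a) (by simp)]
    refine ⟨b - a, ?_⟩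
    have hne : (b.re - a.re) ^ 2 + (b.im - a.im) ^ 2 ≠ 0 := by
      intro h0
      exact hab (Complex.ext (by nlinarith [sq_nonneg (b.re - a.re), sq_nonneg (b.im - a.im)])
        (by nlinarith [sq_nonneg (b.re - a.re), sq_nonneg (b.im - a.im)]))
    rw [orient_def] at h
    rintro q (rfl | rfl | rfl)
    · exact ⟨0, by simp⟩
    · exact ⟨1, by simp⟩
    · obtain ⟨k, hk⟩ : ∃ k : ℝ, k * ((b.re - a.re) ^ 2 + (b.im - a.im) ^ 2)
          = (b.re - a.re) * (q.re - a.re) + (b.im - a.im) * (q.im - a.im) :=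
        ⟨_, div_mul_cancel₀ _ hne⟩
      refine ⟨k, Complex.ext (mul_left_cancel₀ hne ?_) (mul_left_cancel₀ hne ?_)⟩
      · simp only [vadd_eq_add, Complex.add_re, Complex.real_smul, Complex.re_ofReal_mul,
          Complex.sub_re]
        linear_combination (-(b.im - a.im)) * h - (b.re - a.re) * hk
      · simp only [vadd_eq_add, Complex.add_im, Complex.real_smul, Complex.im_ofReal_mul,
          Complex.sub_im]
        linear_combination (b.re - a.re) * h - (b.im - a.im) * hk
  rcases hcol.wbtw_or_wbtw_or_wbtw with h | h | h
  · right; left; rw [segment_symm]; exact mem_segment_iff_wbtw.2 h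
  · right; right; rw [segment_symm]; exact mem_segment_iff_wbtw.2 h
  · left; rw [segment_symm]; exact mem_segment_iff_wbtw.2 h

/-- The vertices of a triangle of the graph are not collinear. -/
theorem IsRACDrawing.orient_ne_zero (hp : IsRACDrawing H p) {a b c : V} (hab : H.Adj a b)
    (hbc : H.Adj b c) (hca : H.Adj c a) : orient (p a) (p b) (p c) ≠ 0 := by
  intro h
  rcases exists_pos_between h with h | h | h
  · rcases hp.vertex_edge _ _ _ hbc h with h | h
    exacts [hab.ne h, hca.ne h.symm]
  · rcases hp.vertex_edge _ _ _ hca h with h | h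
    exacts [hbc.ne h, hab.ne h.symm]
  · rcases hp.vertex_edge _ _ _ hab h with h | h
    exacts [hca.ne h, hbc.ne h.symm]

/-- An edge that crosses a side of a triangle of the graph, and does not end at the opposite corner,
ends inside the triangle. -/
theorem IsRACDrawing.enter (hp : IsRACDrawing H p) {a b c x y : V}
    (hbc : H.Adj b c) (hca : H.Adj c a) (hxy : Crosses H p x y a b) (hcx : c ≠ x) (hcy : c ≠ y) :
    InTri (p a) (p b) (p c) (p x) ∨ InTri (p a) (p b) (p c) (p y) := by
  have hab := hxy.2.1
  wlog hS : 0 < orient (p a) (p b) (p c) generalizing a b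
  · have := this (a := b) (b := a) hca.symm hbc.symm hxy.swap_right hab.symm (by
      rw [orient_swap']
      have := hp.orient_ne_zero hab hbc hca
      have := lt_of_le_of_ne (not_lt.1 hS) this
      linarith)
    exact this.imp InTri.swap InTri.swap
  obtain ⟨s, t, D, hs0, hs1, ht0, ht1, hD, -, -, -, h1, h2, -⟩ := hp.cross_param hxy
  rcases lt_or_gt_of_ne hD with hD | hD
  · right
    refine hp.enter_pos hbc hca hxy.swap_left hcy hcx hS ?_
    rw [h2]; nlinarith
  · left
    refine hp.enter_pos hbc hca hxy hcx hcy hS ?_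
    rw [h1]; positivity

/-- An edge that crosses a side of a triangle does not have both ends inside. -/
theorem IsRACDrawing.not_both_inside (hp : IsRACDrawing H p) {a b c x y : V}
    (hxy : Crosses H p x y a b) (hx : InTri (p a) (p b) (p c) (p x))
    (hy : InTri (p a) (p b) (p c) (p y)) : False := by
  obtain ⟨s, t, D, hs0, hs1, ht0, ht1, hD, -, -, -, h1, h2, -⟩ := hp.cross_param hxy
  have hadd1 := orient_add (p a) (p b) (p c) (p x)
  have hadd2 := orient_add (p a) (p b) (p c) (p y)
  rcases hx with hx | hx <;> rcases hy with hy | hy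
  · have := hx.1; have := hy.1; nlinarith
  · linarith
  · linarith
  · have := hx.1; have := hy.1; nlinarith

/-- The foot of a crossing lies on the positive side of the end of the crossed edge. -/
theorem IsRACDrawing.inner_pos (hp : IsRACDrawing H p) {P q o y : V}
    (h : Crosses H p o y P q) : 0 < inner ℝ (p o - p P) (p q - p P) := by
  have hi := hp.right_angle _ _ _ _ h
  obtain ⟨s, t, D, hs0, hs1, ht0, ht1, hD, -, -, -, -, -, e1, e2⟩ := hp.cross_param h
  have hN : 0 < ((p q).re - (p P).re) ^ 2 + ((p q).im - (p P).im) ^ 2 := by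
    by_contra h0
    exact h.2.1.ne (hp.injective (Complex.ext
      (by nlinarith [sq_nonneg ((p q).re - (p P).re), sq_nonneg ((p q).im - (p P).im)])
      (by nlinarith [sq_nonneg ((p q).re - (p P).re), sq_nonneg ((p q).im - (p P).im)])))
  rw [inner_eq] at *
  simp only [Complex.sub_re, Complex.sub_im] at *
  have : ((p o).re - (p P).re) * ((p q).re - (p P).re) +
      ((p o).im - (p P).im) * ((p q).im - (p P).im)
      = t * (((p q).re - (p P).re) ^ 2 + ((p q).im - (p P).im) ^ 2) := by
    linear_combination ((p q).re - (p P).re) * e1 + ((p q).im - (p P).im) * e2 - s * hi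
  rw [this]; positivity

/-- Auxiliary form of `IsRACDrawing.unique_inside`: the two sides that are crossed are given. -/
theorem IsRACDrawing.unique_inside_aux (hp : IsRACDrawing H p) {P q r o y z : V}
    (hoy : Crosses H p o y P q) (hoz : Crosses H p o z P r)
    (hy : InTri (p P) (p q) (p r) (p y)) (hz : InTri (p P) (p q) (p r) (p z)) : False := by
  have hadd1 := orient_add (p P) (p q) (p r) (p y)
  have hadd2 := orient_add (p P) (p q) (p r) (p z)
  have i1 := hp.inner_pos hoy
  have i2 := hp.inner_pos hoz
  obtain ⟨s, t, D, hs0, hs1, ht0, ht1, hD, -, -, -, h1, h2, -⟩ := hp.cross_param hoy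
  obtain ⟨s', t', D', hs0', hs1', ht0', ht1', hD', -, -, -, h1', h2', -⟩ := hp.cross_param hoz
  have e1 : det (p o - p P) (p q - p P) = -orient (p P) (p q) (p o) := by
    simp only [orient, det]; ring
  have e2 : det (p r - p P) (p o - p P) = orient (p P) (p r) (p o) := rfl
  have e3 : det (p r - p P) (p q - p P) = - orient (p P) (p q) (p r) := by
    simp only [orient, det]; ring
  have e4 := orient_swap' (p P) (p r) (p z)
  rcases hy with hy | hy <;> rcases hz with hz | hz
  · have hd : D < 0 := by have := hy.1; rw [h2] at this; nlinarith
    have hd' : 0 < D' := by have := hz.2.2; rw [e4, h2'] at this; nlinarith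
    have k1 : 0 < det (p r - p P) (p o - p P) := by rw [e2, h1']; positivity
    have k2 : 0 < det (p o - p P) (p q - p P) := by rw [e1, h1]; nlinarith
    have := det_pos_of_acute k1 k2 i2 i1
    linarith
  · linarith
  · linarith
  · have hd : 0 < D := by have := hy.1; rw [h2] at this; nlinarith
    have hd' : D' < 0 := by have := hz.2.2; rw [e4, h2'] at this; nlinarith
    have e2' : det (p o - p P) (p r - p P) = -orient (p P) (p r) (p o) := by
      simp only [orient, det]; ring
    have e1' : det (p q - p P) (p o - p P) = orient (p P) (p q) (p o) := rfl
    have e3' : det (p q - p P) (p r - p P) = orient (p P) (p q) (p r) := rfl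
    have k1 : 0 < det (p o - p P) (p r - p P) := by rw [e2', h1']; nlinarith
    have k2 : 0 < det (p q - p P) (p o - p P) := by rw [e1', h1]; positivity
    have := det_pos_of_acute k2 k1 i1 i2
    linarith

/-- A vertex outside a triangle of the graph has at most one neighbour inside: the edges to two such
neighbours would be perpendicular to two sides of the triangle, which is impossible from a point
that sees both. -/
theorem IsRACDrawing.unique_inside (hp : IsRACDrawing H p) {a b c o y z : V} (hab : H.Adj a b)
    (hbc : H.Adj b c) (hca : H.Adj c a) (hoy : H.Adj o y) (hoz : H.Adj o z) (ha : a ≠ o)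
    (hb : b ≠ o) (hc : c ≠ o) (ho : ¬ InTri (p a) (p b) (p c) (p o))
    (hy : InTri (p a) (p b) (p c) (p y)) (hz : InTri (p a) (p b) (p c) (p z)) : y = z := by
  by_contra hne
  have hfan : ∀ {u v : V}, Crosses H p y o u v → Crosses H p z o u v → False :=
    fun h1 h2 => hne (hp.fan h1.symm.swap_right h2.symm.swap_right)
  rcases hp.exit hab hbc hca hoy.symm ha hb hc hy ho with h1 | h1 | h1 <;>
    rcases hp.exit hab hbc hca hoz.symm ha hb hc hz ho with h2 | h2 | h2
  · exact hfan h1 h2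
  · exact hp.unique_inside_aux h1.swap_left.swap_right h2.swap_left hy.swap hz.swap
  · exact hp.unique_inside_aux h1.swap_left h2.swap_left.swap_right hy hz
  · exact hp.unique_inside_aux h1.swap_left h2.swap_left.swap_right hy.rotate hz.rotate
  · exact hfan h1 h2
  · exact hp.unique_inside_aux h1.swap_left.swap_right h2.swap_left
      hy.rotate.swap hz.rotate.swap
  · exact hp.unique_inside_aux h1.swap_left.swap_right h2.swap_left
      hy.rotate.rotate.swap hz.rotate.rotate.swap
  · exact hp.unique_inside_aux h1.swap_left h2.swap_left.swap_right hy.rotate.rotate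
      hz.rotate.rotate
  · exact hfan h1 h2

end Drawing

section Drawing

variable {V : Type*} {H : SimpleGraph V} {p : V → ℂ}

/-- Each of two crossing edges separates the ends of the other one. -/
theorem IsRACDrawing.orient_mul_neg (hp : IsRACDrawing H p) {u v x y : V}
    (h : Crosses H p u v x y) : orient (p u) (p v) (p x) * orient (p u) (p v) (p y) < 0 := by
  obtain ⟨s, t, D, hs0, hs1, ht0, ht1, hD, -, h1, h2, -⟩ := hp.cross_param h
  rw [h1, h2]
  have : 0 < D ^ 2 := by positivity
  have : 0 < t * (1 - t) := mul_pos ht0 (by linarith)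
  nlinarith

/-- Two edges cross if each of them separates the ends of the other one. -/
theorem crosses_of_orient {u v x y : V} (huv : H.Adj u v) (hxy : H.Adj x y)
    (h1 : orient (p u) (p v) (p x) * orient (p u) (p v) (p y) < 0)
    (h2 : orient (p x) (p y) (p u) * orient (p x) (p y) (p v) < 0) : Crosses H p u v x y := by
  refine ⟨huv, hxy, ?_, ?_⟩
  · intro h
    have : orient (p u) (p v) (p x) = 0 := by
      rcases Sym2.eq_iff.1 h with ⟨rfl, rfl⟩ | ⟨rfl, rfl⟩ <;> simp only [orient_def] <;> ring
    rw [this] at h1; simp at h1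
  · set A := orient (p u) (p v) (p x)
    set B := orient (p u) (p v) (p y)
    set C := orient (p x) (p y) (p u)
    set E := orient (p x) (p y) (p v)
    have hAB : A - B ≠ 0 := by
      intro h
      rw [sub_eq_zero.1 h] at h1
      nlinarith [mul_self_nonneg B]
    have hCE : C - E ≠ 0 := by
      intro h
      rw [sub_eq_zero.1 h] at h2
      nlinarith [mul_self_nonneg E]
    have key : ∀ a b : ℝ, a * b < 0 → 0 < a / (a - b) ∧ a / (a - b) < 1 := by
      intro a b hab
      rcases lt_trichotomy a 0 with ha | rfl | ha
      · have hb : 0 < b := by nlinarith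
        constructor
        · exact div_pos_of_neg_of_neg ha (by linarith)
        · rw [div_lt_one_of_neg (by linarith)]; linarith
      · simp at hab
      · have hb : b < 0 := by nlinarith
        constructor
        · exact div_pos ha (by linarith)
        · rw [div_lt_one (by linarith)]; linarith
    obtain ⟨t, ht⟩ : ∃ t, t = A / (A - B) := ⟨_, rfl⟩
    obtain ⟨s, hs⟩ : ∃ s, s = C / (C - E) := ⟨_, rfl⟩
    have hS := key C E h2
    have hT := key A B h1
    rw [← hs] at hS
    rw [← ht] at hT
    refine ⟨p x + t * (p y - p x), mem_openSegment_iff.2 ⟨s, hS.1, hS.2, ?_, ?_⟩,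
      mem_openSegment_iff.2 ⟨t, hT.1, hT.2, by simp, by simp⟩⟩
    all_goals
      have hCA : C - E = -(A - B) := by simp only [A, B, C, E, orient_def]; ring
      have ht' : t * (A - B) = A := by rw [ht]; field_simp
      have hs' : s * (A - B) = -C := by
        have : s * (C - E) = C := by rw [hs]; field_simp
        rw [hCA] at this; linarith
      apply mul_left_cancel₀ hAB
      simp only [Complex.add_re, Complex.re_ofReal_mul, Complex.sub_re, Complex.add_im,
        Complex.im_ofReal_mul, Complex.sub_im]
    · have e : (A - B) * ((p x).re - (p u).re) + A * ((p y).re - (p x).re)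
          + C * ((p v).re - (p u).re) = 0 := by
        simp only [A, B, C, orient_def]; ring
      linear_combination e + ((p y).re - (p x).re) * ht' - ((p v).re - (p u).re) * hs'
    · have e : (A - B) * ((p x).im - (p u).im) + A * ((p y).im - (p x).im)
          + C * ((p v).im - (p u).im) = 0 := by
        simp only [A, B, C, orient_def]; ring
      linear_combination e + ((p y).im - (p x).im) * ht' - ((p v).im - (p u).im) * hs'

theorem orient_self_left (a b : ℂ) : orient a b a = 0 := by simp only [orient_def]; ring

theorem orient_self_right (a b : ℂ) : orient a b b = 0 := by simp only [orient_def]; ring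

/-- A vertex in the angle at `o` of a triangle `uwo` of the graph lies inside the triangle, or its
edge to `o` crosses `uw`. -/
theorem IsRACDrawing.wedge (hp : IsRACDrawing H p) {o u w z : V} (huw : H.Adj u w)
    (hoz : H.Adj o z) (hS : 0 < orient (p o) (p u) (p w)) (h1 : 0 < orient (p o) (p u) (p z))
    (h2 : 0 < orient (p o) (p z) (p w)) :
    InTri (p u) (p w) (p o) (p z) ∨ Crosses H p o z u w := by
  have hS' : 0 < orient (p u) (p w) (p o) := by rwa [orient_rotate]
  have h2' : 0 < orient (p w) (p o) (p z) := by rwa [← orient_rotate]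
  rcases lt_trichotomy (orient (p u) (p w) (p z)) 0 with h | h | h
  · right
    refine crosses_of_orient hoz huw ?_ ?_
    · rw [orient_swap]; nlinarith
    · nlinarith
  · exfalso
    rcases hp.vertex_edge _ _ _ huw (mem_segment_of_orient hS' h h2'.le h1.le) with rfl | rfl
    · rw [orient_self_right] at h1; exact lt_irrefl _ h1
    · rw [orient_self_right] at h2; exact lt_irrefl _ h2
  · exact Or.inl (Or.inl ⟨h, h2', h1⟩)

/-- The line through two points of a proper angle at `o` does not pass through `o`. -/
theorem IsRACDrawing.orient_ne_zero_of_pos (hp : IsRACDrawing H p) {o a x y : V} (hx : H.Adj o x)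
    (hy : H.Adj o y) (hne : x ≠ y) (h1 : 0 < orient (p o) (p a) (p x))
    (h2 : 0 < orient (p o) (p a) (p y)) : orient (p o) (p x) (p y) ≠ 0 := by
  intro h0
  refine hp.not_same_direction hx hy hne (div_pos h2 h1) ?_ ?_
  all_goals
    rw [div_mul_eq_mul_div, eq_div_iff h1.ne']
    simp only [orient_def] at *
  · linear_combination ((p o).re - (p a).re) * h0
  · linear_combination ((p o).im - (p a).im) * h0

/-- If four edges run from a vertex inside a triangle of the graph to vertices outside, two of them
cross the same side. -/
theorem IsRACDrawing.four_exits (hp : IsRACDrawing H p) {a b c x : V} (hab : H.Adj a b)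
    (hbc : H.Adj b c) (hca : H.Adj c a) (hx : InTri (p a) (p b) (p c) (p x)) {y : Fin 4 → V}
    (hinj : Function.Injective y) (hadj : ∀ i, H.Adj x (y i))
    (hout : ∀ i, ¬ InTri (p a) (p b) (p c) (p (y i)))
    (hcor : ∀ i, a ≠ y i ∧ b ≠ y i ∧ c ≠ y i) : False := by
  have h : ∀ i, ∃ k : Fin 3, Crosses H p x (y i) (![a, b, c] k) (![b, c, a] k) := by
    intro i
    rcases hp.exit hab hbc hca (hadj i) (hcor i).1 (hcor i).2.1 (hcor i).2.2 hx (hout i)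
      with h | h | h
    exacts [⟨0, h⟩, ⟨1, h⟩, ⟨2, h⟩]
  choose f hf using h
  obtain ⟨i, j, hij, he⟩ := Fintype.exists_ne_map_eq_of_card_lt f (by simp)
  have h1 := hf i
  rw [he] at h1
  exact hij (hinj (hp.fan h1.symm (hf j).symm))

/-- If `ox` crosses `uw`, and `x` lies inside the triangle `uwz`, then the edges from `x` to other
common neighbours of `o` and `x` leave the triangle through the two sides at `z`. -/
theorem IsRACDrawing.exit_two (hp : IsRACDrawing H p) {o x u w z y : V}
    (hc : Crosses H p o x u w) (hwz : H.Adj w z) (hzu : H.Adj z u) (hoz : o ≠ z)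
    (hin : InTri (p u) (p w) (p z) (p x)) (hoy : H.Adj o y) (hxy : H.Adj x y) (hu : u ≠ y)
    (hw : w ≠ y) (hz : z ≠ y) : Crosses H p x y w z ∨ Crosses H p x y z u := by
  obtain ⟨hou, how, hxu, hxw⟩ := Crosses.ne hp hc
  have ho : ¬ InTri (p u) (p w) (p z) (p o) := fun h => hp.not_both_inside hc h hin
  have hy : ¬ InTri (p u) (p w) (p z) (p y) := fun h => hxy.ne
    (hp.unique_inside hc.2.1 hwz hzu hc.1 hoy hou.symm how.symm hoz.symm ho hin h)
  rcases hp.exit hc.2.1 hwz hzu hxy hu hw hz hin hy with h | h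
  · exact absurd (hp.fan hc.swap_left.symm h.symm) hoy.ne
  · exact h

/-- The case of `IsRACDrawing.not_crosses_of_three` in which `x`, rather than `o`, lies inside the
triangle `uwz`. -/
theorem IsRACDrawing.not_crosses_of_three_aux (hp : IsRACDrawing H p) {o x u w z : V}
    (hc : Crosses H p o x u w) (hwz : H.Adj w z) (hzu : H.Adj z u) (hoz : o ≠ z)
    (hin : InTri (p u) (p w) (p z) (p x)) {y : Fin 3 → V} (hinj : Function.Injective y)
    (hoy : ∀ i, H.Adj o (y i)) (hxy : ∀ i, H.Adj x (y i))
    (hne : ∀ i, u ≠ y i ∧ w ≠ y i ∧ z ≠ y i) : False := by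
  have h : ∀ i, ∃ k : Fin 2, Crosses H p x (y i) z (![w, u] k) := by
    intro i
    rcases hp.exit_two hc hwz hzu hoz hin (hoy i) (hxy i) (hne i).1 (hne i).2.1 (hne i).2.2
      with h | h
    exacts [⟨0, h.swap_right⟩, ⟨1, h⟩]
  -- only two sides are available for the three edges
  choose f hf using h
  obtain ⟨i, j, hij, he⟩ := Fintype.exists_ne_map_eq_of_card_lt f (by simp)
  have h1 := hf i
  rw [he] at h1
  exact hij (hinj (hp.fan h1.symm (hf j).symm))

/-- The edge `ox` does not cross `uw` if `o` and `x` have three common neighbours besides `u`, `w`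
and a common neighbour `z` of these. -/
theorem IsRACDrawing.not_crosses_of_three (hp : IsRACDrawing H p) {o x u w z : V}
    (hwz : H.Adj w z) (hzu : H.Adj z u) (hoz : o ≠ z) (hxz : x ≠ z) {y : Fin 3 → V}
    (hinj : Function.Injective y) (hoy : ∀ i, H.Adj o (y i)) (hxy : ∀ i, H.Adj x (y i))
    (hne : ∀ i, u ≠ y i ∧ w ≠ y i ∧ z ≠ y i) : ¬ Crosses H p o x u w := by
  intro hc
  rcases hp.enter hwz hzu hc hoz.symm hxz.symm with h | h
  · exact hp.not_crosses_of_three_aux hc.swap_left hwz hzu hxz h hinj hxy hoy hne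
  · exact hp.not_crosses_of_three_aux hc hwz hzu hoz h hinj hoy hxy hne

/-- Two edges `xy₁`, `xy₂` with adjacent ends do not leave the triangle `uwz` of the graph through
its two sides at `z`, one through each. -/
theorem IsRACDrawing.not_straddle (hp : IsRACDrawing H p) {o x u w z y₁ y₂ : V}
    (hou : H.Adj o u) (how : H.Adj o w) (hoz : H.Adj o z) (hox : x ≠ o) (hoy₁ : y₁ ≠ o)
    (hoy₂ : y₂ ≠ o) (huw : u ≠ w) (huy₂ : y₂ ≠ u) (hwy₁ : y₁ ≠ w) (hy : H.Adj y₁ y₂)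
    (h1 : Crosses H p x y₁ z u) (h2 : Crosses H p x y₂ z w)
    (hno : ¬ Crosses H p o z y₁ y₂) : False := by
  obtain ⟨hxz, hxu, hyz, hyu⟩ := Crosses.ne hp h1
  obtain ⟨-, hxw, hyz', hyw⟩ := Crosses.ne hp h2
  have hxy₁ := h1.1
  have hxy₂ := h2.1
  have t1 := hp.enter hy hxy₂.symm h1.symm hyz' huy₂
  have t2 := hp.enter hy.symm hxy₁.symm h2.symm hyz hwy₁
  by_cases hz : InTri (p x) (p y₁) (p y₂) (p z)
  · by_cases ho : InTri (p x) (p y₁) (p y₂) (p o)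
    · have hu := fun h => hp.not_both_inside h1.symm hz h
      exact hoz.ne' (hp.unique_inside hxy₁ hy hxy₂.symm h1.2.1.symm hou.symm hxu hyu huy₂ hu hz ho)
    · rcases hp.exit hxy₁ hy hxy₂.symm hoz.symm hox hoy₁ hoy₂ hz ho with h | h | h
      · exact hou.ne (hp.fan h.symm h1)
      · exact hno h.swap_left
      · exact how.ne (hp.fan h.symm.swap_left h2)
  · have hu := t1.resolve_left hz
    have hw := t2.resolve_left fun h => hz h.rotate.rotate.swap
    exact huw (hp.unique_inside hxy₁ hy hxy₂.symm h1.2.1 h2.2.1 hxz hyz hyz' hz hu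
      hw.rotate.rotate.swap)

/-- The edge `ox` does not cross `uw` if `o` and `x` have two adjacent common neighbours `y₁`, `y₂`
besides `u`, `w` and a common neighbour `z` of these, provided that `oz` does not cross `y₁y₂`, and
`oy₁`, `oy₂` do not cross `zw`. -/
theorem IsRACDrawing.not_crosses_of_two (hp : IsRACDrawing H p) {o x u w z y₁ y₂ : V}
    (hwz : H.Adj w z) (hzu : H.Adj z u) (hou : H.Adj o u) (how : H.Adj o w) (hoz : H.Adj o z)
    (hxz : x ≠ z) (hoy₁ : H.Adj o y₁) (hoy₂ : H.Adj o y₂) (hxy₁ : H.Adj x y₁) (hxy₂ : H.Adj x y₂)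
    (hy : H.Adj y₁ y₂) (hy₁ : u ≠ y₁ ∧ w ≠ y₁ ∧ z ≠ y₁) (hy₂ : u ≠ y₂ ∧ w ≠ y₂ ∧ z ≠ y₂)
    (hno : ¬ Crosses H p o z y₁ y₂) (hno₁ : ¬ Crosses H p o y₁ w z)
    (hno₂ : ¬ Crosses H p o y₂ w z) : ¬ Crosses H p o x u w := by
  intro hc
  rcases hp.enter hwz hzu hc hoz.ne' hxz.symm with h | h
  · have h1 := (hp.exit_two hc.swap_left hwz hzu hxz h hxy₁ hoy₁ hy₁.1 hy₁.2.1
      hy₁.2.2).resolve_left hno₁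
    have h2 := (hp.exit_two hc.swap_left hwz hzu hxz h hxy₂ hoy₂ hy₂.1 hy₂.2.1
      hy₂.2.2).resolve_left hno₂
    exact hy.ne (hp.fan h1.symm h2.symm)
  · rcases hp.exit_two hc hwz hzu hoz.ne h hoy₁ hxy₁ hy₁.1 hy₁.2.1 hy₁.2.2 with h1 | h1 <;>
      rcases hp.exit_two hc hwz hzu hoz.ne h hoy₂ hxy₂ hy₂.1 hy₂.2.1 hy₂.2.2 with h2 | h2
    · exact hy.ne (hp.fan h1.symm h2.symm)
    · exact hp.not_straddle how hou hoz hc.1.ne' hoy₁.ne' hoy₂.ne' hc.2.1.ne' hy₂.2.1.symm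
        hy₁.1.symm hy h1.swap_right h2 hno
    · exact hp.not_straddle hou how hoz hc.1.ne' hoy₁.ne' hoy₂.ne' hc.2.1.ne hy₂.1.symm
        hy₁.2.1.symm hy h1 h2.swap_right hno
    · exact hy.ne (hp.fan h1.symm h2.symm)

/-- If an edge of a triangle of the graph is the only side of `uwo` that the edges of another
triangle `xyz` cross, then `x` and `y` are on the same side of the boundary of `uwo`. -/
theorem IsRACDrawing.not_split (hp : IsRACDrawing H p) {u w o x y z : V} (huw : H.Adj u w)
    (hwo : H.Adj w o) (hou : H.Adj o u) (hxy : H.Adj x y) (hyz : H.Adj y z) (hzx : H.Adj z x)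
    (hx : u ≠ x ∧ w ≠ x ∧ o ≠ x) (hy : u ≠ y ∧ w ≠ y ∧ o ≠ y) (hz : u ≠ z ∧ w ≠ z ∧ o ≠ z)
    (h1 : ¬ Crosses H p x y w o) (h2 : ¬ Crosses H p x y o u) (h3 : ¬ Crosses H p y z w o)
    (h4 : ¬ Crosses H p y z o u) (h5 : ¬ Crosses H p z x w o) (h6 : ¬ Crosses H p z x o u)
    (hin : InTri (p u) (p w) (p o) (p x)) : InTri (p u) (p w) (p o) (p y) := by
  by_contra hout
  have c1 : Crosses H p x y u w := by
    have := hp.exit huw hwo hou hxy hy.1 hy.2.1 hy.2.2 hin hout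
    tauto
  by_cases hzi : InTri (p u) (p w) (p o) (p z)
  · have c2 : Crosses H p z y u w := by
      have := hp.exit huw hwo hou hyz.symm hy.1 hy.2.1 hy.2.2 hzi hout
      rcases this with h | h | h
      · exact h
      · exact absurd h.swap_left h3
      · exact absurd h.swap_left h4
    exact hzx.ne (hp.fan c2.symm.swap_right c1.symm.swap_right)
  · have c2 : Crosses H p x z u w := by
      have := hp.exit huw hwo hou hzx.symm hz.1 hz.2.1 hz.2.2 hin hzi
      rcases this with h | h | h
      · exact h
      · exact absurd h.swap_left h5
      · exact absurd h.swap_left h6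
    exact hyz.ne (hp.fan c1.symm c2.symm)

end Drawing

/-! ### One copy of the graph -/

/-- The vertices `o` and `c 0, …, c 7` of `H` span an augmented square antiprism: the vertices
`c m`, in this cyclic order, alternate between the two quadrilaterals, so that vertices at cyclic
distance one or two are adjacent, and `o` is the central vertex. -/
structure IsAntiprism {V : Type*} (H : SimpleGraph V) (o : V) (c : ZMod 8 → V) : Prop where
  injective : Function.Injective c
  spoke : ∀ m, H.Adj o (c m)
  rim : ∀ m, H.Adj (c m) (c (m + 1))
  quad : ∀ m, H.Adj (c m) (c (m + 2))

theorem zmod_eight_cases (j : ZMod 8) :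
    j = 0 ∨ j = 1 ∨ j = 2 ∨ j = 3 ∨ j = 4 ∨ j = 5 ∨ j = 6 ∨ j = 7 := by
  decide +revert

namespace IsAntiprism

variable {V : Type*} {H : SimpleGraph V} {p : V → ℂ} {o : V} {c : ZMod 8 → V}

theorem shift (w : IsAntiprism H o c) (k : ZMod 8) : IsAntiprism H o fun m => c (m + k) where
  injective _ _ h := add_right_cancel (w.injective h)
  spoke m := w.spoke _
  rim m := by rw [add_right_comm]; exact w.rim _
  quad m := by rw [add_right_comm]; exact w.quad _

theorem reflect (w : IsAntiprism H o c) (k : ZMod 8) : IsAntiprism H o fun m => c (k - m) where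
  injective _ _ h := sub_right_injective (w.injective h)
  spoke m := w.spoke _
  rim m := by
    have := w.rim (k - (m + 1))
    rw [show k - (m + 1) + 1 = k - m by ring] at this
    exact this.symm
  quad m := by
    have := w.quad (k - (m + 2))
    rw [show k - (m + 2) + 2 = k - m by ring] at this
    exact this.symm

theorem ne (w : IsAntiprism H o c) {m n : ZMod 8} (h : m ≠ n) : c m ≠ c n :=
  fun e => h (w.injective e)

theorem center_ne (w : IsAntiprism H o c) (m : ZMod 8) : o ≠ c m := (w.spoke m).ne

theorem adj (w : IsAntiprism H o c) {m n : ZMod 8}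
    (h : n = m + 1 ∨ n = m + 2 ∨ m = n + 1 ∨ m = n + 2) : H.Adj (c m) (c n) := by
  rcases h with rfl | rfl | rfl | rfl
  exacts [w.rim _, w.quad _, (w.rim _).symm, (w.quad _).symm]

theorem injective_three (w : IsAntiprism H o c) {i j k : ZMod 8} (h : i ≠ j ∧ i ≠ k ∧ j ≠ k) :
    Function.Injective ![c i, c j, c k] := by
  have h1 := w.ne h.1
  have h2 := w.ne h.2.1
  have h3 := w.ne h.2.2
  intro a b hab
  fin_cases a <;> fin_cases b <;> simp_all

/-- The edge from `o` to `c j` does not cross the edge `uv` if three neighbours of `c j` are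
different from `u`, `v` and a common neighbour of these. -/
theorem spoke_three (w : IsAntiprism H o c) (hp : IsRACDrawing H p) (j u v z i₀ i₁ i₂ : ZMod 8)
    (hvz : z = v + 1 ∨ z = v + 2 ∨ v = z + 1 ∨ v = z + 2)
    (hzu : u = z + 1 ∨ u = z + 2 ∨ z = u + 1 ∨ z = u + 2) (hz : j ≠ z)
    (h₀ : i₀ = j + 1 ∨ i₀ = j + 2 ∨ j = i₀ + 1 ∨ j = i₀ + 2)
    (h₁ : i₁ = j + 1 ∨ i₁ = j + 2 ∨ j = i₁ + 1 ∨ j = i₁ + 2)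
    (h₂ : i₂ = j + 1 ∨ i₂ = j + 2 ∨ j = i₂ + 1 ∨ j = i₂ + 2)
    (hi : i₀ ≠ i₁ ∧ i₀ ≠ i₂ ∧ i₁ ≠ i₂) (g₀ : u ≠ i₀ ∧ v ≠ i₀ ∧ z ≠ i₀)
    (g₁ : u ≠ i₁ ∧ v ≠ i₁ ∧ z ≠ i₁) (g₂ : u ≠ i₂ ∧ v ≠ i₂ ∧ z ≠ i₂) :
    ¬ Crosses H p o (c j) (c u) (c v) := by
  refine hp.not_crosses_of_three (w.adj hvz) (w.adj hzu) (w.center_ne z) (w.ne hz)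
    (w.injective_three hi) ?_ ?_ ?_
  · intro i; fin_cases i <;> exact w.spoke _
  · intro i; fin_cases i
    exacts [w.adj h₀, w.adj h₁, w.adj h₂]
  · intro i; fin_cases i
    exacts [⟨w.ne g₀.1, w.ne g₀.2.1, w.ne g₀.2.2⟩, ⟨w.ne g₁.1, w.ne g₁.2.1, w.ne g₁.2.2⟩,
      ⟨w.ne g₂.1, w.ne g₂.2.1, w.ne g₂.2.2⟩]

/-- The edge between two consecutive vertices is not crossed by the edges from the centre to the
four vertices that are farther away; these have enough neighbours elsewhere. -/
theorem not_crosses_rim_far (w : IsAntiprism H o c) (hp : IsRACDrawing H p) {j m n : ZMod 8}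
    (hn : n = m + 1) (hj : j = m + 3 ∨ j = m + 4 ∨ j = m + 5 ∨ j = m + 6) :
    ¬ Crosses H p o (c j) (c m) (c n) := by
  have h3 : ∀ c : ZMod 8 → V, IsAntiprism H o c → ¬ Crosses H p o (c 3) (c 0) (c 1) :=
    fun c w => w.spoke_three hp 3 0 1 7 2 4 5 (by decide) (by decide) (by decide) (by decide)
      (by decide) (by decide) (by decide) (by decide) (by decide) (by decide)
  have h4 : ∀ c : ZMod 8 → V, IsAntiprism H o c → ¬ Crosses H p o (c 4) (c 0) (c 1) :=
    fun c w => w.spoke_three hp 4 0 1 7 2 3 5 (by decide) (by decide) (by decide) (by decide)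
      (by decide) (by decide) (by decide) (by decide) (by decide) (by decide)
  subst hn
  rcases hj with rfl | rfl | rfl | rfl
  · simpa [add_comm] using h3 _ (w.shift m)
  · simpa [add_comm] using h4 _ (w.shift m)
  · have := h4 _ (w.reflect (m + 1))
    rw [(by decide : ∀ m : ZMod 8, m + 1 - 4 = m + 5) m] at this
    exact fun h => this (by simpa using h.swap_right)
  · have := h3 _ (w.reflect (m + 1))
    rw [(by decide : ∀ m : ZMod 8, m + 1 - 3 = m + 6) m] at this
    exact fun h => this (by simpa using h.swap_right)

/-- No edge between consecutive vertices `c m`, `c (m + 1)` crosses an edge at the centre. -/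
theorem not_crosses_rim (w : IsAntiprism H o c) (hp : IsRACDrawing H p) {j m n : ZMod 8}
    (hn : n = m + 1) : ¬ Crosses H p o (c j) (c m) (c n) := by
  have h2 : ∀ c : ZMod 8 → V, IsAntiprism H o c → ¬ Crosses H p o (c 2) (c 0) (c 1) := by
    intro c w h
    exact hp.not_crosses_of_two (z := c 7) (y₁ := c 3) (y₂ := c 4)
      (w.adj (by decide)) (w.adj (by decide)) (w.spoke _) (w.spoke _) (w.spoke _)
      (w.ne (by decide)) (w.spoke _) (w.spoke _) (w.adj (by decide)) (w.adj (by decide))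
      (w.adj (by decide)) ⟨w.ne (by decide), w.ne (by decide), w.ne (by decide)⟩
      ⟨w.ne (by decide), w.ne (by decide), w.ne (by decide)⟩
      (w.not_crosses_rim_far hp (by decide) (by decide))
      (fun h => w.not_crosses_rim_far hp (by decide) (by decide) h.swap_right)
      (fun h => w.not_crosses_rim_far hp (by decide) (by decide) h.swap_right) h.swap_right
  subst hn
  obtain ⟨k, rfl⟩ : ∃ k, j = m + k := ⟨j - m, by ring⟩
  rcases zmod_eight_cases k with rfl | rfl | rfl | rfl | rfl | rfl | rfl | rfl
  · rw [add_zero]; exact hp.not_crosses_adjacent ∘ fun h => h.swap_left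
  · exact hp.not_crosses_adjacent ∘ fun h => h.swap_left.swap_right
  · simpa [add_comm] using h2 _ (w.shift m)
  · exact w.not_crosses_rim_far hp rfl (by tauto)
  · exact w.not_crosses_rim_far hp rfl (by tauto)
  · exact w.not_crosses_rim_far hp rfl (by tauto)
  · exact w.not_crosses_rim_far hp rfl (by tauto)
  · have := h2 _ (w.reflect (m + 1))
    rw [(by decide : ∀ m : ZMod 8, m + 1 - 2 = m + 7) m] at this
    exact fun h => this (by simpa using h.swap_right)

/-- Among the edges at the centre, only the one to `c (m + 1)` can cross the edge from `c m` to
`c (m + 2)`. -/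
theorem eq_of_crosses_quad (w : IsAntiprism H o c) (hp : IsRACDrawing H p) {j m n : ZMod 8}
    (hn : n = m + 2) (h : Crosses H p o (c j) (c m) (c n)) : j = m + 1 := by
  have h4 : ∀ c : ZMod 8 → V, IsAntiprism H o c → ¬ Crosses H p o (c 4) (c 0) (c 2) :=
    fun c w => w.spoke_three hp 4 0 2 1 3 5 6 (by decide) (by decide) (by decide) (by decide)
      (by decide) (by decide) (by decide) (by decide) (by decide) (by decide)
  have h5 : ∀ c : ZMod 8 → V, IsAntiprism H o c → ¬ Crosses H p o (c 5) (c 0) (c 2) :=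
    fun c w => w.spoke_three hp 5 0 2 1 3 4 6 (by decide) (by decide) (by decide) (by decide)
      (by decide) (by decide) (by decide) (by decide) (by decide) (by decide)
  have h3 : ∀ c : ZMod 8 → V, IsAntiprism H o c → ¬ Crosses H p o (c 3) (c 0) (c 2) := by
    intro c w h
    exact hp.not_crosses_of_two (z := c 1) (y₁ := c 4) (y₂ := c 5)
      (w.adj (by decide)) (w.adj (by decide)) (w.spoke _) (w.spoke _) (w.spoke _)
      (w.ne (by decide)) (w.spoke _) (w.spoke _) (w.adj (by decide)) (w.adj (by decide))
      (w.adj (by decide)) ⟨w.ne (by decide), w.ne (by decide), w.ne (by decide)⟩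
      ⟨w.ne (by decide), w.ne (by decide), w.ne (by decide)⟩
      (w.not_crosses_rim hp (by decide))
      (fun h => w.not_crosses_rim hp (by decide) h.swap_right)
      (fun h => w.not_crosses_rim hp (by decide) h.swap_right) h
  subst hn
  obtain ⟨k, rfl⟩ : ∃ k, j = m + k := ⟨j - m, by ring⟩
  rcases zmod_eight_cases k with rfl | rfl | rfl | rfl | rfl | rfl | rfl | rfl
  · rw [add_zero] at h; exact absurd h.swap_left hp.not_crosses_adjacent
  · rfl
  · exact absurd h.swap_left.swap_right hp.not_crosses_adjacent
  · exact absurd h (by simpa [add_comm] using h3 _ (w.shift m))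
  · exact absurd h (by simpa [add_comm] using h4 _ (w.shift m))
  · exact absurd h (by simpa [add_comm] using h5 _ (w.shift m))
  · have := h4 _ (w.reflect (m + 2))
    rw [(by decide : ∀ m : ZMod 8, m + 2 - 4 = m + 6) m] at this
    exact absurd h.swap_right (by simpa using this)
  · have := h3 _ (w.reflect (m + 2))
    rw [(by decide : ∀ m : ZMod 8, m + 2 - 3 = m + 7) m] at this
    exact absurd h.swap_right (by simpa using this)

end IsAntiprism

/-! ### The winding of a copy around its centre -/

/-- The vertices `c m` and `c n` of an antiprism are adjacent. -/
abbrev Near (m n : ZMod 8) : Prop := n = m + 1 ∨ n = m + 2 ∨ m = n + 1 ∨ m = n + 2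

/-- The vertices `c a`, `c b` of an antiprism are joined by an edge that is not one of the two which
could cross the edge from the centre to `c j`. -/
abbrev NearFree (a b j : ZMod 8) : Prop :=
  b = a + 1 ∨ a = b + 1 ∨ (b = a + 2 ∧ j ≠ a + 1) ∨ (a = b + 2 ∧ j ≠ b + 1)

namespace IsAntiprism

variable {V : Type*} {H : SimpleGraph V} {p : V → ℂ} {o : V} {c : ZMod 8 → V}

theorem not_crosses_spoke (w : IsAntiprism H o c) (hp : IsRACDrawing H p) {j a b : ZMod 8}
    (h : NearFree a b j) : ¬ Crosses H p (c a) (c b) o (c j) := by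
  intro hc
  rcases h with h | h | h | h
  · exact w.not_crosses_rim hp h hc.symm
  · exact w.not_crosses_rim hp h hc.symm.swap_right
  · exact h.2 (w.eq_of_crosses_quad hp h.1 hc.symm)
  · exact h.2 (w.eq_of_crosses_quad hp h.1 hc.symm.swap_right)

/-- The instance of `IsRACDrawing.not_split` for the triangle of the centre with `c m`, `c n`, and
for the triangle of vertices `c a`, `c b`, `c d`, none of whose sides can cross the edges from the
centre to `c m` and `c n`. -/
theorem inside_of_inside (w : IsAntiprism H o c) (hp : IsRACDrawing H p) (m n a b d : ZMod 8)
    (hmn : Near m n) (hf : ∀ j ∈ [m, n], NearFree a b j ∧ NearFree b d j ∧ NearFree d a j)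
    (hne : ∀ j ∈ [m, n], j ≠ a ∧ j ≠ b ∧ j ≠ d)
    (h : InTri (p (c m)) (p (c n)) (p o) (p (c a))) :
    InTri (p (c m)) (p (c n)) (p o) (p (c b)) := by
  simp only [List.mem_cons, List.not_mem_nil, or_false, forall_eq_or_imp, forall_eq] at hf hne
  have hN : ∀ {a b j : ZMod 8}, NearFree a b j → H.Adj (c a) (c b) := by
    intro a b j h
    rcases h with h | h | h | h
    exacts [w.adj (Or.inl h), w.adj (Or.inr (Or.inr (Or.inl h))), w.adj (Or.inr (Or.inl h.1)),
      w.adj (Or.inr (Or.inr (Or.inr h.1)))]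
  exact hp.not_split (w.adj hmn) (w.spoke n).symm (w.spoke m) (hN hf.1.1) (hN hf.1.2.1)
    (hN hf.1.2.2) ⟨w.ne hne.1.1, w.ne hne.2.1, w.center_ne a⟩
    ⟨w.ne hne.1.2.1, w.ne hne.2.2.1, w.center_ne b⟩
    ⟨w.ne hne.1.2.2, w.ne hne.2.2.2, w.center_ne d⟩
    (fun h => w.not_crosses_spoke hp hf.2.1 h.swap_right) (w.not_crosses_spoke hp hf.1.1)
    (fun h => w.not_crosses_spoke hp hf.2.2.1 h.swap_right) (w.not_crosses_spoke hp hf.1.2.1)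
    (fun h => w.not_crosses_spoke hp hf.2.2.2 h.swap_right) (w.not_crosses_spoke hp hf.1.2.2) h

/-- If the triangle `c 0`, `c 1`, `o` contains one of the other vertices, it contains them all. -/
theorem inside_rim_all (w : IsAntiprism H o c) (hp : IsRACDrawing H p) {j k : ZMod 8}
    (h : InTri (p (c 0)) (p (c 1)) (p o) (p (c j))) (hj : j ≠ 0 ∧ j ≠ 1)
    (hk : k ≠ 0 ∧ k ≠ 1) : InTri (p (c 0)) (p (c 1)) (p o) (p (c k)) := by
  have h23 := w.inside_of_inside hp 0 1 2 3 4 (by decide) (by decide) (by decide)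
  have h32 := w.inside_of_inside hp 0 1 3 2 4 (by decide) (by decide) (by decide)
  have h34 := w.inside_of_inside hp 0 1 3 4 5 (by decide) (by decide) (by decide)
  have h43 := w.inside_of_inside hp 0 1 4 3 5 (by decide) (by decide) (by decide)
  have h45 := w.inside_of_inside hp 0 1 4 5 6 (by decide) (by decide) (by decide)
  have h54 := w.inside_of_inside hp 0 1 5 4 6 (by decide) (by decide) (by decide)
  have h56 := w.inside_of_inside hp 0 1 5 6 7 (by decide) (by decide) (by decide)
  have h65 := w.inside_of_inside hp 0 1 6 5 7 (by decide) (by decide) (by decide)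
  have h67 := w.inside_of_inside hp 0 1 6 7 5 (by decide) (by decide) (by decide)
  have h76 := w.inside_of_inside hp 0 1 7 6 5 (by decide) (by decide) (by decide)
  have h2 : InTri (p (c 0)) (p (c 1)) (p o) (p (c 2)) := by
    rcases zmod_eight_cases j with rfl | rfl | rfl | rfl | rfl | rfl | rfl | rfl
    exacts [absurd rfl hj.1, absurd rfl hj.2, h, h32 h, h32 (h43 h), h32 (h43 (h54 h)),
      h32 (h43 (h54 (h65 h))), h32 (h43 (h54 (h65 (h76 h))))]
  rcases zmod_eight_cases k with rfl | rfl | rfl | rfl | rfl | rfl | rfl | rfl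
  exacts [absurd rfl hk.1, absurd rfl hk.2, h2, h23 h2, h34 (h23 h2), h45 (h34 (h23 h2)),
    h56 (h45 (h34 (h23 h2))), h67 (h56 (h45 (h34 (h23 h2))))]

/-- If the triangle `c 0`, `c 2`, `o` contains one of the vertices other than `c 1`, it contains
`c 1` and `c 3` as well. -/
theorem inside_quad_all (w : IsAntiprism H o c) (hp : IsRACDrawing H p) {j : ZMod 8}
    (h : InTri (p (c 0)) (p (c 2)) (p o) (p (c j))) (hj : j ≠ 0 ∧ j ≠ 1 ∧ j ≠ 2) :
    InTri (p (c 0)) (p (c 2)) (p o) (p (c 1)) ∧ InTri (p (c 0)) (p (c 2)) (p o) (p (c 3)) := by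
  have h34 := w.inside_of_inside hp 0 2 3 4 5 (by decide) (by decide) (by decide)
  have h43 := w.inside_of_inside hp 0 2 4 3 5 (by decide) (by decide) (by decide)
  have h45 := w.inside_of_inside hp 0 2 4 5 6 (by decide) (by decide) (by decide)
  have h54 := w.inside_of_inside hp 0 2 5 4 6 (by decide) (by decide) (by decide)
  have h56 := w.inside_of_inside hp 0 2 5 6 7 (by decide) (by decide) (by decide)
  have h65 := w.inside_of_inside hp 0 2 6 5 7 (by decide) (by decide) (by decide)
  have h67 := w.inside_of_inside hp 0 2 6 7 5 (by decide) (by decide) (by decide)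
  have h76 := w.inside_of_inside hp 0 2 7 6 5 (by decide) (by decide) (by decide)
  have h3 : InTri (p (c 0)) (p (c 2)) (p o) (p (c 3)) := by
    rcases zmod_eight_cases j with rfl | rfl | rfl | rfl | rfl | rfl | rfl | rfl
    exacts [absurd rfl hj.1, absurd rfl hj.2.1, absurd rfl hj.2.2, h, h43 h, h43 (h54 h),
      h43 (h54 (h65 h)), h43 (h54 (h65 (h76 h)))]
  refine ⟨?_, h3⟩
  by_contra h1
  exact w.ne (show (3 : ZMod 8) ≠ 7 by decide) (hp.unique_inside (w.adj (by decide))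
    (w.spoke 2).symm (w.spoke 0) (w.adj (by decide)) (w.adj (by decide)) (w.ne (by decide))
    (w.ne (by decide)) (w.center_ne 1) h1 h3 (h67 (h56 (h45 (h34 h3)))))

/-- A triangle with a vertex inside would contain all of them, and then neither of the two possible
orders of `c 2`, `c 7` around the centre is consistent: `c 0`, which lies on the boundary of the
angle at the centre, would have to lie inside a smaller angle. -/
theorem not_inside_rim_pos (w : IsAntiprism H o c) (hp : IsRACDrawing H p) {j : ZMod 8}
    (hS : 0 < orient (p o) (p (c 0)) (p (c 1))) :
    ¬ InTri (p (c 0)) (p (c 1)) (p o) (p (c j)) := by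
  intro h
  have hj : j ≠ 0 ∧ j ≠ 1 := by
    constructor <;> rintro rfl <;> simp [InTri, orient_self_left, orient_self_right] at h
  have hall : ∀ k : ZMod 8, k ≠ 0 ∧ k ≠ 1 → 0 < orient (p o) (p (c 0)) (p (c k)) ∧
      0 < orient (p o) (p (c k)) (p (c 1)) := by
    intro k hk
    have hadd := orient_add (p (c 0)) (p (c 1)) (p o) (p (c k))
    rw [orient_rotate (p o)] at hadd
    have e := orient_rotate (p o) (p (c k)) (p (c 1))
    have e' := orient_rotate (p (c k)) (p (c 1)) (p o)
    rcases w.inside_rim_all hp h hj hk with h | h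
    · exact ⟨h.2.2, by linarith [h.2.1]⟩
    · linarith [h.1, h.2.1, h.2.2]
  have h2 := hall 2 (by decide)
  have h7 := hall 7 (by decide)
  have h27 : 0 < orient (p o) (p (c 2)) (p (c 7)) := by
    have hne := hp.orient_ne_zero_of_pos (w.spoke 2) (w.spoke 7) (w.ne (by decide)) h2.1 h7.1
    by_contra hneg
    have h72 : 0 < orient (p o) (p (c 7)) (p (c 2)) := by
      rw [orient_swap]
      have := lt_of_le_of_ne (not_lt.1 hneg) hne
      linarith
    rcases hp.wedge (w.adj (by decide)) (w.spoke 2) h7.2 h72 h2.2 with h | h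
    · have h' := ((w.shift 7).inside_quad_all hp (j := 3) h (by decide)).1
      have e1 := orient_swap (p o) (p (c 0)) (p (c 7))
      have e2 := orient_rotate (p o) (p (c 0)) (p (c 1))
      have e3 := orient_rotate (p (c 0)) (p (c 1)) (p o)
      have e4 := orient_rotate (p (c 1)) (p o) (p (c 0))
      change InTri (p (c 7)) (p (c 1)) (p o) (p (c 0)) at h'
      rcases h' with h' | h'
      · linarith [h'.2.2, h7.1]
      · linarith [h'.2.1]
    · exact absurd (w.eq_of_crosses_quad hp (by decide) h) (by decide)
  rcases hp.wedge (w.adj (by decide)) (w.spoke 7) h2.2 h27 h7.2 with h | h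
  · have h' := (w.shift 1).inside_rim_all hp (j := 6) (k := 7) h.swap (by decide) (by decide)
    change InTri (p (c 1)) (p (c 2)) (p o) (p (c 0)) at h'
    have e1 := orient_swap (p o) (p (c 0)) (p (c 1))
    have e2 := orient_rotate (p o) (p (c 0)) (p (c 2))
    have e3 := orient_rotate (p (c 0)) (p (c 2)) (p o)
    rcases h' with h' | h'
    · linarith [h'.2.2]
    · linarith [h'.2.1, h2.1]
  · exact w.not_crosses_rim hp (by decide) h.swap_right

/-- The triangle formed by the centre and two consecutive vertices contains no vertex. -/
theorem not_inside_rim (w : IsAntiprism H o c) (hp : IsRACDrawing H p) {j m n : ZMod 8}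
    (hn : n = m + 1) : ¬ InTri (p (c m)) (p (c n)) (p o) (p (c j)) := by
  subst hn
  intro h
  have hne := hp.orient_ne_zero (w.spoke m) (w.rim m) (w.spoke (m + 1)).symm
  rcases lt_or_gt_of_ne hne with hS | hS
  · refine (w.reflect (m + 1)).not_inside_rim_pos hp (j := m + 1 - j) ?_ ?_
    · rw [orient_swap]; simpa using hS
    · simpa using h.swap
  · refine (w.shift m).not_inside_rim_pos hp (j := j - m) ?_ ?_
    · simpa [add_comm] using hS
    · simpa [add_comm] using h

/-- No vertex lies in the angle at the centre between two consecutive vertices. -/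
theorem not_wedge_rim (w : IsAntiprism H o c) (hp : IsRACDrawing H p) {j m n : ZMod 8}
    (hn : n = m + 1 ∨ m = n + 1) (hS : 0 < orient (p o) (p (c m)) (p (c n)))
    (h1 : 0 < orient (p o) (p (c m)) (p (c j))) (h2 : 0 < orient (p o) (p (c j)) (p (c n))) :
    False := by
  have hadj : H.Adj (c m) (c n) := w.adj (by tauto)
  rcases hp.wedge hadj (w.spoke j) hS h1 h2 with h | h
  · rcases hn with hn | hn
    · exact w.not_inside_rim hp hn h
    · exact w.not_inside_rim hp hn h.swap
  · rcases hn with hn | hn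
    · exact w.not_crosses_rim hp hn h
    · exact w.not_crosses_rim hp hn h.swap_right

/-- The copy is drawn in the positive sense: `c 0`, …, `c 7` are seen counterclockwise from `o`. -/
def Pos (o : V) (c : ZMod 8 → V) (p : V → ℂ) : Prop :=
  ∀ m n, n = m + 1 → 0 < orient (p o) (p (c m)) (p (c n))

theorem Pos.shift (h : Pos o c p) (k : ZMod 8) : Pos o (fun m => c (m + k)) p := by
  rintro m n rfl
  exact h _ _ (by ring)

/-- The orientation of the triangles of consecutive vertices with the centre does not change along
the cycle: otherwise one of three consecutive vertices lies in the angle between the two others. -/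
theorem pos_of_pos (w : IsAntiprism H o c) (hp : IsRACDrawing H p)
    (hS : 0 < orient (p o) (p (c 0)) (p (c 1))) : Pos o c p := by
  have step : ∀ c : ZMod 8 → V, IsAntiprism H o c → 0 < orient (p o) (p (c 0)) (p (c 1)) →
      0 < orient (p o) (p (c 1)) (p (c 2)) := by
    intro c w h01
    by_contra hneg
    have h21 : 0 < orient (p o) (p (c 2)) (p (c 1)) := by
      rw [orient_swap]
      have := lt_of_le_of_ne (not_lt.1 hneg) (hp.orient_ne_zero (w.spoke 1)
        (w.adj (by decide) : H.Adj (c 1) (c 2)) (w.spoke 2).symm)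
      linarith
    rcases lt_or_gt_of_ne (hp.orient_ne_zero (w.spoke 0)
        (w.adj (by decide) : H.Adj (c 0) (c 2)) (w.spoke 2).symm) with h | h
    · refine w.not_wedge_rim hp (m := 2) (n := 1) (j := 0) (by decide) h21 ?_ h01
      rw [orient_swap]; linarith
    · exact w.not_wedge_rim hp (m := 0) (n := 1) (j := 2) (by decide) h01 h h21
  have key : ∀ k : ℕ, 0 < orient (p o) (p (c k)) (p (c (k + 1))) := by
    intro k
    induction k with
    | zero => simpa using hS
    | succ k ih =>
      have := step _ (w.shift k) (by simpa [add_comm] using ih)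
      push_cast
      rw [show (k : ZMod 8) + 1 + 1 = 2 + k by ring, show (k : ZMod 8) + 1 = 1 + k by ring]
      exact this
  rintro m n rfl
  have := key m.val
  rwa [ZMod.natCast_zmod_val] at this

/-- Two consecutive angles at the centre make up less than a straight angle. -/
theorem Pos.quad_base (hpos : Pos o c p) (w : IsAntiprism H o c) (hp : IsRACDrawing H p) :
    0 < orient (p o) (p (c 0)) (p (c 2)) := by
  by_contra hneg
  have h01 := hpos 0 1 (by decide)
  have h12 := hpos 1 2 (by decide)
  have h23 := hpos 2 3 (by decide)
  have h20 : 0 < orient (p o) (p (c 2)) (p (c 0)) := by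
    rw [orient_swap]
    have := lt_of_le_of_ne (not_lt.1 hneg) (hp.orient_ne_zero (w.spoke 0)
      (w.adj (by decide) : H.Adj (c 0) (c 2)) (w.spoke 2).symm)
    linarith
  -- otherwise `o` lies inside the triangle of `c 0`, `c 1`, `c 2`; as `c 3` is not in the angle
  -- between `c 0` and `c 1`, it is in the one between `c 2` and `c 0`
  have h30 : 0 < orient (p o) (p (c 3)) (p (c 0)) := by
    by_contra h
    have id1 : orient (p o) (p (c 1)) (p (c 2)) * orient (p o) (p (c 0)) (p (c 3))
        + orient (p o) (p (c 2)) (p (c 0)) * orient (p o) (p (c 1)) (p (c 3))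
        + orient (p o) (p (c 0)) (p (c 1)) * orient (p o) (p (c 2)) (p (c 3)) = 0 := by
      simp only [orient_def]; ring
    have e := orient_swap (p o) (p (c 0)) (p (c 3))
    have h03 : 0 ≤ orient (p o) (p (c 0)) (p (c 3)) := by linarith
    have h13 : orient (p o) (p (c 1)) (p (c 3)) < 0 := by
      by_contra hc
      have := mul_nonneg h12.le h03
      have := mul_nonneg h20.le (not_lt.1 hc)
      have := mul_pos h01 h23
      linarith
    have h31 : 0 < orient (p o) (p (c 3)) (p (c 1)) := by rw [orient_swap]; linarith
    rcases h03.lt_or_eq with h03 | h03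
    · exact w.not_wedge_rim hp (m := 0) (n := 1) (j := 3) (by decide) h01 h03 h31
    · refine hp.not_same_direction (w.spoke 0) (w.spoke 3) (w.ne (by decide))
        (div_pos h31 h01) ?_ ?_
      all_goals
        rw [div_mul_eq_mul_div, eq_div_iff h01.ne']
        simp only [orient_def] at *
      · linear_combination ((p o).re - (p (c 1)).re) * h03
      · linear_combination ((p o).im - (p (c 1)).im) * h03
  rcases hp.wedge (w.adj (by decide)) (w.spoke 3) h20 h23 h30 with h | h
  · have h' := (w.inside_quad_all hp (j := 3) h.swap (by decide)).1
    have e1 := orient_add (p (c 0)) (p (c 2)) (p o) (p (c 1))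
    have e2 := orient_rotate (p o) (p (c 0)) (p (c 2))
    have e3 := orient_rotate (p o) (p (c 1)) (p (c 2))
    have e4 := orient_rotate (p (c 1)) (p (c 2)) (p o)
    have e5 := orient_swap (p o) (p (c 0)) (p (c 2))
    rcases h' with h' | h'
    · linarith [h'.1, h'.2.1, h'.2.2]
    · linarith [h'.2.2]
  · exact absurd (w.eq_of_crosses_quad hp (by decide) h.swap_right) (by decide)

theorem Pos.quad (hpos : Pos o c p) (w : IsAntiprism H o c) (hp : IsRACDrawing H p) {m n : ZMod 8}
    (hn : n = m + 2) : 0 < orient (p o) (p (c m)) (p (c n)) := by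
  subst hn
  simpa [add_comm] using (hpos.shift m).quad_base (w.shift m) hp

end IsAntiprism

/-! ### The outer quadrilateral of a copy -/

theorem InTri.pos {a b c z : ℂ} (h : InTri a b c z) (hS : 0 < orient a b c) :
    0 < orient a b z ∧ 0 < orient b c z ∧ 0 < orient c a z := by
  rcases h with h | h
  · exact h
  · have := orient_add a b c z
    linarith [h.1, h.2.1, h.2.2]

theorem not_inTri_corner {a b c : ℂ} : ¬ InTri a b c a ∧ ¬ InTri a b c b ∧ ¬ InTri a b c c := by
  refine ⟨?_, ?_, ?_⟩ <;> simp [InTri, orient_self_left, orient_self_right]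

section Drawing

variable {V : Type*} {H : SimpleGraph V} {p : V → ℂ}

/-- If `oz` crosses `uw`, then `z` lies beyond the side `uw` of the triangle `uwo`. -/
theorem IsRACDrawing.not_inside_of_crosses (hp : IsRACDrawing H p) {o z u w : V}
    (h : Crosses H p o z u w) : ¬ InTri (p u) (p w) (p o) (p z) := by
  intro hin
  have h1 := hp.orient_mul_neg h.symm
  have h2 := orient_add (p u) (p w) (p o) (p z)
  rcases hin with h | h <;> nlinarith [h.1, h.2.1, h.2.2]

end Drawing

/-- A cyclic pattern of length eight without two consecutive marks and without three consecutive
gaps alternates, unless the distances of the marks are two, three and three. -/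
theorem alternate_or {B : ZMod 8 → Prop} (h2 : ∀ m, ¬ (B m ∧ B (m + 1)))
    (h3 : ∀ m, B m ∨ B (m + 1) ∨ B (m + 2))
    (hpat : ∀ k, ¬ (B k ∧ ¬ B (k + 1) ∧ ¬ B (k + 2) ∧ ¬ B (k + 4) ∧ ¬ B (k + 5) ∧ B (k + 6))) :
    (∀ m, B (2 * m)) ∨ ∀ m, B (2 * m + 1) := by
  have hstep : ∀ k, B k → B (k + 2) := by
    intro k hk
    by_contra hk2
    have hk1 : ¬ B (k + 1) := fun h => h2 k ⟨hk, h⟩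
    have hk3 : B (k + 3) := by
      have := h3 (k + 1)
      rw [(by ring : k + 1 + 1 = k + 2), (by ring : k + 1 + 2 = k + 3)] at this
      tauto
    have hk4 : ¬ B (k + 4) := fun h => h2 (k + 3) ⟨hk3, by
      rwa [(by ring : k + 3 + 1 = k + 4)]⟩
    by_cases hk5 : B (k + 5)
    · refine hpat (k + 5) ⟨hk5, fun h => h2 (k + 5) ⟨hk5, h⟩, ?_, ?_, ?_, ?_⟩
      · rw [(by decide : ∀ k : ZMod 8, k + 5 + 2 = k + 7) k]
        exact fun h => h2 (k + 7) ⟨h, by rwa [(by decide : ∀ k : ZMod 8, k + 7 + 1 = k) k]⟩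
      · rwa [(by decide : ∀ k : ZMod 8, k + 5 + 4 = k + 1) k]
      · rwa [(by decide : ∀ k : ZMod 8, k + 5 + 5 = k + 2) k]
      · rwa [(by decide : ∀ k : ZMod 8, k + 5 + 6 = k + 3) k]
    · have hk6 : B (k + 6) := by
        have := h3 (k + 4)
        rw [(by ring : k + 4 + 1 = k + 5), (by ring : k + 4 + 2 = k + 6)] at this
        tauto
      exact hpat k ⟨hk, hk1, hk2, hk4, hk5, hk6⟩
  have hall : ∀ a, B a → ∀ m, B (2 * m + a) := by
    intro a ha m
    have : ∀ k : ℕ, B (2 * k + a) := by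
      intro k
      induction k with
      | zero => simpa using ha
      | succ k ih =>
        have := hstep _ ih
        push_cast
        rwa [(by ring : 2 * ((k : ZMod 8) + 1) + a = 2 * k + a + 2)]
    have := this m.val
    rwa [ZMod.natCast_zmod_val] at this
  rcases h3 0 with h | h | h
  · left; simpa using hall 0 h
  · right; simpa using hall 1 (by simpa using h)
  · left
    intro m
    have := hall 2 (by simpa using h) (m - 1)
    rwa [(by ring : 2 * (m - 1) + 2 = 2 * m)] at this

namespace IsAntiprism

variable {V : Type*} {H : SimpleGraph V} {p : V → ℂ} {o : V} {c : ZMod 8 → V}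

/-- Every drawing is in the positive sense for a given numbering or for the reverse one. -/
theorem pos_or_pos (w : IsAntiprism H o c) (hp : IsRACDrawing H p) (k : ZMod 8) :
    Pos o c p ∨ Pos o (fun m => c (k - m)) p := by
  have hne := hp.orient_ne_zero (w.spoke (k - 1)) (w.rim (k - 1)) (w.spoke _).symm
  rw [sub_add_cancel] at hne
  rcases lt_or_gt_of_ne hne with h | h
  · right
    refine (w.reflect k).pos_of_pos hp ?_
    rw [orient_swap, sub_zero]
    linarith
  · left
    have := (w.shift (k - 1)).pos_of_pos hp (by simpa using h)
    rintro m n rfl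
    have := this (m - (k - 1)) (m + 1 - (k - 1)) (by ring)
    simpa using this

/-- A vertex lies inside the triangle formed by the centre and the two vertices next to it, or its
edge to the centre crosses the edge between these. -/
theorem Pos.inside_or_crosses (hpos : Pos o c p) (w : IsAntiprism H o c) (hp : IsRACDrawing H p)
    {l m n : ZMod 8} (hm : m = l + 1) (hn : n = m + 1) :
    InTri (p (c l)) (p (c n)) (p o) (p (c m)) ∨ Crosses H p o (c m) (c l) (c n) :=
  hp.wedge (w.adj (by subst hm hn; right; left; ring)) (w.spoke m)
    (hpos.quad w hp (by subst hm hn; ring)) (hpos _ _ hm) (hpos _ _ hn)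

/-- The triangle formed by the centre and the vertices `c m`, `c (m + 2)` contains at most the
vertex between these. -/
theorem Pos.eq_of_inside_quad (hpos : Pos o c p) (w : IsAntiprism H o c) (hp : IsRACDrawing H p)
    {j m n : ZMod 8} (hn : n = m + 2) (h : InTri (p (c m)) (p (c n)) (p o) (p (c j))) :
    j = m + 1 := by
  by_contra hj
  have hjm : j - m ≠ 0 ∧ j - m ≠ 1 ∧ j - m ≠ 2 := by
    refine ⟨fun e => ?_, fun e => ?_, fun e => ?_⟩
    · rw [sub_eq_zero.1 e] at h; exact not_inTri_corner.1 h
    · exact hj (by linear_combination e)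
    · rw [show j = n by rw [hn]; linear_combination e] at h; exact not_inTri_corner.2.1 h
  have h' := ((w.shift m).inside_quad_all hp (j := j - m) (by
    subst hn; simpa [add_comm] using h) hjm).2
  have hS := (hpos.shift m).quad_base (w.shift m) hp
  have h23 := hpos.shift m 2 3 (by decide)
  have e := orient_rotate (p (c (0 + m))) (p (c (2 + m))) (p o)
  have e' := orient_rotate (p o) (p (c (0 + m))) (p (c (2 + m)))
  have := (h'.pos (by rw [← e, ← orient_rotate]; exact hS)).2.1
  rw [← orient_rotate, ← orient_rotate, orient_swap] at this
  have e3 := orient_rotate (p (c (2 + m))) (p (c (3 + m))) (p o)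
  have e4 := orient_rotate (p o) (p (c (2 + m))) (p (c (3 + m)))
  simp only at *
  linarith

/-- The triangle formed by three consecutive vertices contains no vertex. -/
theorem Pos.not_inside_ear (hpos : Pos o c p) (w : IsAntiprism H o c) (hp : IsRACDrawing H p)
    {j l m n : ZMod 8} (hm : m = l + 1) (hn : n = m + 1) :
    ¬ InTri (p (c l)) (p (c m)) (p (c n)) (p (c j)) ∧
      ¬ InTri (p (c l)) (p (c m)) (p (c n)) (p o) := by
  have hnl : n = l + 2 := by subst hm hn; ring
  have ho : ¬ InTri (p (c l)) (p (c m)) (p (c n)) (p o) := by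
    intro h
    have h1 := hpos _ _ hm
    have h2 := hpos.quad w hp hnl
    rw [← orient_rotate] at h1 h2
    rw [orient_swap'] at h2
    rcases h with h | h
    · linarith [h.2.2]
    · linarith [h.1]
  refine ⟨fun h => ?_, ho⟩
  rcases hp.exit (w.adj (Or.inl hm)) (w.adj (Or.inl hn)) (w.adj (by rw [hnl]; tauto))
    (w.spoke j).symm (w.center_ne l).symm (w.center_ne m).symm (w.center_ne n).symm h ho
    with h1 | h1 | h1
  · exact w.not_crosses_rim hp hm h1.swap_left
  · exact w.not_crosses_rim hp hn h1.swap_left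
  · have := w.eq_of_crosses_quad hp hnl h1.swap_left.swap_right
    rw [this, ← hm] at h
    exact not_inTri_corner.2.1 h

/-- The edges from the centre to two consecutive vertices are not both crossed by the edges between
the neighbours of these vertices. -/
theorem Pos.not_crosses_both (hpos : Pos o c p) (w : IsAntiprism H o c) (hp : IsRACDrawing H p)
    (h1 : Crosses H p o (c 1) (c 0) (c 2)) (h2 : Crosses H p o (c 2) (c 1) (c 3)) : False := by
  rcases hp.enter (a := o) (b := c 1) (c := c 3) (w.adj (by decide)) (w.spoke 3).symm h1.symm
    (w.ne (by decide)) (w.ne (by decide)) with h | h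
  · have h13 := hpos.quad w hp (show (3 : ZMod 8) = 1 + 2 by decide)
    have h01 := hpos 0 1 (by decide)
    have := (h.pos h13).1
    rw [orient_swap] at this
    linarith
  · exact hp.not_inside_of_crosses h2 h.rotate

/-- If two consecutive vertices lie inside the triangles formed by the centre and their neighbours,
then the edges between these neighbours cross. -/
theorem Pos.crosses_of_inside (hpos : Pos o c p) (w : IsAntiprism H o c) (hp : IsRACDrawing H p)
    (h1 : ¬ Crosses H p o (c 1) (c 0) (c 2)) (h2 : ¬ Crosses H p o (c 2) (c 1) (c 3)) :
    Crosses H p (c 0) (c 2) (c 1) (c 3) := by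
  have h2' := (hpos.inside_or_crosses w hp (l := 1) (m := 2) (n := 3) (by decide)
    (by decide)).resolve_right h2
  have h0 : ¬ InTri (p (c 1)) (p (c 3)) (p o) (p (c 0)) := fun h =>
    absurd (hpos.eq_of_inside_quad w hp (by decide) h) (by decide)
  rcases hp.exit (w.adj (by decide)) (w.spoke 3).symm (w.spoke 1)
    (w.adj (by decide) : H.Adj (c 2) (c 0)) (w.ne (by decide)) (w.ne (by decide)) (w.center_ne 0)
    h2' h0 with h | h | h
  · exact h.swap_left
  · exact absurd h.swap_right (w.not_crosses_spoke hp (by decide))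
  · exact absurd h.symm.swap_right h1

/-- If `o c₀` crosses `c₇c₁`, and `c₀c₂` crosses `c₁c₃`, then the quadrilateral `c₁c₃c₅c₇` has a
reflex angle at `c₁`, because `c₀` sees its two sides there under a right angle. -/
theorem Pos.reflex_one (hpos : Pos o c p) (w : IsAntiprism H o c) (hp : IsRACDrawing H p)
    (h0 : Crosses H p o (c 0) (c 7) (c 1)) (h1 : ¬ Crosses H p o (c 1) (c 0) (c 2))
    (h2 : ¬ Crosses H p o (c 2) (c 1) (c 3)) :
    orient (p (c 7)) (p (c 1)) (p (c 3)) < 0 := by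
  have hX := hpos.crosses_of_inside w hp h1 h2
  have h2' := (hpos.inside_or_crosses w hp (l := 1) (m := 2) (n := 3) (by decide)
    (by decide)).resolve_right h2
  have h71 := hpos.quad w hp (show (1 : ZMod 8) = 7 + 2 by decide)
  have h13 := hpos.quad w hp (show (3 : ZMod 8) = 1 + 2 by decide)
  rw [← orient_rotate] at h71 h13
  have i1 := hp.inner_pos h0.swap_left.swap_right
  have i2 := hp.inner_pos hX
  have d1 : 0 < orient (p (c 1)) (p (c 7)) (p (c 0)) := by
    have := hp.orient_mul_neg h0.symm
    rw [orient_swap']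
    nlinarith
  have d2 : 0 < orient (p (c 1)) (p (c 0)) (p (c 3)) := by
    have := hp.orient_mul_neg hX.symm
    have h3 := (h2'.pos h13).1
    rw [orient_swap]
    nlinarith
  have := det_pos_of_acute d1 d2 i1 i2
  rw [orient_swap']
  exact neg_neg_of_pos this

/-- The mirror image of `Pos.reflex_one`, for the angle of the same quadrilateral at `c₅`. -/
theorem Pos.reflex_five (hpos : Pos o c p) (w : IsAntiprism H o c) (hp : IsRACDrawing H p)
    (h4 : ¬ Crosses H p o (c 4) (c 3) (c 5)) (h5 : ¬ Crosses H p o (c 5) (c 4) (c 6))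
    (h6 : Crosses H p o (c 6) (c 5) (c 7)) :
    orient (p (c 3)) (p (c 5)) (p (c 7)) < 0 := by
  have hX : Crosses H p (c 3) (c 5) (c 4) (c 6) :=
    (hpos.shift 3).crosses_of_inside (w.shift 3) hp h4 h5
  have h4' := (hpos.inside_or_crosses w hp (l := 3) (m := 4) (n := 5) (by decide)
    (by decide)).resolve_right h4
  have h35 := hpos.quad w hp (show (5 : ZMod 8) = 3 + 2 by decide)
  have h57 := hpos.quad w hp (show (7 : ZMod 8) = 5 + 2 by decide)
  rw [← orient_rotate] at h35 h57
  have i1 := hp.inner_pos hX.symm.swap_left.swap_right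
  have i2 := hp.inner_pos h6.swap_left
  have d1 : 0 < orient (p (c 5)) (p (c 3)) (p (c 6)) := by
    have := hp.orient_mul_neg hX
    have h3 := (h4'.pos h35).1
    rw [orient_swap']
    nlinarith
  have d2 : 0 < orient (p (c 5)) (p (c 6)) (p (c 7)) := by
    have := hp.orient_mul_neg h6.symm
    rw [orient_swap]
    nlinarith
  have := det_pos_of_acute d1 d2 i1 i2
  rw [orient_swap']
  exact neg_neg_of_pos this

/-- In every RAC drawing one of the two quadrilaterals is outside: the edges from the centre to its
vertices cross the edges of the other one. -/
theorem Pos.alternate (hpos : Pos o c p) (w : IsAntiprism H o c) (hp : IsRACDrawing H p) :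
    (∀ m, Crosses H p o (c (2 * m)) (c (2 * m - 1)) (c (2 * m + 1))) ∨
      ∀ m, Crosses H p o (c (2 * m + 1)) (c (2 * m)) (c (2 * m + 2)) := by
  have key := alternate_or (B := fun m => Crosses H p o (c m) (c (m - 1)) (c (m + 1))) ?_ ?_ ?_
  · refine key.imp id fun h m => ?_
    have := h m
    rwa [show 2 * m + 1 - 1 = 2 * m by ring, show 2 * m + 1 + 1 = 2 * m + 2 by ring] at this
  · -- no two consecutive marks
    rintro m ⟨h1, h2⟩
    refine (hpos.shift (m - 1)).not_crosses_both (w.shift (m - 1)) hp ?_ ?_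
    · simpa [show 2 + (m - 1) = m + 1 by ring] using h1
    · simp only [add_sub_cancel_right] at h2
      simpa [show 2 + (m - 1) = m + 1 by ring, show 3 + (m - 1) = m + 1 + 1 by ring] using h2
  · -- no three consecutive gaps: the edges from `c (m + 1)` to `c (m - 1)` and to `c (m + 3)`
    -- would both cross the edge from `c m` to `c (m + 2)`
    intro m
    by_contra hc
    push Not at hc
    obtain ⟨h1, h2, h3⟩ := hc
    simp only [add_sub_cancel_right, show m + 2 - 1 = m + 1 by ring,
      show m + 1 + 1 = m + 2 by ring, show m + 2 + 1 = m + 3 by ring] at h2 h3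
    have hA := (hpos.shift (m - 1)).crosses_of_inside (w.shift (m - 1)) hp
      (by simpa [show 2 + (m - 1) = m + 1 by ring] using h1)
      (by simpa [show 2 + (m - 1) = m + 1 by ring, show 3 + (m - 1) = m + 2 by ring] using h2)
    have hB := (hpos.shift m).crosses_of_inside (w.shift m) hp
      (by simpa [add_comm] using h2) (by simpa [add_comm] using h3)
    simp only [show 2 + (m - 1) = m + 1 by ring, show 3 + (m - 1) = m + 2 by ring,
      show 1 + (m - 1) = m by ring, zero_add, add_zero, add_comm _ m] at hA hB
    exact w.ne (show m + -1 ≠ m + 3 from fun h => absurd (add_left_cancel h) (by decide))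
      (hp.fan (x := c (m + 1)) (by
        have := hA.symm.swap_right
        rwa [sub_eq_add_neg] at this) hB)
  · -- in the exceptional pattern two opposite angles of a quadrilateral are reflex
    rintro k ⟨h0, h1, h2, h4, h5, h6⟩
    have hp' := hpos.shift k
    have w' := w.shift k
    have r1 := hp'.reflex_one w' hp
      (by
        rwa [(by decide : ∀ k : ZMod 8, 7 + k = k - 1) k, zero_add, add_comm 1 k])
      (by
        rwa [(by decide : ∀ k : ZMod 8, 0 + k = k + 1 - 1) k, add_comm 1 k,
          (by decide : ∀ k : ZMod 8, 2 + k = k + 1 + 1) k])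
      (by
        rwa [(by decide : ∀ k : ZMod 8, 1 + k = k + 2 - 1) k, add_comm 2 k,
          (by decide : ∀ k : ZMod 8, 3 + k = k + 2 + 1) k])
    have r5 := hp'.reflex_five w' hp
      (by
        rwa [(by decide : ∀ k : ZMod 8, 3 + k = k + 4 - 1) k, add_comm 4 k,
          (by decide : ∀ k : ZMod 8, 5 + k = k + 4 + 1) k])
      (by
        rwa [(by decide : ∀ k : ZMod 8, 4 + k = k + 5 - 1) k, add_comm 5 k,
          (by decide : ∀ k : ZMod 8, 6 + k = k + 5 + 1) k])
      (by
        rwa [(by decide : ∀ k : ZMod 8, 5 + k = k + 6 - 1) k, add_comm 6 k,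
          (by decide : ∀ k : ZMod 8, 7 + k = k + 6 + 1) k])
    have s1 := hp'.quad w' hp (show (3 : ZMod 8) = 1 + 2 by decide)
    have s2 := hp'.quad w' hp (show (5 : ZMod 8) = 3 + 2 by decide)
    have s3 := hp'.quad w' hp (show (7 : ZMod 8) = 5 + 2 by decide)
    have s4 := hp'.quad w' hp (show (1 : ZMod 8) = 7 + 2 by decide)
    -- two opposite angles of a quadrilateral around `o` are not both reflex
    have id : ∀ o a b c d : ℂ, orient a b c + orient c d a
        = orient o a b + orient o b c + orient o c d + orient o d a := by
      intro o a b c d; simp only [orient_def]; ring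
    have := id (p o) (p (c (7 + k))) (p (c (1 + k))) (p (c (3 + k))) (p (c (5 + k)))
    linarith

end IsAntiprism

/-! ### Two copies that share two vertices -/

section Subdivision

/-- The values of an affine functional inside a triangle lie between those at the corners. -/
theorem InTri.orient_lt {a b c z : ℂ} (h : InTri a b c z) {P Q : ℂ} {r : ℝ}
    (ha : orient P Q a < r) (hb : orient P Q b < r) (hc : orient P Q c < r) :
    orient P Q z < r := by
  have id : orient P Q z * orient a b c = orient P Q a * orient b c z
      + orient P Q b * orient c a z + orient P Q c * orient a b z := by
    simp only [orient_def]; ring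
  have hadd := orient_add a b c z
  have hr : r * orient a b c = r * orient b c z + r * orient c a z + r * orient a b z := by
    rw [← hadd]; ring
  rcases h with ⟨h1, h2, h3⟩ | ⟨h1, h2, h3⟩
  · have hS : 0 < orient a b c := by linarith
    refine lt_of_mul_lt_mul_right ?_ hS.le
    nlinarith [mul_pos h2 (sub_pos.2 ha), mul_pos h3 (sub_pos.2 hb), mul_pos h1 (sub_pos.2 hc)]
  · have hS : orient a b c < 0 := by linarith
    refine lt_of_mul_lt_mul_right (a := -orient a b c) ?_ (by linarith)
    nlinarith [mul_pos (neg_pos.2 h2) (sub_pos.2 ha), mul_pos (neg_pos.2 h3) (sub_pos.2 hb),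
      mul_pos (neg_pos.2 h1) (sub_pos.2 hc)]

/-- A point inside a triangle is nearer to a side than the opposite corner. -/
theorem orient_abs_lt {a b c z : ℂ} (h : InTri a b c z) :
    (0 < orient a b z ∧ orient a b z < orient a b c) ∨
      (orient a b z < 0 ∧ orient a b c < orient a b z) := by
  have hadd := orient_add a b c z
  rcases h with ⟨h1, h2, h3⟩ | ⟨h1, h2, h3⟩
  · left; constructor <;> linarith
  · right; constructor <;> linarith

/-- A triangle with corners `a`, `b` or points inside `abc` does not contain `c`, which is farther
away from the line `ab` than all of these. -/
theorem not_inTri_of_inside {a b c x y z : ℂ} (hS : orient a b c ≠ 0)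
    (hx : x = a ∨ x = b ∨ InTri a b c x) (hy : y = a ∨ y = b ∨ InTri a b c y)
    (hz : z = a ∨ z = b ∨ InTri a b c z) : ¬ InTri x y z c := by
  intro h
  rcases lt_or_gt_of_ne hS with hS | hS
  · have key : ∀ v, v = a ∨ v = b ∨ InTri a b c v → orient b a v < orient b a c := by
      rintro v (rfl | rfl | hv)
      · rw [orient_self_right, orient_swap']; linarith
      · rw [orient_self_left, orient_swap']; linarith
      · rw [orient_swap', orient_swap' a b c]
        rcases orient_abs_lt hv with h | h <;> linarith [h.1, h.2]
    exact lt_irrefl _ (h.orient_lt (key x hx) (key y hy) (key z hz))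
  · have key : ∀ v, v = a ∨ v = b ∨ InTri a b c v → orient a b v < orient a b c := by
      rintro v (rfl | rfl | hv)
      · rwa [orient_self_left]
      · rwa [orient_self_right]
      · rcases orient_abs_lt hv with h | h <;> linarith [h.1, h.2]
    exact lt_irrefl _ (h.orient_lt (key x hx) (key y hy) (key z hz))

/-- A point `e` inside a triangle divides it into three triangles. -/
theorem InTri.subdivide {a b c e z : ℂ} (he : InTri a b c e) (hz : InTri a b c z) :
    (InTri a b e z ∨ InTri b c e z ∨ InTri c a e z) ∨
      z ∈ segment ℝ e a ∨ z ∈ segment ℝ e b ∨ z ∈ segment ℝ e c := by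
  wlog hS : 0 < orient a b c generalizing a b
  · have hS' : 0 < orient b a c := by
      rw [orient_swap']
      have := orient_add a b c e
      rcases he with h | h
      · linarith [h.1, h.2.1, h.2.2]
      · linarith [h.1, h.2.1, h.2.2]
    rcases this he.swap hz.swap hS' with (h | h | h) | h | h | h
    · exact Or.inl (Or.inl h.swap)
    · exact Or.inl (Or.inr (Or.inr h.swap))
    · exact Or.inl (Or.inr (Or.inl h.swap))
    · tauto
    · tauto
    · tauto
  obtain ⟨e1, e2, e3⟩ := he.pos hS
  obtain ⟨z1, z2, z3⟩ := hz.pos hS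
  have id : orient b c e * orient e a z + orient c a e * orient e b z
      + orient a b e * orient e c z = 0 := by simp only [orient_def]; ring
  -- two consecutive signs, and the position of `z` with respect to the side, give a triangle
  have key : ∀ {a b : ℂ}, 0 < orient a b e → 0 < orient a b z → 0 ≤ orient e a z →
      orient e b z ≤ 0 → InTri a b e z ∨ z ∈ segment ℝ e a ∨ z ∈ segment ℝ e b := by
    intro a b h1 h2 h3 h4
    have h5 : orient e b z = - orient b e z := orient_swap' _ _ _
    have hS1 : 0 < orient e a b := by rwa [← orient_rotate]
    have hS2 : 0 < orient b e a := by rwa [orient_rotate]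
    rcases h3.lt_or_eq with h3 | h3
    · rcases h4.lt_or_eq with h4 | h4
      · exact Or.inl (Or.inl ⟨h2, by linarith, h3⟩)
      · right; right
        rw [segment_symm]
        exact mem_segment_of_orient hS2 (by linarith) h3.le h2.le
    · right; left
      exact mem_segment_of_orient hS1 h3.symm h2.le (by linarith)
  rcases le_or_gt 0 (orient e a z) with ha | ha <;>
    rcases le_or_gt 0 (orient e b z) with hb | hb <;>
    rcases le_or_gt 0 (orient e c z) with hc | hc
  · have h1 := mul_nonneg e2.le ha
    have h2 := mul_nonneg e3.le hb
    have h3 := mul_nonneg e1.le hc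
    have h4 : orient e b z = 0 := by
      have : orient c a e * orient e b z = 0 := by linarith
      exact (mul_eq_zero.1 this).resolve_left e3.ne'
    have := key e1 z1 ha h4.le
    tauto
  · have := key e2 z2 hb hc.le
    tauto
  · have := key e1 z1 ha hb.le
    tauto
  · have := key e1 z1 ha hb.le
    tauto
  · have := key e3 z3 hc ha.le
    tauto
  · have := key e2 z2 hb hc.le
    tauto
  · have := key e3 z3 hc ha.le
    tauto
  · have h1 := mul_pos e2 (neg_pos.2 ha)
    have h2 := mul_pos e3 (neg_pos.2 hb)
    have h3 := mul_pos e1 (neg_pos.2 hc)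
    linarith

end Subdivision

namespace IsAntiprism

variable {V : Type*} {H : SimpleGraph V} {p : V → ℂ} {o : V} {c : ZMod 8 → V} {x y z : V}

/-- If a triangle contains the centre, it contains one of any four other vertices. -/
theorem not_inside_center_of_four (w : IsAntiprism H o c) (hp : IsRACDrawing H p)
    (hxy : H.Adj x y) (hyz : H.Adj y z) (hzx : H.Adj z x) (i₀ i₁ i₂ i₃ : ZMod 8)
    (hi : [i₀, i₁, i₂, i₃].Nodup)
    (hcor : ∀ n ∈ [i₀, i₁, i₂, i₃], x ≠ c n ∧ y ≠ c n ∧ z ≠ c n)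
    (hout : ∀ n ∈ [i₀, i₁, i₂, i₃], ¬ InTri (p x) (p y) (p z) (p (c n))) :
    ¬ InTri (p x) (p y) (p z) (p o) := by
  intro h
  have hg : ∀ k : Fin 4, [i₀, i₁, i₂, i₃].get k ∈ [i₀, i₁, i₂, i₃] := fun k => List.get_mem _ _
  exact hp.four_exits hxy hyz hzx h (y := fun k => c ([i₀, i₁, i₂, i₃].get k))
    (fun a b hab => List.nodup_iff_injective_get.1 hi (w.injective hab)) (fun k => w.spoke _)
    (fun k => hout _ (hg k)) (fun k => hcor _ (hg k))

/-- If a triangle contains `c j`, it contains the centre or one of any three neighbours of `c j`. -/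
theorem not_inside_of_three (w : IsAntiprism H o c) (hp : IsRACDrawing H p)
    (hxy : H.Adj x y) (hyz : H.Adj y z) (hzx : H.Adj z x) (hco : x ≠ o ∧ y ≠ o ∧ z ≠ o)
    (ho : ¬ InTri (p x) (p y) (p z) (p o)) {j i₀ i₁ i₂ : ZMod 8} (hi : [i₀, i₁, i₂].Nodup)
    (hadj : ∀ n ∈ [i₀, i₁, i₂], Near j n)
    (hcor : ∀ n ∈ [i₀, i₁, i₂], x ≠ c n ∧ y ≠ c n ∧ z ≠ c n)
    (hout : ∀ n ∈ [i₀, i₁, i₂], ¬ InTri (p x) (p y) (p z) (p (c n))) :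
    ¬ InTri (p x) (p y) (p z) (p (c j)) := by
  intro h
  have hg : ∀ k : Fin 3, [i₀, i₁, i₂].get k ∈ [i₀, i₁, i₂] := fun k => List.get_mem _ _
  refine hp.four_exits hxy hyz hzx h (y := Fin.cons o fun k => c ([i₀, i₁, i₂].get k))
    ?_ ?_ ?_ ?_
  · rw [Fin.cons_injective_iff]
    exact ⟨by rintro ⟨k, hk⟩; exact w.center_ne _ hk.symm,
      fun a b hab => List.nodup_iff_injective_get.1 hi (w.injective hab)⟩
  · refine Fin.cases (w.spoke j).symm fun k => w.adj (hadj _ (hg k))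
  · exact Fin.cases ho fun k => hout _ (hg k)
  · exact Fin.cases hco fun k => hcor _ (hg k)

/-- If a triangle whose corners are not among these vertices contains a vertex `c j` which is not
`c 0`, `c 1` or `c 2`, then it contains the centre or another of the vertices besides `c 0` and
`c 2`. -/
theorem not_inside_far (w : IsAntiprism H o c) (hp : IsRACDrawing H p)
    (hxy : H.Adj x y) (hyz : H.Adj y z) (hzx : H.Adj z x) (hco : x ≠ o ∧ y ≠ o ∧ z ≠ o)
    (ho : ¬ InTri (p x) (p y) (p z) (p o)) {j : ZMod 8} (hj : j ≠ 0 ∧ j ≠ 1 ∧ j ≠ 2)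
    (hcor : ∀ n, n ≠ 0 → n ≠ 2 → x ≠ c n ∧ y ≠ c n ∧ z ≠ c n)
    (hout : ∀ n, n ≠ 0 → n ≠ 2 → n ≠ j → ¬ InTri (p x) (p y) (p z) (p (c n))) :
    ¬ InTri (p x) (p y) (p z) (p (c j)) := by
  have key : ∀ i₀ i₁ i₂ : ZMod 8, [i₀, i₁, i₂].Nodup →
      (∀ n ∈ [i₀, i₁, i₂], Near j n ∧ n ≠ 0 ∧ n ≠ 2 ∧ n ≠ j) →
      ¬ InTri (p x) (p y) (p z) (p (c j)) := fun i₀ i₁ i₂ h1 h2 =>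
    w.not_inside_of_three hp hxy hyz hzx hco ho h1 (fun n hn => (h2 n hn).1)
      (fun n hn => hcor n (h2 n hn).2.1 (h2 n hn).2.2.1)
      (fun n hn => hout n (h2 n hn).2.1 (h2 n hn).2.2.1 (h2 n hn).2.2.2)
  rcases zmod_eight_cases j with rfl | rfl | rfl | rfl | rfl | rfl | rfl | rfl
  · exact absurd rfl hj.1
  · exact absurd rfl hj.2.1
  · exact absurd rfl hj.2.2
  · exact key 1 4 5 (by decide) (by decide)
  · exact key 3 5 6 (by decide) (by decide)
  · exact key 3 4 6 (by decide) (by decide)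
  · exact key 4 5 7 (by decide) (by decide)
  · exact key 5 6 1 (by decide) (by decide)

/-- A triangle that does not contain `c 0`, and whose corners are not among these vertices (apart
from `c 2`), contains none of these vertices (apart from `c 2`). -/
theorem outside_of_outside (w : IsAntiprism H o c) (hp : IsRACDrawing H p)
    (hxy : H.Adj x y) (hyz : H.Adj y z) (hzx : H.Adj z x) (hco : x ≠ o ∧ y ≠ o ∧ z ≠ o)
    (hcor : ∀ n, n ≠ 2 → x ≠ c n ∧ y ≠ c n ∧ z ≠ c n)
    (h0 : ¬ InTri (p x) (p y) (p z) (p (c 0))) :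
    ¬ InTri (p x) (p y) (p z) (p o) ∧ ∀ n, n ≠ 2 → ¬ InTri (p x) (p y) (p z) (p (c n)) := by
  have ho : ¬ InTri (p x) (p y) (p z) (p o) := by
    intro h
    have hn : ∀ n, Near 0 n → n ≠ 2 → ¬ InTri (p x) (p y) (p z) (p (c n)) := fun n hn h2 hin =>
      w.center_ne n (hp.unique_inside hxy hyz hzx (w.spoke 0).symm (w.adj hn)
        (hcor 0 (by decide)).1 (hcor 0 (by decide)).2.1 (hcor 0 (by decide)).2.2 h0 h hin)
    refine w.not_inside_center_of_four hp hxy hyz hzx 0 1 7 6 (by decide)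
      (fun n hn => hcor n ?_) (fun n hn' => ?_) h
    · revert n; decide
    · by_cases e : n = 0
      · rwa [e]
      · exact hn n (by revert n; decide) (by revert n; decide)
  refine ⟨ho, fun j hj hin => ?_⟩
  have hout : ∀ n, n ≠ j → ¬ InTri (p x) (p y) (p z) (p (c n)) := fun n hn h =>
    w.ne hn (hp.unique_inside hxy hyz hzx (w.spoke n) (w.spoke j) hco.1 hco.2.1 hco.2.2 ho h hin)
  by_cases hj0 : j = 0
  · exact h0 (hj0 ▸ hin)
  by_cases hj1 : j = 1
  · subst hj1
    exact w.not_inside_of_three hp hxy hyz hzx hco ho (i₀ := 0) (i₁ := 3) (i₂ := 7) (by decide)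
      (by decide) (fun n hn => hcor n (by revert n; decide))
      (fun n hn => hout n (by revert n; decide)) hin
  · exact w.not_inside_far hp hxy hyz hzx hco ho ⟨hj0, hj1, hj⟩ (fun n _ h => hcor n h)
      (fun n _ _ h => hout n h) hin

/-- A triangle of the graph over the edge from `c 0` to `c 2`, with its apex `z` adjacent to `c 1`,
contains none of the other vertices of the antiprism, provided that `c 1` lies between this edge and
the centre, and that the two sides at `z` border triangles with a common apex `v` which contain
none of these vertices either. -/
theorem outside_of_shared (w : IsAntiprism H o c) (hp : IsRACDrawing H p) {v : V}
    (h0z : H.Adj (c 0) z) (h2z : H.Adj (c 2) z) (hv0 : H.Adj v (c 0)) (hv2 : H.Adj v (c 2))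
    (hvz : H.Adj v z) (hzo : z ≠ o) (hzc : ∀ n, z ≠ c n) (hvo : v ≠ o) (hvc : ∀ n, v ≠ c n)
    (hlink : H.Adj (c 1) z)
    (e0 : ∀ u, (u = o ∨ ∃ n, n ≠ 0 ∧ n ≠ 2 ∧ u = c n) → ¬ InTri (p (c 0)) (p z) (p v) (p u))
    (e2 : ∀ u, (u = o ∨ ∃ n, n ≠ 0 ∧ n ≠ 2 ∧ u = c n) → ¬ InTri (p z) (p (c 2)) (p v) (p u))
    (f7 : ¬ InTri (p (c 7)) (p (c 0)) (p o) (p (c 1)))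
    (f2 : ¬ InTri (p (c 2)) (p (c 3)) (p o) (p (c 1)))
    (h1 : InTri (p (c 0)) (p (c 2)) (p o) (p (c 1))) :
    ¬ InTri (p (c 0)) (p (c 2)) (p z) (p o) ∧
      ∀ n, n ≠ 0 → n ≠ 2 → ¬ InTri (p (c 0)) (p (c 2)) (p z) (p (c n)) := by
  have h02 : H.Adj (c 0) (c 2) := w.adj (by decide)
  have hco : c 0 ≠ o ∧ c 2 ≠ o ∧ z ≠ o := ⟨(w.center_ne 0).symm, (w.center_ne 2).symm, hzo⟩
  have hcor : ∀ n, n ≠ 0 → n ≠ 2 → c 0 ≠ c n ∧ c 2 ≠ c n ∧ z ≠ c n := fun n hn0 hn2 =>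
    ⟨w.ne hn0.symm, w.ne hn2.symm, hzc n⟩
  have hS := hp.orient_ne_zero h02 h2z h0z.symm
  have ho : ¬ InTri (p (c 0)) (p (c 2)) (p z) (p o) := by
    intro ho
    have hall : ∀ n, n ≠ 0 → n ≠ 2 → InTri (p (c 0)) (p (c 2)) (p z) (p (c n)) := by
      have hnb : ∀ m n, m ≠ 0 → m ≠ 2 → Near m n → ¬ InTri (p (c 0)) (p (c 2)) (p z) (p (c m)) →
          ¬ InTri (p (c 0)) (p (c 2)) (p z) (p (c n)) := fun m n h0 h2 hmn hm hn =>
        w.center_ne n (hp.unique_inside h02 h2z h0z.symm (w.spoke m).symm (w.adj hmn)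
          (hcor m h0 h2).1 (hcor m h0 h2).2.1 (hcor m h0 h2).2.2 hm ho hn)
      -- the vertices other than `c 0`, `c 2` form a connected graph
      have h13 := hnb 1 3 (by decide) (by decide) (by decide)
      have h34 := hnb 3 4 (by decide) (by decide) (by decide)
      have h45 := hnb 4 5 (by decide) (by decide) (by decide)
      have h56 := hnb 5 6 (by decide) (by decide) (by decide)
      have h67 := hnb 6 7 (by decide) (by decide) (by decide)
      have h71 := hnb 7 1 (by decide) (by decide) (by decide)
      by_contra hcon
      push Not at hcon
      obtain ⟨n, hn0, hn2, hn⟩ := hcon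
      have h3 : ¬ InTri (p (c 0)) (p (c 2)) (p z) (p (c 3)) := by
        rcases zmod_eight_cases n with rfl | rfl | rfl | rfl | rfl | rfl | rfl | rfl
        exacts [absurd rfl hn0, h13 hn, absurd rfl hn2, hn, h13 (h71 (h67 (h56 (h45 hn)))),
          h13 (h71 (h67 (h56 hn))), h13 (h71 (h67 hn)), h13 (h71 hn)]
      refine w.not_inside_center_of_four hp h02 h2z h0z.symm 3 4 5 6 (by decide)
        (fun n hn => hcor n (by revert n; decide) (by revert n; decide)) (fun n hn => ?_) ho
      simp only [List.mem_cons, List.not_mem_nil, or_false] at hn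
      rcases hn with rfl | rfl | rfl | rfl
      exacts [h3, h34 h3, h45 (h34 h3), h56 (h45 (h34 h3))]
    -- since all these vertices and the centre are inside, `z` is in none of their triangles; the
    -- edge from `c 1` to `z` leaves the triangle `c 0`, `c 2`, `o` through an edge at the centre,
    -- and enters the triangle of `c 2`, `c 3` or `c 7`, `c 0` with the centre, but ends outside
    have hz' : ¬ InTri (p (c 0)) (p (c 2)) (p o) (p z) :=
      not_inTri_of_inside hS (Or.inl rfl) (Or.inr (Or.inl rfl)) (Or.inr (Or.inr ho))
    rcases hp.exit h02 (w.spoke 2).symm (w.spoke 0) hlink h0z.ne h2z.ne hzo.symm h1 hz'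
      with h | h | h
    · have h3 := hp.orient_mul_neg h.symm
      rcases orient_abs_lt (hall 1 (by decide) (by decide)) with h4 | h4 <;>
        nlinarith [h4.1, h4.2]
    · rcases hp.enter (c := c 3) (w.spoke 3) (w.adj (by decide)) h (w.ne (by decide))
        (hzc 3).symm with h' | h'
      · exact f2 h'.swap.rotate
      · exact not_inTri_of_inside hS (Or.inr (Or.inl rfl)) (Or.inr (Or.inr ho))
          (Or.inr (Or.inr (hall 3 (by decide) (by decide)))) h'
    · rcases hp.enter (c := c 7) (w.adj (by decide)) (w.spoke 7).symm h (w.ne (by decide))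
        (hzc 7).symm with h' | h'
      · exact f7 h'.swap.rotate.rotate
      · exact not_inTri_of_inside hS (Or.inr (Or.inr ho)) (Or.inl rfl)
          (Or.inr (Or.inr (hall 7 (by decide) (by decide)))) h'
  refine ⟨ho, fun j hj0 hj2 hin => ?_⟩
  have hout : ∀ n, n ≠ j → ¬ InTri (p (c 0)) (p (c 2)) (p z) (p (c n)) := fun n hn h =>
    w.ne hn (hp.unique_inside h02 h2z h0z.symm (w.spoke n) (w.spoke j) hco.1 hco.2.1 hco.2.2 ho h
      hin)
  by_cases hj1 : j = 1
  · -- the edges from `c 1` to the centre and to `c 3` would both cross the side `c 0`, `c 2`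
    subst hj1
    have key : ∀ u, H.Adj (c 1) u → (u = o ∨ ∃ n, n ≠ 0 ∧ n ≠ 2 ∧ u = c n) →
        c 0 ≠ u → c 2 ≠ u → z ≠ u → v ≠ u → ¬ InTri (p (c 0)) (p (c 2)) (p z) (p u) →
        Crosses H p (c 1) u (c 0) (c 2) := by
      intro u hu hu' hu0 hu2 huz huv hout
      rcases hp.exit h02 h2z h0z.symm hu hu0 hu2 huz hin hout with h | h | h
      · exact h
      · rcases hp.enter (c := v) hv2.symm hvz h.swap_right (hvc 1) huv with h' | h'
        · exact absurd h' (e2 _ (Or.inr ⟨1, by decide, by decide, rfl⟩))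
        · exact absurd h' (e2 _ hu')
      · rcases hp.enter (c := v) hvz.symm hv0 h.swap_right (hvc 1) huv with h' | h'
        · exact absurd h'  (e0 _ (Or.inr ⟨1, by decide, by decide, rfl⟩))
        · exact absurd h' (e0 _ hu')
    have k1 := key o (w.spoke 1).symm (Or.inl rfl) hco.1 hco.2.1 hzo hvo ho
    have k2 := key (c 3) (w.adj (by decide)) (Or.inr ⟨3, by decide, by decide, rfl⟩)
      (w.ne (by decide)) (w.ne (by decide)) (hzc 3) (hvc 3) (hout 3 (by decide))
    exact w.center_ne 3 (hp.fan k1.symm k2.symm)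
  · exact w.not_inside_far hp h02 h2z h0z.symm hco ho ⟨hj0, hj1, hj2⟩ hcor
      (fun n _ _ h => hout n h) hin

end IsAntiprism

/-! ### The empty triangles of a glued pair -/

/-- The edge `uv` is one of the edges of the antiprism with centre `o` and further vertices `c m`.
-/
def IsCopyEdge {V : Type*} (o : V) (c : ZMod 8 → V) (u v : V) : Prop :=
  (∃ m, s(u, v) = s(o, c m)) ∨ (∃ m, s(u, v) = s(c m, c (m + 1))) ∨
    ∃ m, s(u, v) = s(c m, c (m + 2))

/-- `H` consists of two augmented square antiprisms, with centres `o` and `o'`, which share the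
vertices `c 0`, `c 2` of the first and `d 0`, `d 2` of the second, and of an edge from `c 1` to
`d 1`. The two ways of identifying the pairs are both allowed here. -/
structure IsGluedPair {V : Type*} (H : SimpleGraph V) (o : V) (c : ZMod 8 → V) (o' : V)
    (d : ZMod 8 → V) : Prop where
  left : IsAntiprism H o c
  right : IsAntiprism H o' d
  shared : (c 0 = d 0 ∧ c 2 = d 2) ∨ (c 0 = d 2 ∧ c 2 = d 0)
  center_ne : o ≠ o'
  left_ne : ∀ m, o' ≠ c m
  right_ne : ∀ m, o ≠ d m
  eq_of_eq : ∀ m n, c m = d n → (m = 0 ∨ m = 2) ∧ (n = 0 ∨ n = 2)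
  link : H.Adj (c 1) (d 1)
  cover : ∀ v, v = o ∨ v = o' ∨ (∃ m, v = c m) ∨ ∃ m, v = d m
  edge_cases : ∀ u v, H.Adj u v → IsCopyEdge o c u v ∨ IsCopyEdge o' d u v ∨ s(u, v) = s(c 1, d 1)

/-- The triangle formed by the vertices `a`, `b`, `e` contains no vertex of the drawing. -/
def EmptyTri {V : Type*} (p : V → ℂ) (a b e : V) : Prop :=
  ∀ v, ¬ InTri (p a) (p b) (p e) (p v)

theorem EmptyTri.rotate {V : Type*} {p : V → ℂ} {a b e : V} (h : EmptyTri p a b e) :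
    EmptyTri p b e a := fun v hv => h v hv.rotate.rotate

theorem EmptyTri.swap {V : Type*} {p : V → ℂ} {a b e : V} (h : EmptyTri p a b e) :
    EmptyTri p b a e := fun v hv => h v hv.swap

/-- The shape of the drawing of a copy of the antiprism: it is drawn in the positive sense, with the
vertices `c (2 * m)` on the outer quadrilateral, and the triangles which it bounds are empty. -/
structure IsCopyDrawing {V : Type*} (H : SimpleGraph V) (p : V → ℂ) (o : V) (c : ZMod 8 → V) :
    Prop where
  pos : IsAntiprism.Pos o c p
  outer : ∀ m, Crosses H p o (c (2 * m)) (c (2 * m - 1)) (c (2 * m + 1))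
  rim_empty : ∀ m, EmptyTri p (c m) (c (m + 1)) o
  inner_empty : ∀ m, EmptyTri p (c (2 * m - 1)) (c (2 * m + 1)) o
  ear_empty : ∀ m, EmptyTri p (c m) (c (m + 1)) (c (m + 2))

namespace IsAntiprism

variable {V : Type*} {H : SimpleGraph V} {p : V → ℂ} {o : V} {c : ZMod 8 → V}

/-- If the vertices `c (2 * m)` are on the outer quadrilateral, the vertex between two of them lies
inside the triangle which they form with the centre. -/
theorem Pos.inside_even (hpos : Pos o c p) (w : IsAntiprism H o c) (hp : IsRACDrawing H p)
    (hA : ∀ m, Crosses H p o (c (2 * m)) (c (2 * m - 1)) (c (2 * m + 1))) (m : ZMod 8) :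
    InTri (p (c (2 * m))) (p (c (2 * m + 2))) (p o) (p (c (2 * m + 1))) := by
  refine (hpos.inside_or_crosses w hp rfl (by ring)).resolve_right fun h => ?_
  refine (hpos.shift (2 * m - 1)).not_crosses_both (w.shift (2 * m - 1)) hp ?_ ?_
  · simpa [show 2 + (2 * m - 1) = 2 * m + 1 by ring] using hA m
  · simpa [show 2 + (2 * m - 1) = 2 * m + 1 by ring, show 3 + (2 * m - 1) = 2 * m + 2 by ring]
      using h

/-- If the vertices `c (2 * m)` are on the outer quadrilateral, the triangle of the centre with a
side of the inner one contains no vertex: the vertex in its angle lies beyond this side. -/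
theorem Pos.not_inside_odd (hpos : Pos o c p) (w : IsAntiprism H o c) (hp : IsRACDrawing H p)
    (hA : ∀ m, Crosses H p o (c (2 * m)) (c (2 * m - 1)) (c (2 * m + 1))) (m j : ZMod 8) :
    ¬ InTri (p (c (2 * m - 1))) (p (c (2 * m + 1))) (p o) (p (c j)) := by
  intro h
  have hj := hpos.eq_of_inside_quad w hp (by ring) h
  rw [hj, sub_add_cancel] at h
  exact hp.not_inside_of_crosses (hA m) h

end IsAntiprism

namespace IsGluedPair

open IsAntiprism

variable {V : Type*} {H : SimpleGraph V} {p : V → ℂ} {o o' : V} {c d : ZMod 8 → V} {x y z s : V}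

theorem symm (g : IsGluedPair H o c o' d) : IsGluedPair H o' d o c where
  left := g.right
  right := g.left
  shared := by
    rcases g.shared with h | h
    · exact Or.inl ⟨h.1.symm, h.2.symm⟩
    · exact Or.inr ⟨h.2.symm, h.1.symm⟩
  center_ne := g.center_ne.symm
  left_ne := g.right_ne
  right_ne := g.left_ne
  eq_of_eq m n h := (g.eq_of_eq n m h.symm).symm
  link := g.link.symm
  cover v := by have := g.cover v; tauto
  edge_cases u v h := by
    have := g.edge_cases u v h
    rw [Sym2.eq_swap (a := d 1)]
    tauto

/-- Reversing the numbering of the first copy exchanges the two ways of identifying the shared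
vertices. -/
theorem reflect_left (g : IsGluedPair H o c o' d) :
    IsGluedPair H o (fun m => c (2 - m)) o' d where
  left := g.left.reflect 2
  right := g.right
  shared := by simpa [and_comm, or_comm] using g.shared
  center_ne := g.center_ne
  left_ne _ := g.left_ne _
  right_ne := g.right_ne
  eq_of_eq m n h := by
    have := g.eq_of_eq _ _ h
    exact ⟨(by decide : ∀ m : ZMod 8, 2 - m = 0 ∨ 2 - m = 2 → m = 0 ∨ m = 2) m this.1, this.2⟩
  link := by simpa [show (2 : ZMod 8) - 1 = 1 by decide] using g.link
  cover v := by
    rcases g.cover v with h | h | ⟨m, h⟩ | h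
    · exact Or.inl h
    · exact Or.inr (Or.inl h)
    · exact Or.inr (Or.inr (Or.inl ⟨2 - m, by simpa using h⟩))
    · exact Or.inr (Or.inr (Or.inr h))
  edge_cases u v h := by
    rcases g.edge_cases u v h with (⟨m, h⟩ | ⟨m, h⟩ | ⟨m, h⟩) | h | h
    · exact Or.inl (Or.inl ⟨2 - m, by simpa using h⟩)
    · refine Or.inl (Or.inr (Or.inl ⟨1 - m, ?_⟩))
      simp only [h, show 2 - (1 - m) = m + 1 by ring, show 2 - (1 - m + 1) = m by ring]
      exact Sym2.eq_swap
    · refine Or.inl (Or.inr (Or.inr ⟨-m, ?_⟩))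
      simp only [h, show 2 - (-m) = m + 2 by ring, show 2 - (-m + 2) = m by ring]
      exact Sym2.eq_swap
    · exact Or.inr (Or.inl h)
    · exact Or.inr (Or.inr (by simpa [show (2 : ZMod 8) - 1 = 1 by decide] using h))

theorem mem_shared (g : IsGluedPair H o c o' d) {n : ZMod 8} (hn : n = 0 ∨ n = 2) :
    d n = c 0 ∨ d n = c 2 := by
  rcases g.shared with h | h <;> rcases hn with rfl | rfl <;> simp [h.1, h.2]

/-- A triangle formed by vertices of the first copy contains none of the other vertices of the
second copy if it does not contain a shared vertex either, and that one is not a corner of it. -/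
theorem outside (g : IsGluedPair H o c o' d) (hp : IsRACDrawing H p)
    (hxy : H.Adj x y) (hyz : H.Adj y z) (hzx : H.Adj z x)
    (hL : ∀ v ∈ [x, y, z], v = o ∨ ∃ m, v = c m) (hs : s = c 0 ∨ s = c 2)
    (hsv : ∀ v ∈ [x, y, z], v ≠ s) (hout : ¬ InTri (p x) (p y) (p z) (p s)) :
    ∀ u, (u = o' ∨ ∃ n, n ≠ 0 ∧ n ≠ 2 ∧ u = d n) → ¬ InTri (p x) (p y) (p z) (p u) := by
  have h1 : ∀ v ∈ [x, y, z], v ≠ o' := by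
    rintro v hv rfl
    rcases hL v hv with h | ⟨m, h⟩
    exacts [g.center_ne h.symm, g.left_ne m h]
  have h2 : ∀ v ∈ [x, y, z], ∀ n, n ≠ 0 → n ≠ 2 → v ≠ d n := by
    rintro v hv n h0 h2 rfl
    rcases hL _ hv with h | ⟨m, h⟩
    · exact g.right_ne n h.symm
    · have := (g.eq_of_eq m n h.symm).2
      tauto
  simp only [List.mem_cons, List.not_mem_nil, or_false, forall_eq_or_imp, forall_eq] at h1 h2 hsv
  have hs' : s = d 0 ∨ s = d 2 := by
    rcases g.shared with h | h <;> rcases hs with rfl | rfl <;> simp [h.1, h.2]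
  rcases hs' with rfl | rfl
  · have := g.right.outside_of_outside hp hxy hyz hzx h1 (fun n hn => by
      by_cases h0 : n = 0
      · rwa [h0]
      · exact ⟨h2.1 n h0 hn, h2.2.1 n h0 hn, h2.2.2 n h0 hn⟩) hout
    rintro u (rfl | ⟨n, -, hn, rfl⟩)
    exacts [this.1, this.2 n hn]
  · have := (g.right.reflect 2).outside_of_outside hp hxy hyz hzx h1 (fun n hn => by
      by_cases h0 : n = 0
      · rw [h0, sub_zero]; exact hsv
      · have e0 : 2 - n ≠ 0 := fun h => hn (sub_eq_zero.1 h).symm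
        have e2 : 2 - n ≠ 2 := fun h => h0 (by simpa using h)
        exact ⟨h2.1 _ e0 e2, h2.2.1 _ e0 e2, h2.2.2 _ e0 e2⟩) (by simpa using hout)
    rintro u (rfl | ⟨n, hn, -, rfl⟩)
    · exact this.1
    · have := this.2 (2 - n) (fun h => hn (by simpa using h))
      simpa using this

/-- The quadrilateral that contains the shared vertices is the outer one. -/
theorem outer (g : IsGluedPair H o c o' d) (hp : IsRACDrawing H p) (hl : Pos o c p) :
    ∀ m, Crosses H p o (c (2 * m)) (c (2 * m - 1)) (c (2 * m + 1)) := by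
  refine (hl.alternate g.left hp).resolve_right fun hB => ?_
  have w := g.left
  rcases hl.inside_or_crosses w hp (l := 7) (m := 0) (n := 1) (by decide) (by decide) with h | h
  · -- the triangle `c 7`, `c 1`, `o` contains the shared vertex `c 0`, but not the other one, and
    -- so none of the neighbours of `c 0` in the second copy
    have hadj : H.Adj (c 7) (c 1) := w.adj (by decide)
    have h2 := g.outside hp hadj (w.spoke 1).symm (w.spoke 7) (s := c 2)
      (by simp) (Or.inr rfl) (by
        simp only [List.mem_cons, List.not_mem_nil, or_false, forall_eq_or_imp, forall_eq]
        exact ⟨w.ne (by decide), w.ne (by decide), w.center_ne 2⟩)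
      fun h => absurd (hl.eq_of_inside_quad w hp (by decide) h) (by decide)
    have key : ∀ j i₀ i₁ i₂ : ZMod 8, [i₀, i₁, i₂].Nodup →
        (∀ n ∈ [i₀, i₁, i₂], Near j n ∧ n ≠ 0 ∧ n ≠ 2) →
        ¬ InTri (p (c 7)) (p (c 1)) (p o) (p (d j)) := fun j i₀ i₁ i₂ hi hn =>
      g.right.not_inside_of_three hp hadj (w.spoke 1).symm (w.spoke 7)
        ⟨(g.left_ne 7).symm, (g.left_ne 1).symm, g.center_ne⟩ (h2 _ (Or.inl rfl)) hi
        (fun n h => (hn n h).1)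
        (fun n h => ⟨fun e => absurd (g.eq_of_eq _ _ e).1 (by decide),
          fun e => absurd (g.eq_of_eq _ _ e).1 (by decide), g.right_ne n⟩)
        fun n h => h2 _ (Or.inr ⟨n, (hn n h).2.1, (hn n h).2.2, rfl⟩)
    rcases g.shared with hs | hs
    · exact key 0 1 7 6 (by decide) (by decide) (hs.1 ▸ h)
    · exact key 2 1 3 4 (by decide) (by decide) (hs.1 ▸ h)
  · have := hB 0
    rw [mul_zero, zero_add, zero_add] at this
    exact (hl.shift 7).not_crosses_both (w.shift 7) hp h this

/-- A triangle is empty if it contains no vertex of the first copy and no unshared vertex of the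
second one. -/
theorem emptyTri_of (g : IsGluedPair H o c o' d) (h1 : ¬ InTri (p x) (p y) (p z) (p o))
    (h2 : ∀ j, ¬ InTri (p x) (p y) (p z) (p (c j)))
    (h3 : ∀ u, (u = o' ∨ ∃ n, n ≠ 0 ∧ n ≠ 2 ∧ u = d n) → ¬ InTri (p x) (p y) (p z) (p u)) :
    EmptyTri p x y z := by
  intro v
  rcases g.cover v with rfl | rfl | ⟨m, rfl⟩ | ⟨n, rfl⟩
  · exact h1
  · exact h3 _ (Or.inl rfl)
  · exact h2 m
  · by_cases hn : n = 0 ∨ n = 2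
    · rcases g.mem_shared hn with h | h <;> rw [h] <;> exact h2 _
    · exact h3 _ (Or.inr ⟨n, fun h => hn (Or.inl h), fun h => hn (Or.inr h), rfl⟩)

theorem rim_empty (g : IsGluedPair H o c o' d) (hp : IsRACDrawing H p) (m : ZMod 8) :
    EmptyTri p (c m) (c (m + 1)) o := by
  have w := g.left
  have h2 : ∀ j, ¬ InTri (p (c m)) (p (c (m + 1))) (p o) (p (c j)) := fun j =>
    w.not_inside_rim hp rfl
  refine g.emptyTri_of not_inTri_corner.2.2 h2 ?_
  have key : ∀ j, (j = 0 ∨ j = 2) → m ≠ j → m + 1 ≠ j → ∀ u,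
      (u = o' ∨ ∃ n, n ≠ 0 ∧ n ≠ 2 ∧ u = d n) →
      ¬ InTri (p (c m)) (p (c (m + 1))) (p o) (p u) := fun j hj hm hm1 =>
    g.outside hp (w.rim m) (w.spoke _).symm (w.spoke m) (s := c j) (by simp)
      (by rcases hj with rfl | rfl <;> simp) (by
        simp only [List.mem_cons, List.not_mem_nil, or_false, forall_eq_or_imp, forall_eq]
        exact ⟨w.ne hm, w.ne hm1, w.center_ne j⟩) (h2 j)
  by_cases h : m ≠ 0 ∧ m + 1 ≠ 0
  · exact key 0 (Or.inl rfl) h.1 h.2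
  · have := (by decide : ∀ m : ZMod 8, ¬ (m ≠ 0 ∧ m + 1 ≠ 0) → m ≠ 2 ∧ m + 1 ≠ 2) m h
    exact key 2 (Or.inr rfl) this.1 this.2

theorem inner_empty (g : IsGluedPair H o c o' d) (hp : IsRACDrawing H p) (hl : Pos o c p)
    (m : ZMod 8) : EmptyTri p (c (2 * m - 1)) (c (2 * m + 1)) o := by
  have w := g.left
  have h2 := hl.not_inside_odd w hp (g.outer hp hl) m
  exact g.emptyTri_of not_inTri_corner.2.2 h2 (g.outside hp
    (w.adj (Or.inr (Or.inl (by ring)))) (w.spoke _).symm (w.spoke _) (s := c 0) (by simp)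
    (Or.inl rfl) (by
        simp only [List.mem_cons, List.not_mem_nil, or_false, forall_eq_or_imp, forall_eq]
        exact ⟨w.ne ((by decide : ∀ m : ZMod 8, 2 * m - 1 ≠ 0) m),
          w.ne ((by decide : ∀ m : ZMod 8, 2 * m + 1 ≠ 0) m), w.center_ne 0⟩) (h2 0))

/-- The triangle of three consecutive vertices is empty. If two of these are the shared ones, this
needs the link; otherwise one of the shared vertices is not a corner. -/
theorem ear_empty (g : IsGluedPair H o c o' d) (hp : IsRACDrawing H p) (hl : Pos o c p)
    (hr : Pos o' d p) (m : ZMod 8) : EmptyTri p (c m) (c (m + 1)) (c (m + 2)) := by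
  have w := g.left
  have h2 := fun j => (hl.not_inside_ear w hp (j := j) (l := m) (m := m + 1) (n := m + 2) rfl
    (by ring))
  refine g.emptyTri_of (h2 0).2 (fun j => (h2 j).1) ?_
  have key : ∀ j, (j = 0 ∨ j = 2) → m ≠ j → m + 1 ≠ j → m + 2 ≠ j → ∀ u,
      (u = o' ∨ ∃ n, n ≠ 0 ∧ n ≠ 2 ∧ u = d n) →
      ¬ InTri (p (c m)) (p (c (m + 1))) (p (c (m + 2))) (p u) := fun j hj hm hm1 hm2 =>
    g.outside hp (w.rim m) (w.adj (Or.inl (by ring))) (w.quad m).symm (s := c j) (by simp)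
      (by rcases hj with rfl | rfl <;> simp) (by
        simp only [List.mem_cons, List.not_mem_nil, or_false, forall_eq_or_imp, forall_eq]
        exact ⟨w.ne hm, w.ne hm1, w.ne hm2⟩) (h2 j).1
  by_cases h : m = 0
  · subst h
    have e0 := g.outside hp (w.rim 0) (w.spoke _).symm (w.spoke 0) (s := c 2) (by simp)
      (Or.inr rfl) (by
        simp only [List.mem_cons, List.not_mem_nil, or_false, forall_eq_or_imp, forall_eq]
        exact ⟨w.ne (by decide), w.ne (by decide), w.center_ne _⟩) (w.not_inside_rim hp rfl)
    have e2 := g.outside hp (w.rim 1) (w.spoke _).symm (w.spoke 1) (s := c 0) (by simp)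
      (Or.inl rfl) (by
        simp only [List.mem_cons, List.not_mem_nil, or_false, forall_eq_or_imp, forall_eq]
        exact ⟨w.ne (by decide), w.ne (by decide), w.center_ne _⟩) (w.not_inside_rim hp rfl)
    have w' := g.right
    have h1 := hr.inside_even w' hp (g.symm.outer hp hr) 0
    have hc1 : ∀ n, c 1 ≠ d n := fun n e => absurd (g.eq_of_eq _ _ e).1 (by decide)
    simp only [mul_zero, zero_add, show (1 : ZMod 8) + 1 = 2 by decide] at h1 e0 e2 ⊢
    rcases g.shared with ⟨s0, s2⟩ | ⟨s0, s2⟩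
    · have := w'.outside_of_shared hp (z := c 1) (v := o) (s0 ▸ w.adj (by decide))
        (s2 ▸ w.adj (by decide)) (s0 ▸ w.spoke 0) (s2 ▸ w.spoke 2) (w.spoke 1) (g.left_ne 1).symm
        hc1 g.center_ne g.right_ne g.link.symm (s0 ▸ e0) (s2 ▸ e2)
        (w'.not_inside_rim hp (by decide)) (w'.not_inside_rim hp (by decide)) h1
      rintro u (rfl | ⟨n, hn0, hn2, rfl⟩) hu
      · exact this.1 (by rw [← s0, ← s2]; exact hu.swap.rotate)
      · exact this.2 n hn0 hn2 (by rw [← s0, ← s2]; exact hu.swap.rotate)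
    · have := w'.outside_of_shared hp (z := c 1) (v := o) (s2 ▸ w.adj (by decide))
        (s0 ▸ w.adj (by decide)) (s2 ▸ w.spoke 2) (s0 ▸ w.spoke 0) (w.spoke 1) (g.left_ne 1).symm
        hc1 g.center_ne g.right_ne g.link.symm
        (fun u hu h => e2 u hu (by rw [s2]; exact h.swap))
        (fun u hu h => e0 u hu (by rw [s0]; exact h.swap))
        (w'.not_inside_rim hp (by decide)) (w'.not_inside_rim hp (by decide)) h1
      rintro u (rfl | ⟨n, hn0, hn2, rfl⟩) hu
      · exact this.1 (by rw [← s0, ← s2]; exact hu.rotate.rotate)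
      · exact this.2 n hn0 hn2 (by rw [← s0, ← s2]; exact hu.rotate.rotate)
  · by_cases h' : m + 1 ≠ 0 ∧ m + 2 ≠ 0
    · exact key 0 (Or.inl rfl) h h'.1 h'.2
    · have := (by decide : ∀ m : ZMod 8, m ≠ 0 → ¬ (m + 1 ≠ 0 ∧ m + 2 ≠ 0) →
        m ≠ 2 ∧ m + 1 ≠ 2 ∧ m + 2 ≠ 2) m h h'
      exact key 2 (Or.inr rfl) this.1 this.2.1 this.2.2

theorem copyDrawing (g : IsGluedPair H o c o' d) (hp : IsRACDrawing H p) (hl : Pos o c p)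
    (hr : Pos o' d p) : IsCopyDrawing H p o c where
  pos := hl
  outer := g.outer hp hl
  rim_empty := g.rim_empty hp
  inner_empty := g.inner_empty hp hl
  ear_empty := g.ear_empty hp hl hr

end IsGluedPair

/-! ### The crossings -/

/-- The shape of the drawing of the two copies: both are drawn in the positive sense, with the
shared vertices on the outer quadrilaterals. As the copies lie on different sides of the shared
side, these vertices then correspond to each other in the opposite order. -/
structure IsPairDrawing {V : Type*} (H : SimpleGraph V) (p : V → ℂ) (o : V) (c : ZMod 8 → V)
    (o' : V) (d : ZMod 8 → V) : Prop where
  glued : IsGluedPair H o c o' d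
  rac : IsRACDrawing H p
  left : IsCopyDrawing H p o c
  right : IsCopyDrawing H p o' d
  zero_eq : c 0 = d 2
  two_eq : c 2 = d 0
  link_crosses : Crosses H p (c 1) (d 1) (c 0) (c 2)

section Crosses

variable {V : Type*} {H : SimpleGraph V} {p : V → ℂ} {u v x y u' v' x' y' : V}

theorem Crosses.congr (h : Crosses H p u v x y) (h1 : s(u, v) = s(u', v'))
    (h2 : s(x, y) = s(x', y')) : Crosses H p u' v' x' y' := by
  rcases Sym2.eq_iff.1 h1 with ⟨rfl, rfl⟩ | ⟨rfl, rfl⟩ <;>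
    rcases Sym2.eq_iff.1 h2 with ⟨rfl, rfl⟩ | ⟨rfl, rfl⟩
  exacts [h, h.swap_right, h.swap_left, h.swap_left.swap_right]

/-- An edge that crosses a side of an empty triangle ends at the opposite corner. -/
theorem EmptyTri.eq_or_eq {a b e : V} (h : EmptyTri p a b e) (hp : IsRACDrawing H p)
    (hbe : H.Adj b e) (hea : H.Adj e a) (hc : Crosses H p u v a b) : e = u ∨ e = v := by
  by_contra hne
  push Not at hne
  rcases hp.enter hbe hea hc hne.1 hne.2 with h' | h'
  exacts [h _ h', h _ h']

end Crosses

theorem zmod_eight_parity (m : ZMod 8) : (∃ k, m = 2 * k) ∨ ∃ k, m = 2 * k - 1 := by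
  decide +revert

namespace IsGluedPair

open IsAntiprism

variable {V : Type*} {H : SimpleGraph V} {p : V → ℂ} {o o' : V} {c d : ZMod 8 → V}

/-- The triangle of the centre with an outer side contains only the vertex between the ends of this
side, which divides it into three empty triangles. -/
theorem eq_of_inside_cell (g : IsGluedPair H o c o' d) (hp : IsRACDrawing H p)
    (hc : IsCopyDrawing H p o c) {m : ZMod 8} {v : V}
    (h : InTri (p (c (2 * m))) (p (c (2 * m + 2))) (p o) (p v)) : v = c (2 * m + 1) := by
  have w := g.left
  have e1 := hc.rim_empty (2 * m)
  have e2 := hc.rim_empty (2 * m + 1)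
  rw [show 2 * m + 1 + 1 = 2 * m + 2 by ring] at e2
  have e3 := hc.ear_empty (2 * m)
  have hne := @not_inTri_corner (p (c (2 * m))) (p (c (2 * m + 2))) (p o)
  rcases (hc.pos.inside_even w hp hc.outer m).subdivide h with (h' | h' | h') | h' | h' | h'
  · exact absurd h'.swap.rotate (e3 v)
  · exact absurd h'.rotate.rotate (e2 v)
  · exact absurd h'.rotate (e1 v)
  · rcases hp.vertex_edge _ _ _ (w.rim (2 * m)).symm h' with e | e
    · exact e
    · exact absurd (e ▸ h) hne.1
  · rcases hp.vertex_edge _ _ _ (w.adj (Or.inl (by ring)) : H.Adj (c (2 * m + 1)) (c (2 * m + 2)))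
      h' with e | e
    · exact e
    · exact absurd (e ▸ h) hne.2.1
  · rcases hp.vertex_edge _ _ _ (w.spoke (2 * m + 1)).symm h' with e | e
    · exact e
    · exact absurd (e ▸ h) hne.2.2

/-- The link starts in the triangle of the centre with the shared side, and cannot leave it through
the other two sides, since these border empty triangles as well. -/
theorem link_crosses (g : IsGluedPair H o c o' d) (hp : IsRACDrawing H p)
    (hc : IsCopyDrawing H p o c) : Crosses H p (c 1) (d 1) (c 0) (c 2) := by
  have w := g.left
  have hin := hc.pos.inside_even w hp hc.outer 0
  have hne : ∀ m, c m ≠ d 1 := fun m e => absurd (g.eq_of_eq _ _ e).2 (by decide)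
  have hout := fun h => hne _ (g.eq_of_inside_cell hp hc (m := 0) (v := d 1) h).symm
  simp only [mul_zero, zero_add] at hin hout
  rcases hp.exit (w.adj (by decide)) (w.spoke 2).symm (w.spoke 0) g.link (hne 0) (hne 2)
    (g.right_ne 1) hin hout with h | h | h
  · exact h
  · have e : EmptyTri p (c 2) o (c 3) := (hc.rim_empty 2).swap.rotate
    rcases e.eq_or_eq hp (w.spoke 3) (w.adj (by decide)) h with h | h
    exacts [absurd h (w.ne (by decide)), absurd h (hne _)]
  · have e : EmptyTri p o (c 0) (c 7) := (hc.rim_empty 7).swap.rotate.rotate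
    rcases e.eq_or_eq hp (w.adj (by decide)) (w.spoke 7).symm h with h | h
    exacts [absurd h (w.ne (by decide)), absurd h (hne _)]

/-- If both copies are drawn in the positive sense, then their shared vertices are identified
crosswise, since the added edge crosses the edge between these. -/
theorem pairDrawing (g : IsGluedPair H o c o' d) (hp : IsRACDrawing H p) (hl : Pos o c p)
    (hr : Pos o' d p) : IsPairDrawing H p o c o' d := by
  have hc := g.copyDrawing hp hl hr
  have hd := g.symm.copyDrawing hp hr hl
  have hX := g.link_crosses hp hc
  have h : c 0 = d 2 ∧ c 2 = d 0 := by
    refine g.shared.resolve_left fun hs => ?_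
    have h1 := (hc.pos.inside_even g.left hp hc.outer 0).pos
      (by rw [orient_rotate]; exact hl.quad g.left hp rfl)
    have h2 := (hd.pos.inside_even g.right hp hd.outer 0).pos
      (by rw [orient_rotate]; exact hr.quad g.right hp rfl)
    have h3 := hp.orient_mul_neg hX.symm
    simp only [mul_zero, zero_add, ← hs.1, ← hs.2] at h1 h2
    nlinarith [h1.1, h2.1]
  exact ⟨g, hp, hc, hd, h.1, h.2, hX⟩

end IsGluedPair

/-- The pairs of edges that cross, directed so that the second edge crosses the first one from
right to left. -/
inductive CrossingPair {V : Type*} (o : V) (c : ZMod 8 → V) (o' : V) (d : ZMod 8 → V) :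
    V → V → V → V → Prop
  | left (m : ZMod 8) : CrossingPair o c o' d o (c (2 * m)) (c (2 * m - 1)) (c (2 * m + 1))
  | right (m : ZMod 8) : CrossingPair o c o' d o' (d (2 * m)) (d (2 * m - 1)) (d (2 * m + 1))
  | link : CrossingPair o c o' d (c 1) (d 1) (c 0) (c 2)

namespace IsPairDrawing

variable {V : Type*} {H : SimpleGraph V} {p : V → ℂ} {o o' : V} {c d : ZMod 8 → V}
  {u v x y x' y' : V}

theorem symm (P : IsPairDrawing H p o c o' d) : IsPairDrawing H p o' d o c where
  glued := P.glued.symm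
  rac := P.rac
  left := P.right
  right := P.left
  zero_eq := P.two_eq.symm
  two_eq := P.zero_eq.symm
  link_crosses := by
    have := P.link_crosses.swap_left.swap_right
    rwa [P.zero_eq, P.two_eq] at this

/-- The edges between consecutive vertices are sides of three empty triangles. An edge that crosses
one of them would have to end at all three of the opposite corners. -/
theorem not_crosses_rim (P : IsPairDrawing H p o c o' d) {m n : ZMod 8} (hn : n = m + 1) :
    ¬ Crosses H p u v (c m) (c n) := by
  subst hn
  intro h
  have w := P.glued.left
  have h1 := (P.left.rim_empty m).eq_or_eq P.rac (w.spoke _).symm (w.spoke _) h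
  have h2 := (P.left.ear_empty m).eq_or_eq P.rac (w.adj (Or.inl (by ring))) (w.quad _).symm h
  have h3 := (P.left.ear_empty (m - 1))
  rw [sub_add_cancel, show m - 1 + 2 = m + 1 by ring] at h3
  have h3 := h3.rotate.eq_or_eq P.rac (w.adj (Or.inr (Or.inr (Or.inr (by ring)))))
    (w.adj (Or.inl (by ring))) h
  have e1 := w.center_ne (m + 2)
  have e2 := w.center_ne (m - 1)
  have e3 : c (m + 2) ≠ c (m - 1) := w.ne ((by decide : ∀ m : ZMod 8, m + 2 ≠ m - 1) m)
  grind

/-- The edge from the centre to `c m` is a side of two empty triangles, and every edge that crosses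
it joins their opposite corners. -/
theorem spoke_crosses (P : IsPairDrawing H p o c o' d) {m : ZMod 8}
    (h : Crosses H p o (c m) x y) : s(x, y) = s(c (m - 1), c (m + 1)) := by
  have w := P.glued.left
  have h1 := (P.left.rim_empty m).rotate.rotate.eq_or_eq P.rac (w.rim m) (w.spoke _).symm h.symm
  have h2 := P.left.rim_empty (m - 1)
  rw [sub_add_cancel] at h2
  have h2 := h2.rotate.swap.eq_or_eq P.rac (w.adj (Or.inr (Or.inr (Or.inl (by ring)))))
    (w.spoke _).symm h.symm
  have e3 : c (m + 1) ≠ c (m - 1) := w.ne ((by decide : ∀ m : ZMod 8, m + 1 ≠ m - 1) m)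
  rw [Sym2.eq_iff]
  grind

/-- The sides of the inner quadrilateral are sides of two empty triangles, and every edge that
crosses one of them joins the opposite corners. -/
theorem inner_crosses (P : IsPairDrawing H p o c o' d) {m : ZMod 8}
    (h : Crosses H p (c (2 * m - 1)) (c (2 * m + 1)) x y) : s(x, y) = s(o, c (2 * m)) := by
  have w := P.glued.left
  have h1 := (P.left.inner_empty m).eq_or_eq P.rac (w.spoke _).symm (w.spoke _) h.symm
  have h2 := P.left.ear_empty (2 * m - 1)
  rw [sub_add_cancel, show 2 * m - 1 + 2 = 2 * m + 1 by ring] at h2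
  have h2 := h2.swap.rotate.eq_or_eq P.rac (w.rim _).symm
    (w.adj (Or.inr (Or.inr (Or.inl (by ring))))) h.symm
  have e := w.center_ne (2 * m)
  rw [Sym2.eq_iff]
  grind

theorem not_odd_spoke_crosses (P : IsPairDrawing H p o c o' d) {m : ZMod 8} :
    ¬ Crosses H p o (c (2 * m + 1)) x y := by
  intro h
  have h' := h.congr rfl (P.spoke_crosses h)
  rw [add_sub_cancel_right, show 2 * m + 1 + 1 = 2 * m + 2 by ring] at h'
  exact P.rac.not_inside_of_crosses h'
    (P.left.pos.inside_even P.glued.left P.rac P.left.outer m)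

/-- The sides of an outer quadrilateral are uncrossed, except that the link crosses the shared one.
-/
theorem outer_crosses (P : IsPairDrawing H p o c o' d) {m : ZMod 8}
    (h : Crosses H p (c (2 * m)) (c (2 * m + 2)) x y) : 2 * m = 0 ∧ s(x, y) = s(c 1, d 1) := by
  have w := P.glued.left
  have h1 := (P.left.ear_empty (2 * m)).rotate.rotate.eq_or_eq P.rac
    (w.rim _) (w.adj (Or.inl (by ring))) h.symm.swap_right
  wlog hx : c (2 * m + 1) = x generalizing x y
  · rw [Sym2.eq_swap]
    exact this h.swap_right h1.symm (h1.resolve_left hx)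
  subst hx
  have key : ∀ {a b : V}, s(c (2 * m + 1), y) = s(a, b) →
      Crosses H p a b (c (2 * m)) (c (2 * m + 2)) := fun e => h.symm.congr e rfl
  rcases P.glued.edge_cases _ _ h.2.1 with (⟨k, hk⟩ | ⟨k, hk⟩ | ⟨k, hk⟩) | hk | hk
  · have : c (2 * m + 1) = c k := by
      rcases Sym2.eq_iff.1 hk with ⟨e, -⟩ | ⟨e, -⟩
      exacts [absurd e.symm (w.center_ne _), e]
    have h2 := key hk
    rw [← this] at h2
    exact absurd h2 P.not_odd_spoke_crosses
  · exact absurd (key hk).symm (P.not_crosses_rim rfl)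
  · rcases zmod_eight_parity k with ⟨l, rfl⟩ | ⟨l, rfl⟩
    · exfalso
      rcases Sym2.eq_iff.1 hk with ⟨e, -⟩ | ⟨e, -⟩
      · exact absurd (w.injective e) ((by decide : ∀ m l : ZMod 8, 2 * m + 1 ≠ 2 * l) m l)
      · exact absurd (w.injective e) ((by decide : ∀ m l : ZMod 8, 2 * m + 1 ≠ 2 * l + 2) m l)
    · have h2 := key hk
      rw [show 2 * l - 1 + 2 = 2 * l + 1 by ring] at h2
      rcases Sym2.eq_iff.1 (P.inner_crosses h2) with ⟨e, -⟩ | ⟨-, e⟩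
      exacts [absurd e.symm (w.center_ne _), absurd e.symm (w.center_ne _)]
  · exfalso
    have hn : ∀ n, c (2 * m + 1) ≠ d n := fun n e => absurd (P.glued.eq_of_eq _ _ e).1
      ((by decide : ∀ m : ZMod 8, ¬ (2 * m + 1 = 0 ∨ 2 * m + 1 = 2)) m)
    have ho := (P.glued.left_ne (2 * m + 1)).symm
    rcases hk with ⟨k, hk⟩ | ⟨k, hk⟩ | ⟨k, hk⟩ <;> rcases Sym2.eq_iff.1 hk with ⟨e, -⟩ | ⟨e, -⟩
    exacts [ho e, hn _ e, hn _ e, hn _ e, hn _ e, hn _ e]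
  · refine ⟨?_, hk⟩
    rcases Sym2.eq_iff.1 hk with ⟨e, -⟩ | ⟨e, -⟩
    · linear_combination w.injective e
    · exact absurd (P.glued.eq_of_eq _ _ e).2 (by decide)

theorem link_crosses_only (P : IsPairDrawing H p o c o' d) (h : Crosses H p (c 1) (d 1) x y) :
    s(x, y) = s(c 0, c 2) := by
  have key : ∀ {o o' : V} {c d : ZMod 8 → V}, IsPairDrawing H p o c o' d →
      Crosses H p (c 1) (d 1) x y → IsCopyEdge o c x y → s(x, y) = s(c 0, c 2) := by
    intro o o' c d P h hk
    have w := P.glued.left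
    have hne : ∀ {a b : V}, s(c 1, d 1) = s(a, b) → a ≠ d 1 ∧ b ≠ d 1 → False := by
      intro a b e hab
      rcases Sym2.eq_iff.1 e with ⟨-, e⟩ | ⟨-, e⟩
      exacts [hab.2 e.symm, hab.1 e.symm]
    have hd : ∀ m, c m ≠ d 1 := fun m e => absurd (P.glued.eq_of_eq _ _ e).2 (by decide)
    rcases hk with ⟨k, hk⟩ | ⟨k, hk⟩ | ⟨k, hk⟩
    · exact (hne (P.spoke_crosses (h.congr rfl hk).symm) ⟨hd _, hd _⟩).elim
    · exact absurd (h.congr rfl hk) (P.not_crosses_rim rfl)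
    · rcases zmod_eight_parity k with ⟨l, rfl⟩ | ⟨l, rfl⟩
      · rw [hk, (P.outer_crosses (h.congr rfl hk).symm).1, zero_add]
      · have h2 := (h.congr rfl hk).symm
        rw [show 2 * l - 1 + 2 = 2 * l + 1 by ring] at h2
        exact (hne (P.inner_crosses h2) ⟨P.glued.right_ne 1, hd _⟩).elim
  rcases P.glued.edge_cases _ _ h.2.1 with hk | hk | hk
  · exact key P h hk
  · rw [key P.symm h.swap_left hk, P.zero_eq, P.two_eq, Sym2.eq_swap]
  · exact absurd hk.symm h.2.2.1

/-- Every edge is crossed by one other edge at most. -/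
theorem crossing_unique (P : IsPairDrawing H p o c o' d) (h : Crosses H p u v x y)
    (h' : Crosses H p u v x' y') : s(x, y) = s(x', y') := by
  have key : ∀ {o o' : V} {c d : ZMod 8 → V}, IsPairDrawing H p o c o' d →
      IsCopyEdge o c u v → s(x, y) = s(x', y') := by
    intro o o' c d P hk
    rcases hk with ⟨k, hk⟩ | ⟨k, hk⟩ | ⟨k, hk⟩
    · rw [P.spoke_crosses (h.congr hk rfl), P.spoke_crosses (h'.congr hk rfl)]
    · exact absurd (h.congr hk rfl).symm (P.not_crosses_rim rfl)
    · rcases zmod_eight_parity k with ⟨l, rfl⟩ | ⟨l, rfl⟩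
      · rw [(P.outer_crosses (h.congr hk rfl)).2, (P.outer_crosses (h'.congr hk rfl)).2]
      · rw [show 2 * l - 1 + 2 = 2 * l + 1 by ring] at hk
        rw [P.inner_crosses (h.congr hk rfl), P.inner_crosses (h'.congr hk rfl)]
  rcases P.glued.edge_cases _ _ h.1 with hk | hk | hk
  · exact key P hk
  · exact key P.symm hk
  · rw [P.link_crosses_only (h.congr hk rfl), P.link_crosses_only (h'.congr hk rfl)]

/-- The crossings of a drawing are those of the list `CrossingPair`. -/
theorem crossingPair (P : IsPairDrawing H p o c o' d) (h : Crosses H p u v x y) :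
    ∃ a b a' b', CrossingPair o c o' d a b a' b' ∧
      ((s(u, v) = s(a, b) ∧ s(x, y) = s(a', b')) ∨ (s(u, v) = s(a', b') ∧ s(x, y) = s(a, b))) := by
  have key : ∀ {o o' : V} {c d : ZMod 8 → V}, IsPairDrawing H p o c o' d →
      IsCopyEdge o c u v → (∃ m, (s(u, v) = s(o, c (2 * m)) ∧
        s(x, y) = s(c (2 * m - 1), c (2 * m + 1))) ∨ (s(u, v) = s(c (2 * m - 1), c (2 * m + 1)) ∧
        s(x, y) = s(o, c (2 * m)))) ∨ (s(u, v) = s(c 0, c 2) ∧ s(x, y) = s(c 1, d 1)) := by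
    intro o o' c d P hk
    rcases hk with ⟨k, hk⟩ | ⟨k, hk⟩ | ⟨k, hk⟩
    · rcases zmod_eight_parity k with ⟨l, rfl⟩ | ⟨l, rfl⟩
      · exact Or.inl ⟨l, Or.inl ⟨hk, P.spoke_crosses (h.congr hk rfl)⟩⟩
      · have := h.congr hk rfl
        rw [show 2 * l - 1 = 2 * (l - 1) + 1 by ring] at this
        exact absurd this P.not_odd_spoke_crosses
    · exact absurd (h.congr hk rfl).symm (P.not_crosses_rim rfl)
    · rcases zmod_eight_parity k with ⟨l, rfl⟩ | ⟨l, rfl⟩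
      · have := P.outer_crosses (h.congr hk rfl)
        rw [this.1, zero_add] at hk
        exact Or.inr ⟨hk, this.2⟩
      · rw [show 2 * l - 1 + 2 = 2 * l + 1 by ring] at hk
        exact Or.inl ⟨l, Or.inr ⟨hk, P.inner_crosses (h.congr hk rfl)⟩⟩
  rcases P.glued.edge_cases _ _ h.1 with hk | hk | hk
  · rcases key P hk with ⟨m, h⟩ | h
    · exact ⟨_, _, _, _, .left m, h⟩
    · exact ⟨_, _, _, _, .link, Or.inr h⟩
  · rcases key P.symm hk with ⟨m, h⟩ | h
    · exact ⟨_, _, _, _, .right m, h⟩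
    · refine ⟨_, _, _, _, .link, Or.inr ⟨?_, ?_⟩⟩
      · rw [h.1, P.zero_eq, P.two_eq, Sym2.eq_swap]
      · rw [h.2, Sym2.eq_swap]
  · exact ⟨_, _, _, _, .link, Or.inl ⟨hk, P.link_crosses_only (h.congr hk rfl)⟩⟩

/-- All pairs of the list `CrossingPair` cross, with the sign that is stated there. -/
theorem crosses_of_crossingPair (P : IsPairDrawing H p o c o' d)
    (h : CrossingPair o c o' d u v x y) :
    Crosses H p u v x y ∧ 0 < det (p v - p u) (p y - p x) := by
  have key : ∀ {u v x y : V}, Crosses H p u v x y → 0 < orient (p u) (p x) (p y) →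
      Crosses H p u v x y ∧ 0 < det (p v - p u) (p y - p x) := by
    intro u v x y hc ho
    refine ⟨hc, ?_⟩
    obtain ⟨s, t, D, hs, -, -, -, -, hD, -, -, h1, -⟩ := P.rac.cross_param hc
    rw [orient_rotate] at h1
    rw [← hD]
    rw [h1] at ho
    exact pos_of_mul_pos_right ho hs.le
  cases h with
  | left m => exact key (P.left.outer m) (P.left.pos.quad P.glued.left P.rac (by ring))
  | right m => exact key (P.right.outer m) (P.right.pos.quad P.glued.right P.rac (by ring))
  | link =>
    refine key P.link_crosses ?_
    have := ((P.left.pos.inside_even P.glued.left P.rac P.left.outer 0).pos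
      (by rw [orient_rotate]; exact P.left.pos.quad P.glued.left P.rac rfl)).1
    simp only [mul_zero, zero_add] at this
    rwa [← orient_rotate]

/-- Two drawings of this shape have the same crossings, with the same signs. -/
theorem crossing_congr {q : V → ℂ} (P : IsPairDrawing H p o c o' d)
    (Q : IsPairDrawing H q o c o' d) (h : Crosses H p u v x y) : Crosses H q u v x y ∧
      (0 < det (p v - p u) (p y - p x) → 0 < det (q v - q u) (q y - q x)) := by
  obtain ⟨a, b, a', b', hX, hs⟩ := P.crossingPair h
  obtain ⟨-, h1⟩ := P.crosses_of_crossingPair hX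
  obtain ⟨h2, h3⟩ := Q.crosses_of_crossingPair hX
  simp only [det, Complex.sub_re, Complex.sub_im] at *
  rcases hs with ⟨hs, hs'⟩ | ⟨hs, hs'⟩
  · refine ⟨h2.congr hs.symm hs'.symm, fun h4 => ?_⟩
    rcases Sym2.eq_iff.1 hs with ⟨rfl, rfl⟩ | ⟨rfl, rfl⟩ <;>
      rcases Sym2.eq_iff.1 hs' with ⟨rfl, rfl⟩ | ⟨rfl, rfl⟩ <;> linarith
  · refine ⟨h2.symm.congr hs.symm hs'.symm, fun h4 => ?_⟩
    rcases Sym2.eq_iff.1 hs with ⟨rfl, rfl⟩ | ⟨rfl, rfl⟩ <;>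
      rcases Sym2.eq_iff.1 hs' with ⟨rfl, rfl⟩ | ⟨rfl, rfl⟩ <;> linarith

end IsPairDrawing

/-! ### The interior of a star-shaped quadrilateral -/

/-- A connected subset of `Fᶜ` that contains `z` and is unbounded makes the component of `z`
unbounded. -/
theorem not_isBounded_component {F R : Set ℂ} {z : ℂ} (hR : IsPreconnected R) (hz : z ∈ R)
    (hF : R ⊆ Fᶜ) (hb : ¬ Bornology.IsBounded R) :
    ¬ Bornology.IsBounded (connectedComponentIn Fᶜ z) := fun h =>
  hb (h.subset (hR.subset_connectedComponentIn hz hF))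

theorem isPreconnected_ray (z w : ℂ) :
    IsPreconnected ((fun s : ℝ => z + s * w) '' Set.Ici 0) := by
  refine isPreconnected_Ici.image _ (Continuous.continuousOn ?_)
  fun_prop

theorem not_isBounded_ray (z : ℂ) {w : ℂ} (hw : w ≠ 0) :
    ¬ Bornology.IsBounded ((fun s : ℝ => z + s * w) '' Set.Ici 0) := by
  intro h
  obtain ⟨R, hR⟩ := h.subset_closedBall z
  have hw' : 0 < ‖w‖ := norm_pos_iff.2 hw
  have h1 : z + (((|R| + 1) / ‖w‖ : ℝ) : ℂ) * w ∈ Metric.closedBall z R :=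
    hR ⟨(|R| + 1) / ‖w‖, by simp only [Set.mem_Ici]; positivity, rfl⟩
  rw [Metric.mem_closedBall, dist_eq_norm, add_sub_cancel_left, norm_mul, Complex.norm_real,
    Real.norm_of_nonneg (by positivity), div_mul_cancel₀ _ hw'.ne'] at h1
  linarith [le_abs_self R]

theorem continuous_orient_right (a b : ℂ) : Continuous fun z => orient a b z := by
  simp only [orient_def]
  fun_prop

theorem continuous_orient_mid (a b : ℂ) : Continuous fun z => orient a z b := by
  simp only [orient_def]
  fun_prop

namespace StarQuad

/-- The point `z` lies in the closed angle at `o` of the triangle `o`, `C k`, `C (k + 1)`. -/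
def InCone (o : ℂ) (C : ZMod 4 → ℂ) (k : ZMod 4) (z : ℂ) : Prop :=
  0 ≤ orient o (C k) z ∧ 0 ≤ orient o z (C (k + 1))

/-- The interior of the quadrilateral with vertices `C k`, which is star-shaped with respect to
`o`. -/
def inside (o : ℂ) (C : ZMod 4 → ℂ) : Set ℂ :=
  {z | ∀ k, InCone o C k z → 0 < orient (C k) (C (k + 1)) z}

/-- The closed region bounded by the quadrilateral with vertices `C k`. -/
def hull (o : ℂ) (C : ZMod 4 → ℂ) : Set ℂ :=
  {z | ∃ k, InCone o C k z ∧ 0 ≤ orient (C k) (C (k + 1)) z}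

/-- The closed polygon with vertices `C k`. -/
def boundary (C : ZMod 4 → ℂ) : Set ℂ := ⋃ k, segment ℝ (C k) (C (k + 1))

variable {o : ℂ} {C : ZMod 4 → ℂ}

/-- The Plücker relation for four directions at `o`. -/
theorem orient_plucker (o a b c z : ℂ) : orient o z a * orient o b c + orient o z b * orient o c a
    + orient o z c * orient o a b = 0 := by
  simp only [orient_def]; ring

/-- The triangle `oab` is cut into three by a point `z`. -/
theorem orient_side (o a b z : ℂ) :
    orient a b z = orient o a b - orient o a z - orient o z b := by
  simp only [orient_def]; ring

/-- The four angles at `o` cover the plane. -/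
theorem exists_inCone (hC : ∀ k, 0 < orient o (C k) (C (k + 1))) (z : ℂ) :
    ∃ k, InCone o C k z := by
  by_contra hcon
  push Not at hcon
  have h : ∀ k, orient o z (C k) ≤ 0 → orient o z (C (k + 1)) < 0 := by
    intro k hk
    by_contra h
    exact hcon k ⟨by rw [orient_swap]; linarith, not_lt.1 h⟩
  have h0 := h 0
  have h1 := h 1
  have h2 := h 2
  have h3 := h 3
  have c0 := hC 0
  have c1 := hC 1
  have c2 := hC 2
  have c3 := hC 3
  simp only [show (0 : ZMod 4) + 1 = 1 by decide, show (1 : ZMod 4) + 1 = 2 by decide,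
    show (2 : ZMod 4) + 1 = 3 by decide, show (3 : ZMod 4) + 1 = 0 by decide] at *
  have p1 := orient_plucker o (C 0) (C 1) (C 2) z
  have p2 := orient_plucker o (C 2) (C 3) (C 0) z
  have e := orient_swap o (C 0) (C 2)
  -- the four determinants with `z` have the same sign, so both diagonals would have to turn
  -- around `o` in the same sense
  rcases lt_or_ge 0 (orient o z (C 0)) with hz | hz
  · have z3 : 0 < orient o z (C 3) := by
      by_contra h; linarith [h3 (not_lt.1 h)]
    have z2 : 0 < orient o z (C 2) := by
      by_contra h; linarith [h2 (not_lt.1 h)]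
    have z1 : 0 < orient o z (C 1) := by
      by_contra h; linarith [h1 (not_lt.1 h)]
    have := mul_pos hz c1
    have := mul_pos z2 c0
    have := mul_pos z2 c3
    have := mul_pos hz c2
    have k1 : orient o (C 2) (C 0) < 0 := by
      by_contra h; nlinarith [mul_nonneg z1.le (not_lt.1 h)]
    have k2 : orient o (C 0) (C 2) < 0 := by
      by_contra h; nlinarith [mul_nonneg z3.le (not_lt.1 h)]
    linarith
  · have z1 := h0 hz
    have z2 := h1 z1.le
    have z3 := h2 z2.le
    have z0 := h3 z3.le
    have := mul_pos (neg_pos.2 z0) c1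
    have := mul_pos (neg_pos.2 z2) c0
    have := mul_pos (neg_pos.2 z2) c3
    have := mul_pos (neg_pos.2 z0) c2
    have k1 : orient o (C 2) (C 0) < 0 := by
      by_contra h; nlinarith [mul_nonneg (neg_pos.2 z1).le (not_lt.1 h)]
    have k2 : orient o (C 0) (C 2) < 0 := by
      by_contra h; nlinarith [mul_nonneg (neg_pos.2 z3).le (not_lt.1 h)]
    linarith

/-- Two of the four angles overlap in a ray at most, so that the conditions for `z` to lie inside
agree on the overlap. -/
theorem overlap (hC : ∀ k, 0 < orient o (C k) (C (k + 1))) {k l : ZMod 4} {z : ℂ}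
    (hk : InCone o C k z) (hl : InCone o C l z) :
    ∃ r : ℝ, 0 < r ∧ orient (C l) (C (l + 1)) z = r * orient (C k) (C (k + 1)) z := by
  have hadj : ∀ k, InCone o C k z → InCone o C (k + 1) z →
      orient o (C k) (C (k + 1)) * orient (C (k + 1)) (C (k + 1 + 1)) z =
        orient o (C (k + 1)) (C (k + 1 + 1)) * orient (C k) (C (k + 1)) z := by
    intro k hk hl
    have hz : orient o z (C (k + 1)) = 0 := by
      have := hk.2
      have h2 := hl.1
      rw [orient_swap] at h2
      linarith
    have e := orient_swap o z (C (k + 1))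
    have e1 := orient_swap o z (C k)
    rw [orient_side o (C k), orient_side o (C (k + 1)) (C (k + 1 + 1)), e, hz, e1]
    have := orient_plucker o (C k) (C (k + 1)) (C (k + 1 + 1)) z
    rw [hz] at this
    linear_combination -this
  have hopp : ∀ k, InCone o C k z → InCone o C (k + 2) z →
      orient (C k) (C (k + 1)) z = orient o (C k) (C (k + 1)) := by
    intro k hk hl
    have c0 := hC k
    have c1 := hC (k + 1)
    have c2 := hC (k + 2)
    have c3 := hC (k + 3)
    rw [show k + 1 + 1 = k + 2 by ring] at c1
    rw [show k + 2 + 1 = k + 3 by ring] at c2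
    rw [(by decide : ∀ k : ZMod 4, k + 3 + 1 = k) k] at c3
    have y0 := hk.1
    have y1 := hk.2
    have y2 := hl.1
    have y3 := hl.2
    rw [show k + 2 + 1 = k + 3 by ring] at y3
    rw [orient_swap] at y0 y2
    have p1 := orient_plucker o (C (k + 1)) (C (k + 2)) (C (k + 3)) z
    have p2 := orient_plucker o (C (k + 3)) (C k) (C (k + 1)) z
    have p3 := orient_plucker o (C k) (C (k + 1)) (C (k + 2)) z
    have e := orient_swap o (C (k + 3)) (C (k + 1))
    have m1 := mul_nonneg y1 c2.le
    have m2 := mul_nonneg y3 c1.le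
    have m3 := mul_nonneg y3 c0.le
    have m4 := mul_nonneg y1 c3.le
    have z13 : orient o z (C (k + 1)) = 0 := by
      by_contra hne
      have hp := lt_of_le_of_ne y1 (Ne.symm hne)
      have := mul_pos hp c2
      have := mul_pos hp c3
      have k1 : 0 < orient o (C (k + 3)) (C (k + 1)) := by
        by_contra h; nlinarith [mul_nonneg y2 (neg_nonneg.2 (not_lt.1 h))]
      have k2 : 0 < orient o (C (k + 1)) (C (k + 3)) := by
        by_contra h; nlinarith [mul_nonneg y0 (neg_nonneg.2 (not_lt.1 h))]
      linarith
    have z0 : orient o z (C k) = 0 := by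
      rw [z13] at p3
      by_contra hne
      have := mul_pos (lt_of_le_of_ne y0 fun h => hne (by linarith)) c1
      have := mul_nonneg y2 c0.le
      linarith
    rw [orient_side o, z13, orient_swap o z, z0]
    ring
  have hkl := (by decide : ∀ k l : ZMod 4, l = k ∨ l = k + 1 ∨ k = l + 1 ∨ l = k + 2) k l
  rcases hkl with rfl | rfl | rfl | rfl
  · exact ⟨1, one_pos, by ring⟩
  · refine ⟨_, div_pos (hC (k + 1)) (hC k), ?_⟩
    have := (hC k).ne'
    field_simp
    linarith [hadj k hk hl]
  · refine ⟨_, div_pos (hC l) (hC (l + 1)), ?_⟩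
    have := (hC (l + 1)).ne'
    field_simp
    linarith [hadj l hl hk]
  · refine ⟨_, div_pos (hC (k + 2)) (hC k), ?_⟩
    have h2 := hopp (k + 2) hl (by rwa [(by decide : ∀ k : ZMod 4, k + 2 + 2 = k) k])
    have := (hC k).ne'
    rw [h2, hopp k hk hl, div_mul_cancel₀ _ this]

theorem mem_inside_of (hC : ∀ k, 0 < orient o (C k) (C (k + 1))) {k : ZMod 4} {z : ℂ}
    (hk : InCone o C k z) (h : 0 < orient (C k) (C (k + 1)) z) : z ∈ inside o C := by
  intro l hl
  obtain ⟨r, hr, e⟩ := overlap hC hk hl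
  rw [e]; positivity

theorem inCone_of_mem_segment (hC : ∀ k, 0 < orient o (C k) (C (k + 1))) {k : ZMod 4} {z : ℂ}
    (hz : z ∈ segment ℝ (C k) (C (k + 1))) :
    InCone o C k z ∧ orient (C k) (C (k + 1)) z = 0 := by
  obtain ⟨t, h0, h1, hre, him⟩ := mem_segment_iff.1 hz
  have e1 : orient o (C k) z = t * orient o (C k) (C (k + 1)) := by
    simp only [orient_def, hre, him]; ring
  have e2 : orient o z (C (k + 1)) = (1 - t) * orient o (C k) (C (k + 1)) := by
    simp only [orient_def, hre, him]; ring
  refine ⟨⟨?_, ?_⟩, ?_⟩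
  · rw [e1]; exact mul_nonneg h0 (hC k).le
  · rw [e2]; exact mul_nonneg (by linarith) (hC k).le
  · rw [orient_side o, e1, e2]; ring

theorem notMem_boundary (hC : ∀ k, 0 < orient o (C k) (C (k + 1))) {z : ℂ}
    (hz : z ∈ inside o C) : z ∉ boundary C := by
  intro h
  obtain ⟨k, hk⟩ := Set.mem_iUnion.1 h
  have := inCone_of_mem_segment hC hk
  linarith [hz k this.1, this.2]

theorem inside_subset_hull (hC : ∀ k, 0 < orient o (C k) (C (k + 1))) :
    inside o C ⊆ hull o C := by
  intro z hz
  obtain ⟨k, hk⟩ := exists_inCone hC z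
  exact ⟨k, hk, (hz k hk).le⟩

theorem inside_or_boundary (hC : ∀ k, 0 < orient o (C k) (C (k + 1))) {z : ℂ}
    (hz : z ∈ hull o C) : z ∈ inside o C ∨ z ∈ boundary C := by
  obtain ⟨k, hk, h⟩ := hz
  rcases h.lt_or_eq with h | h
  · exact Or.inl (mem_inside_of hC hk h)
  · exact Or.inr (Set.mem_iUnion.2 ⟨k, mem_segment_of_orient
      (by rw [orient_rotate]; exact hC k) h.symm (by rw [← orient_rotate]; exact hk.2)
      (by rw [orient_rotate, orient_rotate, ← orient_rotate, ← orient_rotate]; exact hk.1)⟩)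

theorem isClosed_cone_inter (k : ZMod 4) (s : Set ℝ) (hs : IsClosed s) :
    IsClosed {z | InCone o C k z ∧ orient (C k) (C (k + 1)) z ∈ s} :=
  ((isClosed_le continuous_const (continuous_orient_right _ _)).inter
    (isClosed_le continuous_const (continuous_orient_mid _ _))).inter
      (hs.preimage (continuous_orient_right _ _))

theorem isClosed_hull : IsClosed (hull o C) := by
  have : hull o C = ⋃ k, {z | InCone o C k z ∧ orient (C k) (C (k + 1)) z ∈ Set.Ici 0} := by
    ext z; simp [hull]
  rw [this]
  exact isClosed_iUnion_of_finite fun k => isClosed_cone_inter k _ isClosed_Ici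

theorem isOpen_inside : IsOpen (inside o C) := by
  have : inside o C = (⋃ k, {z | InCone o C k z ∧ orient (C k) (C (k + 1)) z ∈ Set.Iic 0})ᶜ := by
    ext z; simp [inside]
  rw [this, isOpen_compl_iff]
  exact isClosed_iUnion_of_finite fun k => isClosed_cone_inter k _ isClosed_Iic

theorem isBounded_hull (hC : ∀ k, 0 < orient o (C k) (C (k + 1))) :
    Bornology.IsBounded (hull o C) := by
  refine (Metric.isBounded_closedBall (x := o) (r := 2 * ∑ k, ‖C k - o‖)).subset ?_
  rintro z ⟨k, hk, h⟩
  have hD := hC k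
  rw [orient_side o] at h
  have hle : ∀ l, ‖C l - o‖ ≤ ∑ k, ‖C k - o‖ := fun l =>
    Finset.single_le_sum (f := fun k => ‖C k - o‖) (fun _ _ => norm_nonneg _) (Finset.mem_univ l)
  have hz : z - o = ((orient o z (C (k + 1)) / orient o (C k) (C (k + 1)) : ℝ) : ℂ) * (C k - o)
      + ((orient o (C k) z / orient o (C k) (C (k + 1)) : ℝ) : ℂ) * (C (k + 1) - o) := by
    apply Complex.ext
    · simp only [Complex.add_re, Complex.re_ofReal_mul, Complex.sub_re]
      field_simp
      simp only [orient_def]; ring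
    · simp only [Complex.add_im, Complex.im_ofReal_mul, Complex.sub_im]
      field_simp
      simp only [orient_def]; ring
  rw [Metric.mem_closedBall, dist_eq_norm, hz]
  refine (norm_add_le _ _).trans ?_
  rw [norm_mul, norm_mul, Complex.norm_real, Complex.norm_real,
    Real.norm_of_nonneg (div_nonneg hk.2 hD.le), Real.norm_of_nonneg (div_nonneg hk.1 hD.le)]
  have h1 : orient o z (C (k + 1)) / orient o (C k) (C (k + 1)) ≤ 1 := by
    rw [div_le_one hD]; linarith [hk.1]
  have h2 : orient o (C k) z / orient o (C k) (C (k + 1)) ≤ 1 := by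
    rw [div_le_one hD]; linarith [hk.2]
  have h3 := mul_le_mul h1 (hle k) (norm_nonneg _) zero_le_one
  have h4 := mul_le_mul h2 (hle (k + 1)) (norm_nonneg _) zero_le_one
  linarith

/-- A connected set that avoids the boundary and meets the interior lies in the interior. -/
theorem subset_inside (hC : ∀ k, 0 < orient o (C k) (C (k + 1))) {S : Set ℂ}
    (hS : IsPreconnected S) (hb : Disjoint S (boundary C)) {z : ℂ} (hz : z ∈ S)
    (hz' : z ∈ inside o C) : S ⊆ inside o C := by
  refine hS.subset_left_of_subset_union isOpen_inside (isClosed_hull (o := o) (C := C)).isOpen_compl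
    ?_ ?_ ⟨z, hz, hz'⟩
  · exact Set.disjoint_compl_right_iff_subset.2 (inside_subset_hull hC)
  · intro x hx
    by_cases h : x ∈ hull o C
    · exact Or.inl ((inside_or_boundary hC h).resolve_right (Set.disjoint_left.1 hb hx))
    · exact Or.inr h

theorem component_subset_inside (hC : ∀ k, 0 < orient o (C k) (C (k + 1))) {z : ℂ}
    (hz : z ∈ inside o C) : connectedComponentIn (boundary C)ᶜ z ⊆ inside o C :=
  subset_inside hC isPreconnected_connectedComponentIn
    (Set.disjoint_left.2 fun _ h => connectedComponentIn_subset _ _ h)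
    (mem_connectedComponentIn (notMem_boundary hC hz)) hz

/-- The points that the quadrilateral encloses in the topological sense are those of `inside`: from
any other point the ray away from `o` escapes to infinity. -/
theorem enclosed_boundary (hC : ∀ k, 0 < orient o (C k) (C (k + 1))) :
    enclosed (boundary C) = inside o C := by
  ext z
  constructor
  · rintro ⟨hzb, hbd⟩
    by_contra hz
    have hz : ¬ ∀ k, InCone o C k z → 0 < orient (C k) (C (k + 1)) z := hz
    push Not at hz
    obtain ⟨k, hk, h⟩ := hz
    have hlt : orient (C k) (C (k + 1)) z < 0 := by
      refine lt_of_le_of_ne h fun h0 => ?_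
      rcases inside_or_boundary hC ⟨k, hk, h0.ge⟩ with h' | h'
      · linarith [h' k hk]
      · exact hzb h'
    have e := orient_side o (C k) (C (k + 1)) z
    have hD := hC k
    have hne : z - o ≠ 0 := by
      intro h0
      rw [sub_eq_zero] at h0
      subst h0
      rw [orient_self_left] at e
      simp only [orient_def] at *
      linarith
    refine not_isBounded_component (isPreconnected_ray z (z - o)) ⟨0, by simp, by simp⟩ ?_
      (not_isBounded_ray z hne) hbd
    -- the ray from `z` away from `o` does not meet the boundary
    rintro _ ⟨s, hs, rfl⟩ hw
    simp only [Set.mem_Ici] at hs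
    have e1 : orient o (C k) (z + s * (z - o)) = (1 + s) * orient o (C k) z := by
      simp [orient_def]; ring
    have e2 : orient o (z + s * (z - o)) (C (k + 1)) = (1 + s) * orient o z (C (k + 1)) := by
      simp [orient_def]; ring
    have hcone : InCone o C k (z + s * (z - o)) :=
      ⟨by rw [e1]; exact mul_nonneg (by linarith) hk.1,
        by rw [e2]; exact mul_nonneg (by linarith) hk.2⟩
    have e3 := orient_side o (C k) (C (k + 1)) (z + s * (z - o))
    obtain ⟨l, hl⟩ := Set.mem_iUnion.1 hw
    have hl' := inCone_of_mem_segment hC hl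
    obtain ⟨r, hr, e4⟩ := overlap hC hcone hl'.1
    rw [hl'.2, e3, e1, e2] at e4
    rcases mul_eq_zero.1 e4.symm with h | h
    · exact hr.ne' h
    · nlinarith [hk.1, hk.2]
  · intro hz
    exact ⟨notMem_boundary hC hz, ((isBounded_hull hC).subset (inside_subset_hull hC)).subset
      (component_subset_inside hC hz)⟩

theorem center_mem (hC : ∀ k, 0 < orient o (C k) (C (k + 1))) : o ∈ inside o C := by
  intro k _
  rw [orient_rotate]
  exact hC k

/-- The interior is star-shaped, hence connected. -/
theorem isPreconnected_inside (hC : ∀ k, 0 < orient o (C k) (C (k + 1))) :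
    IsPreconnected (inside o C) := by
  refine isPreconnected_of_forall o fun z hz => ⟨segment ℝ o z, ?_, left_mem_segment _ _ _,
    right_mem_segment _ _ _, (convex_segment _ _).isPreconnected⟩
  intro x hx
  obtain ⟨t, h0, h1, hre, him⟩ := mem_segment_iff.1 hx
  obtain ⟨k, hk⟩ := exists_inCone hC z
  have h := hz k hk
  have e1 : orient o (C k) x = t * orient o (C k) z := by
    simp only [orient_def, hre, him]; ring
  have e2 : orient o x (C (k + 1)) = t * orient o z (C (k + 1)) := by
    simp only [orient_def, hre, him]; ring
  refine mem_inside_of hC (k := k) ⟨by rw [e1]; exact mul_nonneg h0 hk.1,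
    by rw [e2]; exact mul_nonneg h0 hk.2⟩ ?_
  have := hC k
  rw [orient_side o, e1, e2]
  rw [orient_side o] at h
  nlinarith [hk.1, hk.2]

/-- The open triangle with corners `C k`, `C (k + 1)` and `o` lies in the interior. -/
theorem mem_inside_of_inTri (hC : ∀ k, 0 < orient o (C k) (C (k + 1))) {k : ZMod 4} {z : ℂ}
    (h : InTri (C k) (C (k + 1)) o z) : z ∈ inside o C := by
  have h' := h.pos (by rw [orient_rotate]; exact hC k)
  refine mem_inside_of hC (k := k) ⟨h'.2.2.le, ?_⟩ h'.1
  rw [orient_rotate]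
  exact h'.2.1.le

end StarQuad

/-! ### The regions covered by the two copies -/

section Drawing

variable {V : Type*} {H : SimpleGraph V} {p : V → ℂ} {u v a b : V} {t : ℝ} {z : ℂ}

theorem pointOn_re (p : V → ℂ) (u v : V) (t : ℝ) :
    (pointOn p u v t).re = (p u).re + t * ((p v).re - (p u).re) := by
  simp [pointOn, AffineMap.lineMap_apply]; ring

theorem pointOn_im (p : V → ℂ) (u v : V) (t : ℝ) :
    (pointOn p u v t).im = (p u).im + t * ((p v).im - (p u).im) := by
  simp [pointOn, AffineMap.lineMap_apply]; ring

theorem pointOn_swap (p : V → ℂ) (u v : V) (t : ℝ) : pointOn p v u (1 - t) = pointOn p u v t :=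
  AffineMap.lineMap_apply_one_sub _ _ _

theorem pointOn_mem_openSegment (h0 : 0 < t) (h1 : t < 1) :
    pointOn p u v t ∈ openSegment ℝ (p u) (p v) :=
  mem_openSegment_iff.2 ⟨t, h0, h1, pointOn_re _ _ _ _, pointOn_im _ _ _ _⟩

theorem mem_segment_iff_pointOn :
    z ∈ segment ℝ (p u) (p v) ↔ ∃ t, 0 ≤ t ∧ t ≤ 1 ∧ z = pointOn p u v t := by
  rw [mem_segment_iff]
  refine exists_congr fun t => and_congr_right fun _ => and_congr_right fun _ => ?_
  rw [Complex.ext_iff, pointOn_re, pointOn_im]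

theorem pointOn_zero : pointOn p u v 0 = p u := AffineMap.lineMap_apply_zero _ _

theorem pointOn_one : pointOn p u v 1 = p v := AffineMap.lineMap_apply_one _ _

/-- An edge that does not cross `ab` has no interior point in common with it. -/
theorem IsRACDrawing.pointOn_notMem (hp : IsRACDrawing H p) (huv : H.Adj u v) (hab : H.Adj a b)
    (hne : s(u, v) ≠ s(a, b)) (hc : ¬ Crosses H p u v a b) (h0 : 0 < t) (h1 : t < 1) :
    pointOn p u v t ∉ segment ℝ (p a) (p b) := by
  intro h
  have ho := pointOn_mem_openSegment (p := p) (u := u) (v := v) h0 h1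
  have hend : ∀ w, pointOn p u v t ≠ p w := by
    intro w hw
    rw [hw] at ho
    have hpne : p u ≠ p v := fun e => huv.ne (hp.injective e)
    rcases hp.vertex_edge _ _ _ huv (openSegment_subset_segment ℝ _ _ ho) with rfl | rfl
    · exact hpne (left_mem_openSegment_iff.1 ho)
    · exact hpne (right_mem_openSegment_iff.1 ho)
  exact hc ⟨huv, hab, hne, _, ho, mem_openSegment_of_ne_left_right (hend a).symm (hend b).symm h⟩

/-- The part of an edge between two parameters lies inside a star-shaped quadrilateral if it does
not meet the boundary and one end of it lies inside. -/
theorem pointOn_mem_inside {o : ℂ} {C : ZMod 4 → ℂ} (hC : ∀ k, 0 < orient o (C k) (C (k + 1)))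
    {s : ℝ} (hs : pointOn p u v s ∈ StarQuad.inside o C)
    (hb : ∀ r ∈ Set.uIcc s t, pointOn p u v r ∉ StarQuad.boundary C) :
    pointOn p u v t ∈ StarQuad.inside o C := by
  have hcont : Continuous (pointOn p u v) := AffineMap.lineMap_continuous
  refine StarQuad.subset_inside hC (S := pointOn p u v '' Set.uIcc s t)
    (isPreconnected_uIcc.image _ hcont.continuousOn) ?_ ⟨s, Set.left_mem_uIcc, rfl⟩ hs
    ⟨t, Set.right_mem_uIcc, rfl⟩
  rw [Set.disjoint_left]
  rintro _ ⟨r, hr, rfl⟩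
  exact hb r hr

end Drawing

/-- The even elements of `ZMod 8`, numbered cyclically. -/
def double (k : ZMod 4) : ZMod 8 := 2 * (k.val : ZMod 8)

theorem double_add_one (k : ZMod 4) : double (k + 1) = double k + 2 := by decide +revert

theorem exists_double (m : ZMod 8) : ∃ k, 2 * m = double k := by decide +revert

/-- The corners of the outer quadrilateral of a copy. -/
def corner {V : Type*} (p : V → ℂ) (c : ZMod 8 → V) (k : ZMod 4) : ℂ := p (c (double k))

namespace IsPairDrawing

variable {V : Type*} {H : SimpleGraph V} {p : V → ℂ} {o o' : V} {c d : ZMod 8 → V}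
  {u v x y x' y' : V} {z : ℂ}

/-- The outer quadrilateral of a copy is star-shaped with respect to the centre. -/
theorem star (P : IsPairDrawing H p o c o' d) (k : ZMod 4) :
    0 < orient (p o) (corner p c k) (corner p c (k + 1)) :=
  P.left.pos.quad P.glued.left P.rac (double_add_one k)

theorem mem_boundary_iff : z ∈ StarQuad.boundary (corner p c) ↔
    ∃ m : ZMod 8, z ∈ segment ℝ (p (c (2 * m))) (p (c (2 * m + 2))) := by
  simp only [StarQuad.boundary, Set.mem_iUnion, corner]
  constructor
  · rintro ⟨k, hk⟩
    rw [double_add_one] at hk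
    exact ⟨_, hk⟩
  · rintro ⟨m, hm⟩
    obtain ⟨k, hk⟩ := exists_double m
    exact ⟨k, by rwa [double_add_one, ← hk]⟩

theorem odd_mem_inside (P : IsPairDrawing H p o c o' d) (m : ZMod 8) :
    p (c (2 * m + 1)) ∈ StarQuad.inside (p o) (corner p c) := by
  obtain ⟨k, hk⟩ := exists_double m
  have := P.left.pos.inside_even P.glued.left P.rac P.left.outer m
  refine StarQuad.mem_inside_of_inTri P.star (k := k) ?_
  rw [corner, corner, double_add_one, ← hk]
  exact this

/-- The only vertices in the region covered by a copy are those of the copy. -/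
theorem eq_of_mem_inside (P : IsPairDrawing H p o c o' d)
    (h : p v ∈ StarQuad.inside (p o) (corner p c)) : v = o ∨ ∃ m, v = c (2 * m + 1) := by
  have w := P.glued.left
  obtain ⟨k, hk⟩ := StarQuad.exists_inCone P.star (p v)
  have h0 := h k hk
  have hS := P.star k
  have hS' : 0 < orient (corner p c (k + 1)) (p o) (corner p c k) := by rwa [← orient_rotate]
  have hk2 : 0 ≤ orient (corner p c (k + 1)) (p o) (p v) := by rw [← orient_rotate]; exact hk.2
  have hcor : ∀ l, v ≠ c (double l) := by
    rintro l rfl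
    refine StarQuad.notMem_boundary P.star h (mem_boundary_iff.2 ⟨_, left_mem_segment ℝ _ _⟩)
  rcases hk.1.lt_or_eq with h1 | h1
  · rcases hk2.lt_or_eq with h2 | h2
    · right
      refine ⟨_, P.glued.eq_of_inside_cell P.rac P.left (m := (k.val : ZMod 8)) ?_⟩
      left
      rw [show 2 * (k.val : ZMod 8) + 2 = double (k + 1) from (double_add_one k).symm]
      exact ⟨h0, h2, h1⟩
    · have := mem_segment_of_orient hS' h2.symm hk.1 h0.le
      rcases P.rac.vertex_edge _ _ _ (w.spoke _).symm this with e | e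
      exacts [absurd e (hcor _), Or.inl e]
  · have := mem_segment_of_orient hS h1.symm h0.le hk2
    rcases P.rac.vertex_edge _ _ _ (w.spoke _) this with e | e
    exacts [Or.inl e, absurd e (hcor _)]

theorem outer_adj (P : IsPairDrawing H p o c o' d) (m : ZMod 8) :
    H.Adj (c (2 * m)) (c (2 * m + 2)) := P.glued.left.quad _

theorem pointOn_notMem_boundary (P : IsPairDrawing H p o c o' d) (huv : H.Adj u v)
    (hne : ∀ m, s(u, v) ≠ s(c (2 * m), c (2 * m + 2))) {t : ℝ} (h0 : 0 < t) (h1 : t < 1)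
    (ht : s(u, v) = s(c 1, d 1) → pointOn p u v t ∉ segment ℝ (p (c 0)) (p (c 2))) :
    pointOn p u v t ∉ StarQuad.boundary (corner p c) := by
  rw [mem_boundary_iff]
  rintro ⟨m, hm⟩
  by_cases hc : Crosses H p u v (c (2 * m)) (c (2 * m + 2))
  · obtain ⟨e1, e2⟩ := P.outer_crosses hc.symm
    rw [e1, zero_add] at hm
    exact ht e2 hm
  · exact P.rac.pointOn_notMem huv (P.outer_adj m) (hne m) hc h0 h1 hm

/-- The edges of a copy, except for those of the outer quadrilateral, have an end in the interior
of this quadrilateral, and stay there. -/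
theorem pointOn_mem_inside (P : IsPairDrawing H p o c o' d) (huv : H.Adj u v)
    (hu : p u ∈ StarQuad.inside (p o) (corner p c))
    {t : ℝ} (h0 : 0 < t) (h1 : t < 1) (ht : s(u, v) = s(c 1, d 1) → ∀ r, 0 < r → r ≤ t →
      pointOn p u v r ∉ segment ℝ (p (c 0)) (p (c 2))) :
    pointOn p u v t ∈ StarQuad.inside (p o) (corner p c) := by
  refine RAC.pointOn_mem_inside P.star (s := 0) (by rwa [pointOn_zero]) fun r hr => ?_
  rw [Set.uIcc_of_le h0.le, Set.mem_Icc] at hr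
  rcases hr.1.lt_or_eq with hr0 | rfl
  · refine P.pointOn_notMem_boundary huv ?_ hr0 (hr.2.trans_lt h1) fun e => ht e r hr0 hr.2
    intro m e
    have hb : ∀ n, p (c (2 * n)) ∉ StarQuad.inside (p o) (corner p c) := fun n h =>
      StarQuad.notMem_boundary P.star h (mem_boundary_iff.2 ⟨_, left_mem_segment ℝ _ _⟩)
    rcases Sym2.eq_iff.1 e with ⟨rfl, -⟩ | ⟨rfl, -⟩
    · exact hb _ hu
    · rw [show 2 * m + 2 = 2 * (m + 1) by ring] at hu
      exact hb _ hu
  · rw [pointOn_zero]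
    exact StarQuad.notMem_boundary P.star hu

theorem boundary_subset_carrier (P : IsPairDrawing H p o c o' d) :
    StarQuad.boundary (corner p c) ⊆ carrier H p := by
  intro z hz
  obtain ⟨m, hm⟩ := mem_boundary_iff.1 hz
  exact ⟨_, _, P.outer_adj m, hm⟩

/-- The region enclosed by an outer quadrilateral does not meet the outer face. -/
theorem notMem_outerFace (P : IsPairDrawing H p o c o' d)
    (hz : z ∈ StarQuad.inside (p o) (corner p c)) : z ∉ outerFace H p := by
  intro h
  have h1 : z ∈ enclosed (StarQuad.boundary (corner p c)) := by
    rwa [StarQuad.enclosed_boundary P.star]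
  exact h.2 (h1.2.subset (connectedComponentIn_mono _
    (Set.compl_subset_compl.2 P.boundary_subset_carrier)))

/-- The edges of the outer quadrilateral of a copy do not meet the interior of the other one. -/
theorem inside_disjoint_boundary (P : IsPairDrawing H p o c o' d) :
    Disjoint (StarQuad.inside (p o') (corner p d)) (StarQuad.boundary (corner p c)) := by
  rw [Set.disjoint_left]
  intro z hz hb
  obtain ⟨m, hm⟩ := mem_boundary_iff.1 hb
  have hin : ∀ m, p (c (2 * m)) ∉ StarQuad.inside (p o') (corner p d) := by
    intro m h
    rcases P.symm.eq_of_mem_inside h with e | ⟨n, e⟩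
    · exact P.glued.left_ne _ e.symm
    · exact absurd (P.glued.eq_of_eq _ _ e).2
        ((by decide : ∀ n : ZMod 8, ¬ (2 * n + 1 = 0 ∨ 2 * n + 1 = 2)) n)
  by_cases hm0 : 2 * m = 0
  · rw [hm0, zero_add, P.zero_eq, P.two_eq, segment_symm] at hm
    exact StarQuad.notMem_boundary P.symm.star hz (mem_boundary_iff.2 ⟨0, by
      rwa [mul_zero, zero_add]⟩)
  have key : ∀ u v : V, H.Adj u v → (∀ x y, ¬ Crosses H p u v x y) → (∀ n, v ≠ d n) →
      p u ∉ StarQuad.inside (p o') (corner p d) → p v ∉ StarQuad.inside (p o') (corner p d) →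
      z ∉ segment ℝ (p u) (p v) := by
    intro u v huv hX hd hu hv hz'
    obtain ⟨t, h0, h1, rfl⟩ := mem_segment_iff_pointOn.1 hz'
    have h0 : 0 < t := h0.lt_of_ne (by rintro rfl; rw [pointOn_zero] at hz; exact hu hz)
    have h1 : t < 1 := h1.lt_of_ne (by rintro rfl; rw [pointOn_one] at hz; exact hv hz)
    have hne : ∀ n, s(u, v) ≠ s(d (2 * n), d (2 * n + 2)) := by
      intro n e
      rcases Sym2.eq_iff.1 e with ⟨-, e⟩ | ⟨-, e⟩ <;> exact hd _ e
    have := RAC.pointOn_mem_inside P.symm.star (t := 1) hz fun r hr => ?_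
    · rw [pointOn_one] at this
      exact hv this
    · rw [Set.uIcc_of_le h1.le, Set.mem_Icc] at hr
      rcases hr.2.lt_or_eq with hr1 | rfl
      · refine P.symm.pointOn_notMem_boundary huv hne (h0.trans_le hr.1) hr1 fun e => ?_
        exact absurd (P.symm.link_crosses.congr e.symm rfl) (hX _ _)
      · rw [pointOn_one, mem_boundary_iff]
        rintro ⟨n, hn⟩
        rcases P.rac.vertex_edge _ _ _ (P.symm.outer_adj n) hn with e | e <;> exact hd _ e
  have hX : ∀ x y, ¬ Crosses H p (c (2 * m)) (c (2 * m + 2)) x y := fun x y h =>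
    hm0 (P.outer_crosses h).1
  have h2 : p (c (2 * m + 2)) ∉ StarQuad.inside (p o') (corner p d) := by
    rw [show 2 * m + 2 = 2 * (m + 1) by ring]; exact hin _
  by_cases hm2 : 2 * m = 2
  · refine key _ _ (P.outer_adj m) hX (fun n e => absurd (P.glued.eq_of_eq _ _ e).1 ?_) (hin m) h2
      hm
    rw [hm2]; decide
  · rw [segment_symm] at hm
    exact key _ _ (P.outer_adj m).symm (fun x y h => hX x y h.swap_left)
      (fun n e => absurd (P.glued.eq_of_eq _ _ e).1 (by tauto)) h2 (hin m) hm

/-- The interiors of the two outer quadrilaterals are disjoint: one that met the other one would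
contain it, with its centre. -/
theorem disjoint_inside (P : IsPairDrawing H p o c o' d) :
    Disjoint (StarQuad.inside (p o) (corner p c)) (StarQuad.inside (p o') (corner p d)) := by
  rw [Set.disjoint_left]
  intro z hz hz'
  have h := StarQuad.subset_inside P.star (StarQuad.isPreconnected_inside P.symm.star)
    P.inside_disjoint_boundary hz' hz (StarQuad.center_mem P.symm.star)
  rcases P.eq_of_mem_inside h with e | ⟨m, e⟩
  exacts [P.glued.center_ne e.symm, P.glued.left_ne _ e]

end IsPairDrawing

/-! ### The rotation at the vertices -/

theorem det_swap (a b : ℂ) : det b a = -det a b := by simp only [det]; ring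

theorem CyclicOrder.rotate {a b c : ℂ} (h : CyclicOrder a b c) : CyclicOrder b c a := by
  unfold CyclicOrder at *; tauto

theorem CyclicOrder.asymm {a b c : ℂ} (h : CyclicOrder a b c) : ¬ CyclicOrder a c b := by
  intro h'
  unfold CyclicOrder at *
  rw [det_swap c a, det_swap b c, det_swap a b] at h'
  rcases h with h | h | h <;> rcases h' with h' | h' | h' <;> linarith [h.1, h.2, h'.1, h'.2]

/-- Seen from `d`, the directions on the circle are linearly ordered. -/
theorem CyclicOrder.trans {a b c d : ℂ} (h : CyclicOrder a b d) (h' : CyclicOrder b c d) :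
    CyclicOrder a c d := by
  have id : det a c * det b d = det a b * det c d + det a d * det b c := by
    simp only [det]; ring
  have e1 := det_swap b d
  have e2 := det_swap a d
  unfold CyclicOrder at *
  rcases lt_or_ge 0 (det b d) with hbd | hbd
  · have h1 : 0 < det b c ∧ 0 < det c d := by
      rcases h' with h' | h' | h' <;> first | exact h' | (exfalso; linarith [h'.1, h'.2])
    by_cases hda : 0 < det d a
    · exact Or.inr (Or.inl ⟨h1.2, hda⟩)
    · left
      have hab : 0 < det a b := by tauto
      refine ⟨?_, h1.2⟩
      have := mul_pos hab h1.2
      have := mul_nonneg (by linarith : 0 ≤ det a d) h1.1.le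
      exact pos_of_mul_pos_left (by linarith) hbd.le
  · have h1 : 0 < det d a ∧ 0 < det a b := by
      rcases h with h | h | h <;> first | exact h | (exfalso; linarith [h.1, h.2])
    by_cases hcd : 0 < det c d
    · exact Or.inr (Or.inl ⟨hcd, h1.1⟩)
    · have h2 : 0 < det d b ∧ 0 < det b c := by tauto
      right; right
      refine ⟨h1.1, ?_⟩
      have := mul_nonneg h1.2.le (by linarith : 0 ≤ -det c d)
      have := mul_pos h1.1 h2.2
      refine pos_of_mul_pos_left (b := det d b) ?_ h2.1.le
      rw [e1] at *
      nlinarith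

section Drawing

variable {V : Type*} {H : SimpleGraph V} {p : V → ℂ} {u x y z : V}

/-- The edges `ux`, `uy`, `uz` leave `u` in this counterclockwise cyclic order. -/
def CyclicAt (p : V → ℂ) (u x y z : V) : Prop :=
  CyclicOrder (p x - p u) (p y - p u) (p z - p u)

/-- The edge `uy` comes next to `ux` in the counterclockwise order of the edges at `u`. -/
def IsSector (H : SimpleGraph V) (p : V → ℂ) (u x y : V) : Prop :=
  ∀ z, H.Adj u z → z ≠ x → z ≠ y → CyclicAt p u x y z

/-- An empty triangle at `u`, with an uncrossed side opposite to `u`, is a sector at `u`. -/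
theorem IsRACDrawing.isSector (hp : IsRACDrawing H p) (hux : H.Adj u x) (hxy : H.Adj x y)
    (huy : H.Adj u y) (hE : EmptyTri p x y u) (hX : ∀ a b, ¬ Crosses H p a b x y)
    (hS : 0 < orient (p u) (p x) (p y)) : IsSector H p u x y := by
  intro z hz hzx hzy
  by_contra hcon
  have hdet : ∀ a b, det (p a - p u) (p b - p u) = orient (p u) (p a) (p b) := fun _ _ => rfl
  simp only [CyclicAt, CyclicOrder, hdet] at hcon
  have h1 : 0 ≤ orient (p u) (p x) (p z) := by
    rw [orient_swap]
    by_contra h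
    exact hcon (Or.inr (Or.inr ⟨by linarith, hS⟩))
  have h2 : 0 ≤ orient (p u) (p z) (p y) := by
    rw [orient_swap]
    by_contra h
    exact hcon (Or.inl ⟨hS, by linarith⟩)
  have hline : ∀ {a b : V} {k : ℝ}, H.Adj u a → z ≠ a → 0 ≤ k →
      (p z).re - (p u).re = k * ((p a).re - (p u).re) →
      (p z).im - (p u).im = k * ((p a).im - (p u).im) → False := by
    intro a b k ha hza hk e1 e2
    rcases hk.lt_or_eq with hk | rfl
    · exact hp.not_same_direction ha hz hza.symm hk e1 e2
    · exact hz.ne (hp.injective (Complex.ext (by linarith) (by linarith)))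
  rcases h1.lt_or_eq with h1' | h1'
  · rcases h2.lt_or_eq with h2' | h2'
    · rcases hp.wedge hxy hz hS h1' h2' with h | h
      exacts [hE z h, hX _ _ h]
    · refine hline (b := x) (k := orient (p u) (p x) (p z) / orient (p u) (p x) (p y)) huy hzy
        (by positivity) ?_ ?_
      all_goals
        rw [div_mul_eq_mul_div, eq_div_iff hS.ne']
        simp only [orient_def] at *
      · linear_combination ((p u).re - (p x).re) * h2'
      · linear_combination ((p u).im - (p x).im) * h2'
  · refine hline (b := x) (k := orient (p u) (p z) (p y) / orient (p u) (p x) (p y)) hux hzx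
      (by positivity) ?_ ?_
    all_goals
      rw [div_mul_eq_mul_div, eq_div_iff hS.ne']
      simp only [orient_def] at *
    · linear_combination ((p u).re - (p y).re) * h1'
    · linear_combination ((p u).im - (p y).im) * h1'

/-- A list of edges at `u` is in counterclockwise order if all but the last two of its consecutive
members bound sectors. -/
theorem triplewise_of_isChain {L : List V} {y : V} (hadj : ∀ z ∈ L ++ [y], H.Adj u z)
    (hnd : (L ++ [y]).Nodup) (hL : L.IsChain (IsSector H p u)) :
    (L ++ [y]).Triplewise (CyclicAt p u) := by
  induction L with
  | nil => simp
  | cons a l ih =>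
    rw [List.cons_append] at hadj hnd ⊢
    have ih := ih (fun z hz => hadj z (List.mem_cons_of_mem _ hz)) (List.nodup_cons.1 hnd).2
      hL.of_cons
    refine List.triplewise_cons.2 ⟨?_, ih⟩
    cases l with
    | nil => simp
    | cons b l' =>
      rw [List.cons_append] at *
      have hab : IsSector H p u a b := (List.isChain_cons_cons.1 hL).1
      have hnd' := List.nodup_cons.1 hnd
      have key : ∀ z ∈ l' ++ [y], CyclicAt p u a b z := fun z hz =>
        hab z (hadj z (by simp only [List.mem_cons]; tauto))
          (fun e => hnd'.1 (e ▸ List.mem_cons_of_mem _ hz))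
          (fun e => (List.nodup_cons.1 hnd'.2).1 (e ▸ hz))
      refine List.pairwise_cons.2 ⟨key, ?_⟩
      have h2 := (List.triplewise_cons.1 ih).1
      refine h2.imp_of_mem fun {x z} hx hz hxz => ?_
      exact CyclicOrder.trans (key z hz) hxz

/-- The order of three members of a list determines their cyclic order in every drawing in which the
list is in counterclockwise order. -/
theorem cyclicAt_congr {q : V → ℂ} {L : List V} (hp : L.Triplewise (CyclicAt p u))
    (hq : L.Triplewise (CyclicAt q u)) (hx : x ∈ L) (hy : y ∈ L) (hz : z ∈ L)
    (h : CyclicAt p u x y z) : CyclicAt q u x y z := by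
  have hself : ∀ {a b : ℂ}, ¬ CyclicOrder a a b := by
    intro a b h
    have e1 : det a a = 0 := by simp only [det]; ring
    have e2 := det_swap a b
    unfold CyclicOrder at h
    rcases h with h | h | h <;> linarith [h.1, h.2]
  obtain ⟨i, hi, rfl⟩ := List.getElem_of_mem hx
  obtain ⟨j, hj, rfl⟩ := List.getElem_of_mem hy
  obtain ⟨k, hk, rfl⟩ := List.getElem_of_mem hz
  have hp' := List.triplewise_iff_getElem.1 hp
  have hq' := List.triplewise_iff_getElem.1 hq
  rcases lt_trichotomy i j with hij | rfl | hij
  · rcases lt_trichotomy j k with hjk | rfl | hjk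
    · exact hq' i j k hij hjk hk
    · exact absurd h.rotate hself
    · rcases lt_trichotomy i k with hik | rfl | hik
      · exact absurd (hp' i k j hik hjk hj) h.asymm
      · exact absurd h.rotate.rotate hself
      · exact (hq' k i j hik hij hj).rotate
  · exact absurd h hself
  · rcases lt_trichotomy i k with hik | rfl | hik
    · exact absurd (hp' j i k hij hik hk).rotate h.asymm
    · exact absurd h.rotate.rotate hself
    · rcases lt_trichotomy j k with hjk | rfl | hjk
      · exact (hq' j k i hjk hik hi).rotate.rotate
      · exact absurd h.rotate hself
      · exact absurd (hp' k j i hjk hij hi).rotate.rotate h.asymm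

end Drawing

namespace IsGluedPair

variable {V : Type*} {H : SimpleGraph V} {o o' : V} {c d : ZMod 8 → V} {z : V}

theorem adj_center (g : IsGluedPair H o c o' d) (h : H.Adj o z) : ∃ m, z = c m := by
  have hd := g.right_ne
  have hc := g.left.center_ne
  have ho := g.center_ne
  rcases g.edge_cases _ _ h with (⟨m, h⟩ | ⟨m, h⟩ | ⟨m, h⟩) | (⟨m, h⟩ | ⟨m, h⟩ | ⟨m, h⟩) | h <;>
    rcases Sym2.eq_iff.1 h with ⟨e1, e2⟩ | ⟨e1, e2⟩
  exacts [⟨m, e2⟩, absurd e1 (hc _), absurd e1 (hc _), absurd e1 (hc _), absurd e1 (hc _),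
    absurd e1 (hc _), absurd e1 ho, absurd e1 (hd _), absurd e1 (hd _), absurd e1 (hd _),
    absurd e1 (hd _), absurd e1 (hd _), absurd e1 (hc _), absurd e1 (hd _)]

/-- The neighbours of a vertex `c m`. -/
theorem adj_vertex (g : IsGluedPair H o c o' d) {m : ZMod 8} (h : H.Adj (c m) z) :
    (z = o ∨ z = c (m + 1) ∨ z = c (m + 2) ∨ z = c (m - 1) ∨ z = c (m - 2)) ∨
      (∃ k, c m = d k ∧ (z = o' ∨ z = d (k + 1) ∨ z = d (k + 2) ∨ z = d (k - 1) ∨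
        z = d (k - 2))) ∨ (m = 1 ∧ z = d 1) := by
  have key : ∀ {o : V} {c : ZMod 8 → V} {v : V}, (v ≠ o) → IsCopyEdge o c v z → ∃ k, v = c k ∧
      (z = o ∨ z = c (k + 1) ∨ z = c (k + 2) ∨ z = c (k - 1) ∨ z = c (k - 2)) := by
    intro o c v hv hk
    rcases hk with ⟨k, h⟩ | ⟨k, h⟩ | ⟨k, h⟩ <;>
    rcases Sym2.eq_iff.1 h with ⟨e1, e2⟩ | ⟨e1, e2⟩
    · exact absurd e1 hv
    · exact ⟨k, e1, Or.inl e2⟩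
    · exact ⟨k, e1, by tauto⟩
    · exact ⟨k + 1, e1, by rw [add_sub_cancel_right]; tauto⟩
    · exact ⟨k, e1, by tauto⟩
    · exact ⟨k + 2, e1, by rw [add_sub_cancel_right]; tauto⟩
  rcases g.edge_cases _ _ h with h | h | h
  · obtain ⟨k, e, h⟩ := key (g.left.center_ne m).symm h
    rw [g.left.injective e]
    exact Or.inl h
  · exact Or.inr (Or.inl (key (g.left_ne m).symm h))
  · rcases Sym2.eq_iff.1 h with ⟨e1, e2⟩ | ⟨e1, e2⟩
    · exact Or.inr (Or.inr ⟨g.left.injective e1, e2⟩)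
    · exact absurd (g.eq_of_eq _ _ e1).2 (by decide)

end IsGluedPair

namespace IsPairDrawing

variable {V : Type*} {H : SimpleGraph V} {p : V → ℂ} {o o' : V} {c d : ZMod 8 → V}

theorem not_crosses_odd_spoke (P : IsPairDrawing H p o c o' d) {m : ZMod 8} (a b : V) :
    ¬ Crosses H p a b (c (2 * m + 1)) o ∧ ¬ Crosses H p a b o (c (2 * m + 1)) :=
  ⟨fun h => P.not_odd_spoke_crosses h.symm.swap_left, fun h => P.not_odd_spoke_crosses h.symm⟩

/-! The following triangles are empty, and have an uncrossed side opposite to the vertex in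
question; they give all the sectors at the centre of a copy, and all but the outermost one at each
of its other vertices. -/

theorem sector_center (P : IsPairDrawing H p o c o' d) (m : ZMod 8) :
    IsSector H p o (c m) (c (m + 1)) :=
  P.rac.isSector (P.glued.left.spoke _) (P.glued.left.rim _) (P.glued.left.spoke _)
    (P.left.rim_empty m) (fun _ _ => P.not_crosses_rim rfl) (P.left.pos _ _ rfl)

/-- A vertex between two outer ones lies on the inner side of the edge between them. -/
theorem ear_pos (P : IsPairDrawing H p o c o' d) (m : ZMod 8) :
    0 < orient (p (c (2 * m))) (p (c (2 * m + 2))) (p (c (2 * m + 1))) :=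
  ((P.left.pos.inside_even P.glued.left P.rac P.left.outer m).pos
    (by rw [orient_rotate]; exact P.left.pos.quad P.glued.left P.rac rfl)).1

/-- An outer vertex lies beyond the edge between the two inner vertices next to it. -/
theorem ear_neg (P : IsPairDrawing H p o c o' d) (m : ZMod 8) :
    0 < orient (p (c (2 * m - 1))) (p (c (2 * m))) (p (c (2 * m + 1))) := by
  have h1 := P.rac.orient_mul_neg (P.left.outer m).symm
  have h2 : 0 < orient (p o) (p (c (2 * m - 1))) (p (c (2 * m + 1))) :=
    P.left.pos.quad P.glued.left P.rac (by ring)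
  rw [← orient_rotate] at h2
  rw [orient_swap]
  nlinarith

theorem sector_even_up (P : IsPairDrawing H p o c o' d) (m : ZMod 8) :
    IsSector H p (c (2 * m)) (c (2 * m + 2)) (c (2 * m + 1)) :=
  P.rac.isSector (P.glued.left.quad _) (P.glued.left.adj (Or.inr (Or.inr (Or.inl (by ring)))))
    (P.glued.left.rim _) (P.left.ear_empty (2 * m)).rotate.swap.rotate.rotate.rotate
    (fun _ _ h => P.not_crosses_rim (by ring) h.swap_right) (P.ear_pos m)

theorem sector_even_down (P : IsPairDrawing H p o c o' d) (m : ZMod 8) :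
    IsSector H p (c (2 * m)) (c (2 * m - 1)) (c (2 * m - 2)) := by
  have w := P.glued.left
  have h := P.ear_pos (m - 1)
  have e := P.left.ear_empty (2 * m - 2)
  rw [show 2 * (m - 1) = 2 * m - 2 by ring] at h
  rw [sub_add_cancel, show 2 * m - 2 + 1 = 2 * m - 1 by ring] at h e
  exact P.rac.isSector (w.adj (Or.inr (Or.inr (Or.inl (by ring)))))
    (w.adj (Or.inr (Or.inr (Or.inl (by ring))))) (w.adj (Or.inr (Or.inr (Or.inr (by ring)))))
    e.swap (fun _ _ h => P.not_crosses_rim (by ring) h.swap_right)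
    (by rwa [orient_rotate])

theorem sector_even_center (P : IsPairDrawing H p o c o' d) (m : ZMod 8) :
    IsSector H p (c (2 * m)) (c (2 * m + 1)) o := by
  have w := P.glued.left
  exact P.rac.isSector (w.rim _) (w.spoke _).symm (w.spoke _).symm
    (P.left.rim_empty (2 * m)).rotate (fun _ _ => (P.not_crosses_odd_spoke _ _).1)
    (by rw [orient_rotate]; exact P.left.pos _ _ rfl)

theorem sector_center_even (P : IsPairDrawing H p o c o' d) (m : ZMod 8) :
    IsSector H p (c (2 * m)) o (c (2 * m - 1)) := by
  have w := P.glued.left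
  have e := P.left.rim_empty (2 * m - 1)
  rw [sub_add_cancel] at e
  have hodd : 2 * m - 1 = 2 * (m - 1) + 1 := by ring
  refine P.rac.isSector (w.spoke _).symm (w.spoke _) (w.adj (Or.inr (Or.inr (Or.inl (by ring)))))
    e.rotate.rotate (fun _ _ => ?_) ?_
  · rw [hodd]; exact (P.not_crosses_odd_spoke _ _).2
  · rw [← orient_rotate]; exact P.left.pos _ _ (by ring)

theorem sector_odd_up (P : IsPairDrawing H p o c o' d) (m : ZMod 8) :
    IsSector H p (c (2 * m - 1)) (c (2 * m)) (c (2 * m + 1)) := by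
  have w := P.glued.left
  have e := P.left.ear_empty (2 * m - 1)
  rw [sub_add_cancel, show 2 * m - 1 + 2 = 2 * m + 1 by ring] at e
  exact P.rac.isSector (w.adj (Or.inl (by ring))) (w.rim _) (w.adj (Or.inr (Or.inl (by ring))))
    e.rotate (fun _ _ => P.not_crosses_rim rfl) (P.ear_neg m)

theorem sector_odd_down (P : IsPairDrawing H p o c o' d) (m : ZMod 8) :
    IsSector H p (c (2 * m + 1)) (c (2 * m - 1)) (c (2 * m)) := by
  have w := P.glued.left
  have e := P.left.ear_empty (2 * m - 1)
  rw [sub_add_cancel, show 2 * m - 1 + 2 = 2 * m + 1 by ring] at e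
  exact P.rac.isSector (w.adj (Or.inr (Or.inr (Or.inr (by ring))))) (w.adj (Or.inl (by ring)))
    (w.rim _).symm e (fun _ _ => P.not_crosses_rim (by ring))
    (by rw [← orient_rotate]; exact P.ear_neg m)

theorem sector_odd_center (P : IsPairDrawing H p o c o' d) (m : ZMod 8) :
    IsSector H p (c (2 * m - 1)) (c (2 * m + 1)) o := by
  have w := P.glued.left
  exact P.rac.isSector (w.adj (Or.inr (Or.inl (by ring)))) (w.spoke _).symm (w.spoke _).symm
    (P.left.inner_empty m).rotate (fun _ _ => (P.not_crosses_odd_spoke _ _).1)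
    (by rw [orient_rotate]; exact P.left.pos.quad w P.rac (by ring))

theorem sector_center_odd (P : IsPairDrawing H p o c o' d) (m : ZMod 8) :
    IsSector H p (c (2 * m + 1)) o (c (2 * m - 1)) := by
  have w := P.glued.left
  have hodd : 2 * m - 1 = 2 * (m - 1) + 1 := by ring
  refine P.rac.isSector (w.spoke _).symm (w.spoke _) (w.adj (Or.inr (Or.inr (Or.inr (by ring)))))
    (P.left.inner_empty m).rotate.rotate (fun _ _ => ?_) ?_
  · rw [hodd]; exact (P.not_crosses_odd_spoke _ _).2
  · rw [← orient_rotate]; exact P.left.pos.quad w P.rac (by ring)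

end IsPairDrawing

namespace IsGluedPair

variable {V : Type*} {H : SimpleGraph V} {o o' : V} {c d : ZMod 8 → V} {z : V}

theorem mem_of_adj_shared (g : IsGluedPair H o c o' d) (h0 : c 0 = d 2) (h2 : c 2 = d 0)
    (hz : H.Adj (c 0) z) : z ∈ [d 4, d 3, o', d 1, c 2, c 1, o, c 7] ++ [c 6] := by
  simp only [List.cons_append, List.nil_append, List.mem_cons]
  rcases g.adj_vertex hz with h | ⟨k, hk, h⟩ | h
  · simp only [zero_add, zero_sub, show (-1 : ZMod 8) = 7 by decide,
      show (-2 : ZMod 8) = 6 by decide] at h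
    tauto
  · rw [h0] at hk
    obtain rfl := g.right.injective hk
    simp only [show (2 : ZMod 8) + 2 = 4 by decide, show (2 : ZMod 8) + 1 = 3 by decide,
      show (2 : ZMod 8) - 1 = 1 by decide, sub_self, ← h2] at h
    tauto
  · exact absurd h.1 (by decide)

theorem mem_of_adj_even (g : IsGluedPair H o c o' d) {k : ZMod 8} (hm0 : 2 * k ≠ 0)
    (hm2 : 2 * k ≠ 2) (hz : H.Adj (c (2 * k)) z) :
    z ∈ [c (2 * k + 2), c (2 * k + 1), o, c (2 * k - 1)] ++ [c (2 * k - 2)] := by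
  rcases g.adj_vertex hz with h | ⟨l, hl, h⟩ | h
  · simp only [List.cons_append, List.nil_append, List.mem_cons]
    tauto
  · have := (g.eq_of_eq _ _ hl).1
    tauto
  · exact absurd h.1 ((by decide : ∀ k : ZMod 8, 2 * k ≠ 1) k)

end IsGluedPair

namespace IsPairDrawing

variable {V : Type*} {H : SimpleGraph V} {p : V → ℂ} {o o' : V} {c d : ZMod 8 → V} {u x y z : V}

theorem triplewise_center (P : IsPairDrawing H p o c o' d) :
    ([c 0, c 1, c 2, c 3, c 4, c 5, c 6] ++ [c 7]).Triplewise (CyclicAt p o) := by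
  have w := P.glued.left
  refine triplewise_of_isChain (H := H) ?_ ?_ ?_
  · simp [w.spoke]
  · change ([0, 1, 2, 3, 4, 5, 6, 7].map c).Nodup
    exact List.Nodup.map w.injective (by decide)
  · simp only [List.isChain_cons_cons, List.IsChain.singleton, and_true]
    exact ⟨P.sector_center 0, P.sector_center 1, P.sector_center 2, P.sector_center 3,
      P.sector_center 4, P.sector_center 5⟩

theorem triplewise_even (P : IsPairDrawing H p o c o' d) (m : ZMod 8) :
    ([c (2 * m + 2), c (2 * m + 1), o, c (2 * m - 1)] ++ [c (2 * m - 2)]).Triplewise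
      (CyclicAt p (c (2 * m))) := by
  have w := P.glued.left
  refine triplewise_of_isChain (H := H) ?_ ?_ ?_
  · simp only [List.cons_append, List.nil_append, List.mem_cons, List.not_mem_nil, or_false,
      forall_eq_or_imp, forall_eq]
    exact ⟨w.quad _, w.rim _, (w.spoke _).symm, w.adj (Or.inr (Or.inr (Or.inl (by ring)))),
      w.adj (Or.inr (Or.inr (Or.inr (by ring))))⟩
  · have h := w.center_ne
    have h' := fun m => (w.center_ne m).symm
    simp only [List.cons_append, List.nil_append, List.nodup_cons, List.mem_cons,
      List.not_mem_nil, or_false, not_or, w.injective.eq_iff, h, h', not_false_eq_true,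
      List.nodup_nil, and_true, true_and]
    revert m
    decide
  · simp only [List.isChain_cons_cons, List.IsChain.singleton, and_true]
    exact ⟨P.sector_even_up m, P.sector_even_center m, P.sector_center_even m⟩

theorem triplewise_odd (P : IsPairDrawing H p o c o' d) (m : ZMod 8) :
    ([c (2 * m + 2), c (2 * m + 3), o, c (2 * m - 1)] ++ [c (2 * m)]).Triplewise
      (CyclicAt p (c (2 * m + 1))) := by
  have w := P.glued.left
  refine triplewise_of_isChain (H := H) ?_ ?_ ?_
  · simp only [List.cons_append, List.nil_append, List.mem_cons, List.not_mem_nil, or_false,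
      forall_eq_or_imp, forall_eq]
    exact ⟨w.adj (Or.inl (by ring)), w.adj (Or.inr (Or.inl (by ring))), (w.spoke _).symm,
      w.adj (Or.inr (Or.inr (Or.inr (by ring)))), (w.rim _).symm⟩
  · have h := w.center_ne
    have h' := fun m => (w.center_ne m).symm
    simp only [List.cons_append, List.nil_append, List.nodup_cons, List.mem_cons,
      List.not_mem_nil, or_false, not_or, w.injective.eq_iff, h, h', not_false_eq_true,
      List.nodup_nil, and_true, true_and]
    revert m
    decide
  · simp only [List.isChain_cons_cons, List.IsChain.singleton, and_true]
    have h1 := P.sector_odd_up (m + 1)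
    have h2 := P.sector_odd_center (m + 1)
    rw [show 2 * (m + 1) - 1 = 2 * m + 1 by ring, show 2 * (m + 1) + 1 = 2 * m + 3 by ring] at h1 h2
    rw [show 2 * (m + 1) = 2 * m + 2 by ring] at h1
    exact ⟨h1, h2, P.sector_center_odd m⟩

theorem triplewise_link (P : IsPairDrawing H p o c o' d) :
    ([c 2, c 3, o, c 7, c 0] ++ [d 1]).Triplewise (CyclicAt p (c 1)) := by
  have w := P.glued.left
  have hd : ∀ m, c m ≠ d 1 := fun m e => absurd (P.glued.eq_of_eq _ _ e).2 (by decide)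
  refine triplewise_of_isChain (H := H) ?_ ?_ ?_
  · simp only [List.cons_append, List.nil_append, List.mem_cons, List.not_mem_nil, or_false,
      forall_eq_or_imp, forall_eq]
    exact ⟨w.adj (by decide), w.adj (by decide), (w.spoke _).symm, w.adj (by decide),
      w.adj (by decide), P.glued.link⟩
  · have h := w.center_ne
    have h' := fun m => (w.center_ne m).symm
    simp only [List.cons_append, List.nil_append, List.nodup_cons, List.mem_cons,
      List.not_mem_nil, or_false, not_or, w.injective.eq_iff, h, h', not_false_eq_true,
      List.nodup_nil, and_true, true_and , hd, P.glued.right_ne]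
    decide
  · simp only [List.isChain_cons_cons, List.IsChain.singleton, and_true]
    have h1 := P.sector_odd_up 1
    have h2 := P.sector_odd_center 1
    have h3 := P.sector_center_odd 0
    have h4 := P.sector_odd_down 0
    exact ⟨h1, h2, h3, h4⟩

/-- At a shared vertex the edges of the second copy precede those of the first one. -/
theorem triplewise_shared (P : IsPairDrawing H p o c o' d) :
    ([d 4, d 3, o', d 1, c 2, c 1, o, c 7] ++ [c 6]).Triplewise (CyclicAt p (c 0)) := by
  have w := P.glued.left
  have w' := P.glued.right
  have hcd : ∀ m n, ¬ ((m = 0 ∨ m = 2) ∧ (n = 0 ∨ n = 2)) → d n ≠ c m := fun m n h e =>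
    h (P.glued.eq_of_eq m n e.symm)
  refine triplewise_of_isChain (H := H) ?_ ?_ ?_
  · simp only [List.cons_append, List.nil_append, List.mem_cons, List.not_mem_nil, or_false,
      forall_eq_or_imp, forall_eq]
    refine ⟨?_, ?_, ?_, ?_, w.adj (by decide), w.adj (by decide), (w.spoke _).symm,
      w.adj (by decide), w.adj (by decide)⟩ <;> rw [P.zero_eq]
    exacts [w'.adj (by decide), w'.adj (by decide), (w'.spoke _).symm, w'.adj (by decide)]
  · have h := w.center_ne
    have h' := fun m => (w.center_ne m).symm
    have k := w'.center_ne
    have k' := fun m => (w'.center_ne m).symm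
    have l := P.glued.right_ne
    have l' := fun m => (P.glued.right_ne m).symm
    simp only [List.cons_append, List.nil_append, List.nodup_cons, List.mem_cons,
      List.not_mem_nil, or_false, not_or, w.injective.eq_iff, w'.injective.eq_iff, h, h', k, k',
      l', P.glued.left_ne, P.glued.center_ne.symm, not_false_eq_true,
      List.nodup_nil, and_true, true_and]
    refine ⟨⟨by decide, by decide, ?_, ?_, ?_, ?_⟩, ⟨by decide, ?_, ?_, ?_, ?_⟩,
      ⟨?_, ?_, ?_, ?_⟩, by decide, by decide, by decide⟩ <;> exact hcd _ _ (by decide)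
  · simp only [List.isChain_cons_cons, List.IsChain.singleton, and_true]
    have h1 := P.symm.sector_even_up 1
    have h2 := P.symm.sector_even_center 1
    have h3 := P.symm.sector_center_even 1
    have h4 := P.symm.sector_even_down 1
    have h5 := P.sector_even_up 0
    have h6 := P.sector_even_center 0
    have h7 := P.sector_center_even 0
    simp only [mul_one, mul_zero, zero_add, zero_sub, show (2 : ZMod 8) + 2 = 4 by decide,
      show (2 : ZMod 8) + 1 = 3 by decide, show (2 : ZMod 8) - 1 = 1 by decide, sub_self,
      show (-1 : ZMod 8) = 7 by decide, ← P.zero_eq, ← P.two_eq] at h1 h2 h3 h4 h5 h6 h7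
    exact ⟨h1, h2, h3, h4, h5, h6, h7⟩

/-- The edges at a vertex have a cyclic order which does not depend on the drawing. -/
theorem exists_rotation (g : IsGluedPair H o c o' d) (h0 : c 0 = d 2) (h2 : c 2 = d 0) (u : V) :
    ∃ L : List V, (∀ z, H.Adj u z → z ∈ L) ∧
      ∀ p, IsPairDrawing H p o c o' d → L.Triplewise (CyclicAt p u) := by
  have hcenter : ∀ {o o' : V} {c d : ZMod 8 → V}, IsGluedPair H o c o' d →
      ∃ L : List V, (∀ z, H.Adj o z → z ∈ L) ∧
      ∀ p, IsPairDrawing H p o c o' d → L.Triplewise (CyclicAt p o) := by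
    intro o o' c d g
    refine ⟨_, fun z hz => ?_, fun p P => P.triplewise_center⟩
    obtain ⟨m, rfl⟩ := g.adj_center hz
    rcases zmod_eight_cases m with rfl | rfl | rfl | rfl | rfl | rfl | rfl | rfl <;> simp
  have hvertex : ∀ {o o' : V} {c d : ZMod 8 → V}, IsGluedPair H o c o' d → c 0 = d 2 → c 2 = d 0 →
      ∀ m, m ≠ 2 → ∃ L : List V, (∀ z, H.Adj (c m) z → z ∈ L) ∧
        ∀ p, IsPairDrawing H p o c o' d → L.Triplewise (CyclicAt p (c m)) := by
    intro o o' c d g h0 h2 m hm2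
    rcases (by decide : ∀ m : ZMod 8, (∃ k, m = 2 * k) ∨ ∃ k, m = 2 * k + 1) m
      with ⟨k, rfl⟩ | ⟨k, rfl⟩
    · by_cases hm0 : 2 * k = 0
      · rw [hm0]
        refine ⟨_, fun z hz => ?_, fun p P => P.triplewise_shared⟩
        exact g.mem_of_adj_shared h0 h2 hz
      · exact ⟨_, fun z hz => g.mem_of_adj_even hm0 hm2 hz, fun p P => P.triplewise_even k⟩
    · have hl : ∀ l, c (2 * k + 1) ≠ d l := fun l e => absurd (g.eq_of_eq _ _ e).1
        ((by decide : ∀ k : ZMod 8, ¬ (2 * k + 1 = 0 ∨ 2 * k + 1 = 2)) k)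
      by_cases hm1 : 2 * k + 1 = 1
      · rw [hm1] at hl ⊢
        refine ⟨_, fun z hz => ?_, fun p P => P.triplewise_link⟩
        rcases g.adj_vertex hz with h | ⟨l, hl', h⟩ | h
        · simp only [show (1 : ZMod 8) + 1 = 2 by decide, show (1 : ZMod 8) + 2 = 3 by decide,
            show (1 : ZMod 8) - 2 = 7 by decide, sub_self] at h
          simp only [List.cons_append, List.nil_append, List.mem_cons]
          tauto
        · exact absurd hl' (hl l)
        · simp [h.2]
      · refine ⟨_, fun z hz => ?_, fun p P => P.triplewise_odd k⟩
        rcases g.adj_vertex hz with h | ⟨l, hl', h⟩ | h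
        · simp only [add_sub_cancel_right, show 2 * k + 1 + 1 = 2 * k + 2 by ring,
            show 2 * k + 1 + 2 = 2 * k + 3 by ring, show 2 * k + 1 - 2 = 2 * k - 1 by ring] at h
          simp only [List.cons_append, List.nil_append, List.mem_cons]
          tauto
        · exact absurd hl' (hl l)
        · exact absurd h.1 hm1
  have hswap : ∀ {v : V}, (∃ L : List V, (∀ z, H.Adj v z → z ∈ L) ∧
      ∀ p, IsPairDrawing H p o' d o c → L.Triplewise (CyclicAt p v)) →
      ∃ L : List V, (∀ z, H.Adj v z → z ∈ L) ∧
      ∀ p, IsPairDrawing H p o c o' d → L.Triplewise (CyclicAt p v) := by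
    rintro v ⟨L, h1, h2⟩
    exact ⟨L, h1, fun p P => h2 p P.symm⟩
  rcases g.cover u with rfl | rfl | ⟨m, rfl⟩ | ⟨n, rfl⟩
  · exact hcenter g
  · exact hswap (hcenter g.symm)
  · by_cases hm : m = 2
    · rw [hm, h2]
      exact hswap (hvertex g.symm h2.symm h0.symm 0 (by decide))
    · exact hvertex g h0 h2 m hm
  · by_cases hn : n = 2
    · rw [hn, ← h0]
      exact hvertex g h0 h2 0 (by decide)
    · exact hswap (hvertex g.symm h2.symm h0.symm n hn)

/-- Two drawings of this shape have the same rotation at every vertex. -/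
theorem rotation_congr {q : V → ℂ} (P : IsPairDrawing H p o c o' d)
    (Q : IsPairDrawing H q o c o' d) (hx : H.Adj u x) (hy : H.Adj u y) (hz : H.Adj u z)
    (h : CyclicAt p u x y z) : CyclicAt q u x y z := by
  obtain ⟨L, hL, hT⟩ := exists_rotation P.glued P.zero_eq P.two_eq u
  exact cyclicAt_congr (hT p P) (hT q Q) (hL x hx) (hL y hy) (hL z hz) h

end IsPairDrawing

/-! ### The outer face along the edges -/

section Drawing

variable {V : Type*} {H : SimpleGraph V} {p : V → ℂ} {u v y a b : V} {z w : ℂ}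

/-- The outer face contains every connected set in the complement of the drawing that it meets. -/
theorem mem_outerFace_of_isPreconnected {S : Set ℂ} (hS : IsPreconnected S)
    (hSc : S ⊆ (carrier H p)ᶜ) (hz : z ∈ S) (hw : w ∈ S) (h : z ∈ outerFace H p) :
    w ∈ outerFace H p := by
  refine ⟨hSc hw, ?_⟩
  rw [← connectedComponentIn_eq (hS.subset_connectedComponentIn hz hSc hw)]
  exact h.2

theorem isClosed_segment (a b : ℂ) : IsClosed (segment ℝ a b) := by
  rw [segment_eq_image_lineMap]
  exact (isCompact_Icc.image AffineMap.lineMap_continuous).isClosed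

theorem isClosed_edges [Finite V] (p : V → ℂ) (R : V → V → Prop) :
    IsClosed {z | ∃ u v, R u v ∧ z ∈ segment ℝ (p u) (p v)} := by
  have : {z | ∃ u v, R u v ∧ z ∈ segment ℝ (p u) (p v)} =
      ⋃ e : {e : V × V // R e.1 e.2}, segment ℝ (p e.1.1) (p e.1.2) := by
    ext z
    simp only [Set.mem_ofPred_eq, Set.mem_iUnion, Subtype.exists, Prod.exists, exists_prop]
  rw [this]
  exact isClosed_iUnion_of_finite fun e => isClosed_segment _ _

/-- The point at height `ε` to the left of the point with parameter `t` of the edge from `u` to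
`v`. -/
noncomputable def leftPoint (p : V → ℂ) (u v : V) (t ε : ℝ) : ℂ :=
  pointOn p u v t + (ε : ℂ) * (Complex.I * (p v - p u))

theorem leftPoint_re (p : V → ℂ) (u v : V) (t ε : ℝ) : (leftPoint p u v t ε).re =
    (p u).re + t * ((p v).re - (p u).re) - ε * ((p v).im - (p u).im) := by
  simp [leftPoint, pointOn_re]; ring

theorem leftPoint_im (p : V → ℂ) (u v : V) (t ε : ℝ) : (leftPoint p u v t ε).im =
    (p u).im + t * ((p v).im - (p u).im) + ε * ((p v).re - (p u).re) := by
  simp [leftPoint, pointOn_im]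

theorem continuous_leftPoint (p : V → ℂ) (u v : V) :
    Continuous fun x : ℝ × ℝ => leftPoint p u v x.1 x.2 := by
  have : Continuous (pointOn p u v) := AffineMap.lineMap_continuous
  unfold leftPoint
  fun_prop

/-- The outer face lies to the left of the uncrossed edge from `u` to `v`. -/
def LeftOuter (H : SimpleGraph V) (p : V → ℂ) (u v : V) : Prop :=
  ∀ t, 0 < t → t < 1 → ∀ᶠ ε : ℝ in 𝓝[>] 0, leftPoint p u v t ε ∈ outerFace H p

theorem normSq_pos (hp : IsRACDrawing H p) (h : H.Adj u v) :
    0 < ((p v).re - (p u).re) ^ 2 + ((p v).im - (p u).im) ^ 2 := by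
  by_contra h0
  exact h.ne (hp.injective (Complex.ext
    (by nlinarith [sq_nonneg ((p v).re - (p u).re), sq_nonneg ((p v).im - (p u).im)])
    (by nlinarith [sq_nonneg ((p v).re - (p u).re), sq_nonneg ((p v).im - (p u).im)])))

/-- On the left of a compact part of an uncrossed edge there is a strip that avoids the drawing, so
that it lies in the outer face as soon as one of its points does. -/
theorem IsRACDrawing.exists_strip [Finite V] (hp : IsRACDrawing H p) (huv : H.Adj u v)
    (hX : ∀ x y, ¬ Crosses H p u v x y) {t₁ t₂ : ℝ} (h1 : 0 < t₁) (h2 : t₂ < 1) :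
    ∃ δ > 0, ∀ r ∈ Set.Icc t₁ t₂, ∀ r' ∈ Set.Icc t₁ t₂, ∀ ε ∈ Set.Ioo 0 δ, ∀ ε' ∈ Set.Ioo 0 δ,
      leftPoint p u v r ε ∈ outerFace H p → leftPoint p u v r' ε' ∈ outerFace H p := by
  have hcont : Continuous (pointOn p u v) := AffineMap.lineMap_continuous
  set F := {z | ∃ x y, (H.Adj x y ∧ s(u, v) ≠ s(x, y)) ∧ z ∈ segment ℝ (p x) (p y)} with hF
  obtain ⟨δ, hδ, hsub⟩ := (isCompact_Icc.image hcont).exists_thickening_subset_open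
    (s := pointOn p u v '' Set.Icc t₁ t₂) (isClosed_edges p _ : IsClosed F).isOpen_compl (by
      rintro _ ⟨r, hr, rfl⟩ ⟨x, y, ⟨hxy, hne⟩, hz⟩
      exact hp.pointOn_notMem huv hxy hne (hX x y) (h1.trans_le hr.1) (hr.2.trans_lt h2) hz)
  have hN := normSq_pos hp huv
  have hne : 0 < ‖p v - p u‖ := norm_pos_iff.2 (sub_ne_zero.2 fun e => huv.ne (hp.injective e).symm)
  refine ⟨δ / ‖p v - p u‖, div_pos hδ hne, fun r hr r' hr' ε hε ε' hε' h => ?_⟩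
  refine mem_outerFace_of_isPreconnected
    (S := (fun x : ℝ × ℝ => leftPoint p u v x.1 x.2) ''
      (Set.Icc t₁ t₂ ×ˢ Set.Ioo 0 (δ / ‖p v - p u‖)))
    ((isPreconnected_Icc.prod isPreconnected_Ioo).image _ (continuous_leftPoint p u v).continuousOn)
    ?_ ⟨(r, ε), ⟨hr, hε⟩, rfl⟩ ⟨(r', ε'), ⟨hr', hε'⟩, rfl⟩ h
  rintro _ ⟨⟨r, ε⟩, ⟨hr, hε⟩, rfl⟩ ⟨x, y, hxy, hz⟩
  simp only at hr hε hz
  by_cases he : s(u, v) = s(x, y)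
  · -- the strip does not meet the line through the edge itself
    have hz' : leftPoint p u v r ε ∈ segment ℝ (p u) (p v) := by
      rcases Sym2.eq_iff.1 he with ⟨rfl, rfl⟩ | ⟨rfl, rfl⟩
      exacts [hz, by rwa [segment_symm]]
    obtain ⟨t, -, -, e1, e2⟩ := mem_segment_iff.1 hz'
    rw [leftPoint_re] at e1
    rw [leftPoint_im] at e2
    have : ε * (((p v).re - (p u).re) ^ 2 + ((p v).im - (p u).im) ^ 2) = 0 := by
      linear_combination ((p v).re - (p u).re) * e2 - ((p v).im - (p u).im) * e1
    exact (mul_pos hε.1 hN).ne' this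
  · refine hsub (Metric.mem_thickening_iff.2 ⟨_, ⟨r, hr, rfl⟩, ?_⟩) ⟨x, y, ⟨hxy, he⟩, hz⟩
    rw [dist_eq_norm, leftPoint, add_sub_cancel_left, norm_mul, norm_mul, Complex.norm_I, one_mul,
      Complex.norm_real, Real.norm_of_nonneg hε.1.le]
    exact (lt_div_iff₀ hne).1 hε.2

/-- The outer face lies to the left of an uncrossed edge if it contains points that approach the
edge from the left. -/
theorem IsRACDrawing.leftOuter_of [Finite V] (hp : IsRACDrawing H p) (huv : H.Adj u v)
    (hX : ∀ x y, ¬ Crosses H p u v x y) {t₁ t₂ : ℝ} (h1 : 0 < t₁) (h2 : t₂ < 1)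
    (h : ∀ δ > 0, ∃ r ∈ Set.Icc t₁ t₂, ∃ ε ∈ Set.Ioo 0 δ,
      leftPoint p u v r ε ∈ outerFace H p) : LeftOuter H p u v := by
  intro t ht0 ht1
  obtain ⟨δ, hδ, hstrip⟩ := hp.exists_strip huv hX (t₁ := min t₁ t) (t₂ := max t₂ t)
    (lt_min h1 ht0) (max_lt h2 ht1)
  obtain ⟨r, hr, ε, hε, hout⟩ := h δ hδ
  filter_upwards [Ioo_mem_nhdsGT hδ] with ε' hε'
  exact hstrip r ⟨(min_le_left _ _).trans hr.1, hr.2.trans (le_max_left _ _)⟩ t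
    ⟨min_le_right _ _, le_max_right _ _⟩ ε hε ε' hε' hout

/-- If the points `z + σ w` for a point `z` of an uncrossed edge, and for a vector `w` that points
to the left of the edge, lie in the outer face, then the outer face lies to the left of the edge. -/
theorem IsRACDrawing.leftOuter_of_ray [Finite V] (hp : IsRACDrawing H p) (huv : H.Adj u v)
    (hX : ∀ x y, ¬ Crosses H p u v x y) {t : ℝ} (h0 : 0 < t) (h1 : t < 1)
    (hw : 0 < det (p v - p u) w)
    (h : ∀ σ : ℝ, 0 < σ → pointOn p u v t + σ * w ∈ outerFace H p) : LeftOuter H p u v := by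
  have hN := normSq_pos hp huv
  set N := ((p v).re - (p u).re) ^ 2 + ((p v).im - (p u).im) ^ 2 with hNdef
  obtain ⟨α, hα⟩ : ∃ α : ℝ, α * N = inner ℝ (p v - p u) w := ⟨_, div_mul_cancel₀ _ hN.ne'⟩
  obtain ⟨β, hβ⟩ : ∃ β : ℝ, β * N = det (p v - p u) w := ⟨_, div_mul_cancel₀ _ hN.ne'⟩
  have hβ0 : 0 < β := pos_of_mul_pos_left (by rw [hβ]; exact hw) hN.le
  have hdec : ∀ σ : ℝ, pointOn p u v t + σ * w = leftPoint p u v (t + σ * α) (σ * β) := by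
    intro σ
    rw [inner_eq] at hα
    simp only [det, Complex.sub_re, Complex.sub_im] at hα hβ
    apply Complex.ext
    · rw [leftPoint_re, Complex.add_re, pointOn_re, Complex.re_ofReal_mul]
      apply mul_left_cancel₀ hN.ne'
      linear_combination (-σ * ((p v).re - (p u).re)) * hα + (σ * ((p v).im - (p u).im)) * hβ
    · rw [leftPoint_im, Complex.add_im, pointOn_im, Complex.im_ofReal_mul]
      apply mul_left_cancel₀ hN.ne'
      linear_combination (-σ * ((p v).im - (p u).im)) * hα - (σ * ((p v).re - (p u).re)) * hβ
  refine hp.leftOuter_of huv hX (t₁ := t / 2) (t₂ := (1 + t) / 2) (by linarith) (by linarith)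
    fun δ hδ => ?_
  have hev : ∀ᶠ σ : ℝ in 𝓝[>] 0, t + σ * α ∈ Set.Ioo (t / 2) ((1 + t) / 2) ∧ σ * β < δ ∧ 0 < σ := by
    have c1 : Filter.Tendsto (fun σ : ℝ => t + σ * α) (𝓝 0) (𝓝 (t + 0 * α)) :=
      (by fun_prop : Continuous fun σ : ℝ => t + σ * α).tendsto 0
    have c2 : Filter.Tendsto (fun σ : ℝ => σ * β) (𝓝 0) (𝓝 (0 * β)) :=
      (by fun_prop : Continuous fun σ : ℝ => σ * β).tendsto 0
    rw [zero_mul] at c1 c2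
    rw [add_zero] at c1
    have e1 := c1 (Ioo_mem_nhds (show t / 2 < t by linarith) (show t < (1 + t) / 2 by linarith))
    have e2 := c2 (Iio_mem_nhds hδ)
    filter_upwards [nhdsWithin_le_nhds e1, nhdsWithin_le_nhds e2, 
      self_mem_nhdsWithin] with σ k1 k2 k3
    exact ⟨k1, k2, k3⟩
  obtain ⟨σ, hσ1, hσ2, hσ3⟩ := hev.exists
  refine ⟨t + σ * α, ⟨hσ1.1.le, hσ1.2.le⟩, σ * β, ⟨mul_pos hσ3 hβ0, hσ2⟩, ?_⟩
  rw [← hdec]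
  exact h σ hσ3

theorem CyclicOrder.smul_mid {a b c : ℂ} {k : ℝ} (hk : 0 < k) (h : CyclicOrder a (k * b) c) :
    CyclicOrder a b c := by
  have e1 : det a (k * b) = k * det a b := by simp [det]; ring
  have e2 : det (k * b) c = k * det b c := by simp [det]; ring
  unfold CyclicOrder at *
  rw [e1, e2] at h
  simpa only [mul_pos_iff_of_pos_left hk] using h

theorem not_cyclicOrder_self (a b : ℂ) : ¬ CyclicOrder a a b := by
  intro h
  have e1 : det a a = 0 := by simp only [det]; ring
  have e2 := det_swap a b
  unfold CyclicOrder at h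
  rcases h with h | h | h <;> linarith [h.1, h.2]

/-- Directions with increasing angles, within one turn, are in counterclockwise cyclic order. -/
theorem cyclicOrder_of_angles {α θ β r s : ℝ} (hr : 0 < r) (hs : 0 < s) (h1 : α < θ) (h2 : θ < β)
    (h3 : β < α + 2 * Real.pi) : CyclicOrder (r * Complex.exp (α * Complex.I))
      (Complex.exp (θ * Complex.I)) (s * Complex.exp (β * Complex.I)) := by
  have key : ∀ r s x y : ℝ, det (r * Complex.exp (x * Complex.I)) (s * Complex.exp (y * Complex.I))
      = r * s * Real.sin (y - x) := by
    intro r s x y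
    simp only [det, Complex.re_ofReal_mul, Complex.im_ofReal_mul, Complex.exp_ofReal_mul_I_re,
      Complex.exp_ofReal_mul_I_im, Real.sin_sub]
    ring
  have k1 := key r 1 α θ
  have k2 := key 1 s θ β
  have k3 := key s r β α
  rw [Complex.ofReal_one, one_mul] at k1 k2
  rw [show α - β = (α + 2 * Real.pi - β) - 2 * Real.pi by ring, Real.sin_sub_two_pi] at k3
  have hs1 : ∀ x : ℝ, 0 < x → x < Real.pi → 0 < Real.sin x := fun x => Real.sin_pos_of_pos_of_lt_pi
  unfold CyclicOrder
  rw [k1, k2, k3]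
  simp only [mul_one, one_mul, mul_pos_iff_of_pos_left hr, mul_pos_iff_of_pos_left hs,
    mul_pos_iff_of_pos_left (mul_pos hs hr)]
  by_cases c1 : θ - α < Real.pi
  · by_cases c2 : β - θ < Real.pi
    · exact Or.inl ⟨hs1 _ (by linarith) c1, hs1 _ (by linarith) c2⟩
    · exact Or.inr (Or.inr ⟨hs1 _ (by linarith) (by linarith), hs1 _ (by linarith) c1⟩)
  · exact Or.inr (Or.inl ⟨hs1 _ (by linarith) (by linarith), hs1 _ (by linarith) (by linarith)⟩)

end Drawing

/-! ### Passing around a corner -/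

section Drawing

variable {V : Type*} {H : SimpleGraph V} {p : V → ℂ} {u v y a b : V} {z w : ℂ}

/-- The open circular sector with apex `y` and radius `ρ` between the angles `α` and `β`. -/
def angularSector (y : ℂ) (ρ α β : ℝ) : Set ℂ :=
  (fun x : ℝ × ℝ => y + x.1 * Complex.exp (x.2 * Complex.I)) '' (Set.Ioo 0 ρ ×ˢ Set.Ioo α β)

theorem isPreconnected_angularSector (y : ℂ) (ρ α β : ℝ) :
    IsPreconnected (angularSector y ρ α β) :=
  (isPreconnected_Ioo.prod isPreconnected_Ioo).image _ (by fun_prop)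

/-- Two distinct directions, one after the other within one turn. -/
theorem exists_angles {A B : ℂ} (h : A.arg ≠ B.arg) : ∃ α β : ℝ, α < β ∧ β < α + 2 * Real.pi ∧
    A = ‖A‖ * Complex.exp (α * Complex.I) ∧ B = ‖B‖ * Complex.exp (β * Complex.I) := by
  have hA := (Complex.norm_mul_exp_arg_mul_I A).symm
  have hB := (Complex.norm_mul_exp_arg_mul_I B).symm
  have h1 := Complex.arg_le_pi A
  have h2 := Complex.arg_le_pi B
  have h3 := Complex.neg_pi_lt_arg A
  have h4 := Complex.neg_pi_lt_arg B
  rcases h.lt_or_gt with hlt | hlt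
  · exact ⟨A.arg, B.arg, hlt, by linarith, hA, hB⟩
  · refine ⟨A.arg, B.arg + 2 * Real.pi, by linarith, by linarith, hA, ?_⟩
    rw [Complex.ofReal_add, add_mul, Complex.exp_add]
    simp

/-- The points near an edge at `y`, on its left, lie in the circular sector that begins there. -/
theorem eventually_mem_sector {A : ℂ} {y : ℂ} {ρ α β t : ℝ} (hA : 0 < ‖A‖) (hαβ : α < β)
    (hAα : A = ‖A‖ * Complex.exp (α * Complex.I)) (ht : 0 < t) (hρ : t * ‖A‖ < ρ) :
    ∀ᶠ ε : ℝ in 𝓝[>] 0, y + A * (t + ε * Complex.I) ∈ angularSector y ρ α β := by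
  have hg : Filter.Tendsto (fun ε : ℝ => (t : ℂ) + ε * Complex.I) (𝓝 0) (𝓝 (t : ℂ)) := by
    have : Continuous fun ε : ℝ => (t : ℂ) + ε * Complex.I := by fun_prop
    simpa using this.tendsto 0
  have harg : Filter.Tendsto (fun ε : ℝ => Complex.arg ((t : ℂ) + ε * Complex.I)) (𝓝 0) (𝓝 0) := by
    have := (Complex.continuousAt_arg (x := (t : ℂ))
      (by simp [Complex.mem_slitPlane_iff, ht])).tendsto
    rw [Complex.arg_ofReal_of_nonneg ht.le] at this
    exact this.comp hg
  have hnorm := (hg.norm).const_mul ‖A‖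
  rw [Complex.norm_real, Real.norm_of_nonneg ht.le, mul_comm ‖A‖ t] at hnorm
  filter_upwards [nhdsWithin_le_nhds (harg (Iio_mem_nhds (sub_pos.2 hαβ))),
    nhdsWithin_le_nhds (hnorm (Iio_mem_nhds hρ)), self_mem_nhdsWithin] with ε h1 h2 h3
  have h3 : 0 < ε := h3
  have h1 : Complex.arg ((t : ℂ) + ε * Complex.I) < β - α := h1
  have hpos : 0 < Complex.arg ((t : ℂ) + ε * Complex.I) := by
    refine lt_of_le_of_ne (Complex.arg_nonneg_iff.2 (by simpa using h3.le)) fun e => ?_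
    have := (Complex.arg_eq_zero_iff.1 e.symm).2
    simp at this
    exact h3.ne' this
  have hne : (t : ℂ) + ε * Complex.I ≠ 0 := by
    intro e
    have := congrArg Complex.re e
    simp at this
    exact ht.ne' this
  refine ⟨(‖A‖ * ‖(t : ℂ) + ε * Complex.I‖, α + Complex.arg ((t : ℂ) + ε * Complex.I)),
    ⟨⟨mul_pos hA (norm_pos_iff.2 hne), h2⟩, by simpa using hpos, show _ < _ by linarith⟩, ?_⟩
  have e := Complex.norm_mul_exp_arg_mul_I ((t : ℂ) + ε * Complex.I)
  simp only [Complex.ofReal_add, Complex.ofReal_mul, add_mul, Complex.exp_add]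
  conv_rhs => rw [← e, hAα]
  ring

/-- The points near an edge at `y`, on its right, lie in the circular sector that ends there. -/
theorem eventually_mem_sector_right {B : ℂ} {y : ℂ} {ρ α β t : ℝ} (hB : 0 < ‖B‖) (hαβ : α < β)
    (hBβ : B = ‖B‖ * Complex.exp (β * Complex.I)) (ht : 0 < t) (hρ : t * ‖B‖ < ρ) :
    ∀ᶠ ε : ℝ in 𝓝[>] 0, y + B * (t - ε * Complex.I) ∈ angularSector y ρ α β := by
  have hconj : (starRingEnd ℂ) B = ‖(starRingEnd ℂ) B‖ * Complex.exp ((-β : ℝ) * Complex.I) := by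
    conv_lhs => rw [hBβ]
    rw [map_mul, Complex.conj_ofReal, ← Complex.exp_conj, Complex.norm_conj]
    simp
  filter_upwards [eventually_mem_sector (y := (starRingEnd ℂ) y) (A := (starRingEnd ℂ) B)
    (by rwa [Complex.norm_conj]) (neg_lt_neg hαβ) hconj ht (by rwa [Complex.norm_conj])]
  rintro ε ⟨⟨r, θ⟩, ⟨hr, hθ⟩, h⟩
  refine ⟨(r, -θ), ⟨hr, by linarith [hθ.2], by linarith [hθ.1]⟩, ?_⟩
  have := congrArg (starRingEnd ℂ) h
  simp only [map_add, map_mul, Complex.conj_conj, Complex.conj_ofReal, Complex.conj_I,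
    ← Complex.exp_conj] at this
  simp only [Complex.ofReal_neg]
  rw [show (-(θ : ℂ)) * Complex.I = θ * -Complex.I by ring, this]
  ring

/-- Around a corner of the drawing, the outer face passes from one edge to the next. -/
theorem IsRACDrawing.leftOuter_iff [Finite V] (hp : IsRACDrawing H p) (hya : H.Adj y a)
    (hyb : H.Adj y b) (hab : a ≠ b) (hXa : ∀ u v, ¬ Crosses H p y a u v)
    (hXb : ∀ u v, ¬ Crosses H p b y u v) (hS : IsSector H p y a b) :
    LeftOuter H p y a ↔ LeftOuter H p b y := by
  have hA0 : 0 < ‖p a - p y‖ :=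
    norm_pos_iff.2 (sub_ne_zero.2 fun e => hya.ne (hp.injective e).symm)
  have hB0 : 0 < ‖p b - p y‖ :=
    norm_pos_iff.2 (sub_ne_zero.2 fun e => hyb.ne (hp.injective e).symm)
  have hargs : (p a - p y).arg ≠ (p b - p y).arg := by
    intro e
    have hpar : p b - p y = ((‖p b - p y‖ / ‖p a - p y‖ : ℝ) : ℂ) * (p a - p y) := by
      have e1 := Complex.norm_mul_exp_arg_mul_I (p a - p y)
      have e2 := Complex.norm_mul_exp_arg_mul_I (p b - p y)
      rw [← e] at e2
      have h0 : (‖p a - p y‖ : ℂ) ≠ 0 := by exact_mod_cast hA0.ne'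
      rw [Complex.ofReal_div, div_mul_eq_mul_div, eq_div_iff h0]
      linear_combination (‖p b - p y‖ : ℂ) * e1 - (‖p a - p y‖ : ℂ) * e2
    refine hp.not_same_direction hya hyb hab (k := ‖p b - p y‖ / ‖p a - p y‖) (by positivity) ?_ ?_
    · simpa only [Complex.sub_re, Complex.re_ofReal_mul] using congrArg Complex.re hpar
    · simpa only [Complex.sub_im, Complex.im_ofReal_mul] using congrArg Complex.im hpar
  obtain ⟨α, β, hαβ, hβα, hα, hβ⟩ := exists_angles hargs
  -- a disc around `y` which meets only the edges at `y`
  obtain ⟨ρ, hρ, hball⟩ := Metric.isOpen_iff.1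
    (isClosed_edges p fun u v => H.Adj u v ∧ u ≠ y ∧ v ≠ y).isOpen_compl (p y) (by
      rintro ⟨u, v, ⟨huv, h1, h2⟩, hz⟩
      rcases hp.vertex_edge _ _ _ huv hz with h | h
      exacts [h1 h.symm, h2 h.symm])
  -- no edge at `y` has a direction between those of `ya` and `yb`
  have hray : ∀ x, H.Adj y x → ∀ r θ : ℝ, 0 < r → α < θ → θ < β →
      p y + r * Complex.exp (θ * Complex.I) ∉ segment ℝ (p y) (p x) := by
    intro x hx r θ hr h1 h2 hz
    obtain ⟨t, ht0, -, e⟩ := mem_segment_iff_pointOn.1 hz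
    have e' : r * Complex.exp (θ * Complex.I) = t * (p x - p y) := by
      rw [pointOn, AffineMap.lineMap_apply, vsub_eq_sub, vadd_eq_add, Complex.real_smul,
        add_comm (p y)] at e
      exact add_right_cancel e
    have hr' : (r : ℂ) ≠ 0 := by exact_mod_cast hr.ne'
    have htpos : 0 < t := by
      refine lt_of_le_of_ne ht0 fun e0 => ?_
      rw [← e0, Complex.ofReal_zero, zero_mul] at e'
      exact mul_ne_zero hr' (Complex.exp_ne_zero _) e'
    have hco := cyclicOrder_of_angles hA0 hB0 h1 h2 hβα
    rw [← hα, ← hβ, show Complex.exp (θ * Complex.I) = ((t / r : ℝ) : ℂ) * (p x - p y) by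
      rw [Complex.ofReal_div, div_mul_eq_mul_div, ← e', mul_div_cancel_left₀ _ hr']] at hco
    have hco := hco.smul_mid (div_pos htpos hr)
    rcases eq_or_ne x a with rfl | hxa
    · exact not_cyclicOrder_self _ _ hco
    rcases eq_or_ne x b with rfl | hxb
    · exact not_cyclicOrder_self _ _ hco.rotate
    exact (hS x hx hxa hxb).asymm hco
  have hsub : angularSector (p y) ρ α β ⊆ (carrier H p)ᶜ := by
    rintro _ ⟨⟨r, θ⟩, ⟨hr, hθ⟩, rfl⟩ ⟨u, v, huv, hz⟩
    by_cases hu : u = y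
    · subst hu
      exact hray v huv r θ hr.1 hθ.1 hθ.2 hz
    by_cases hv : v = y
    · subst hv
      rw [segment_symm] at hz
      exact hray u huv.symm r θ hr.1 hθ.1 hθ.2 hz
    refine hball ?_ ⟨u, v, ⟨huv, hu, hv⟩, hz⟩
    rw [Metric.mem_ball, dist_eq_norm, add_sub_cancel_left, norm_mul, Complex.norm_exp_ofReal_mul_I,
      mul_one, Complex.norm_real, Real.norm_of_nonneg hr.1.le]
    exact hr.2
  have hout : ∀ z ∈ angularSector (p y) ρ α β, ∀ w ∈ angularSector (p y) ρ α β,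
      z ∈ outerFace H p → w ∈ outerFace H p := fun z hz w hw h =>
    mem_outerFace_of_isPreconnected (isPreconnected_angularSector _ _ _ _) hsub hz hw h
  obtain ⟨t, ht0, ht1, htA, htB⟩ : ∃ t : ℝ, 0 < t ∧ t < 1 ∧ t * ‖p a - p y‖ < ρ ∧
      t * ‖p b - p y‖ < ρ := by
    have hev : ∀ᶠ t : ℝ in 𝓝[>] 0, t < 1 ∧ t < ρ / ‖p a - p y‖ ∧ t < ρ / ‖p b - p y‖ := by
      filter_upwards [Ioo_mem_nhdsGT one_pos, Ioo_mem_nhdsGT (div_pos hρ hA0),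
        Ioo_mem_nhdsGT (div_pos hρ hB0)] with t h1 h2 h3 using ⟨h1.2, h2.2, h3.2⟩
    obtain ⟨t, ⟨h1, h2, h3⟩, h0⟩ := (hev.and self_mem_nhdsWithin).exists
    exact ⟨t, h0, h1, (lt_div_iff₀ hA0).1 h2, (lt_div_iff₀ hB0).1 h3⟩
  have hLa : ∀ᶠ ε : ℝ in 𝓝[>] 0, leftPoint p y a t ε ∈ angularSector (p y) ρ α β := by
    filter_upwards [eventually_mem_sector (y := p y) hA0 hαβ hα ht0 htA] with ε h
    convert h using 1
    rw [leftPoint, pointOn, AffineMap.lineMap_apply, vsub_eq_sub, vadd_eq_add, Complex.real_smul]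
    ring
  have hLb : ∀ᶠ ε : ℝ in 𝓝[>] 0, leftPoint p b y (1 - t) ε ∈ angularSector (p y) ρ α β := by
    filter_upwards [eventually_mem_sector_right (y := p y) hB0 hαβ hβ ht0 htB] with ε h
    convert h using 1
    rw [leftPoint, pointOn_swap, pointOn, AffineMap.lineMap_apply, vsub_eq_sub, vadd_eq_add,
      Complex.real_smul]
    ring
  constructor
  · intro h
    obtain ⟨ε₀, h1, h2⟩ := (hLa.and (h t ht0 ht1)).exists
    refine hp.leftOuter_of hyb.symm hXb (t₁ := 1 - t) (t₂ := 1 - t) (by linarith) (by linarith)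
      fun δ hδ => ?_
    obtain ⟨ε, h3, h4⟩ := (hLb.and (Ioo_mem_nhdsGT hδ)).exists
    exact ⟨1 - t, ⟨le_rfl, le_rfl⟩, ε, h4, hout _ h1 _ h3 h2⟩
  · intro h
    obtain ⟨ε₀, h1, h2⟩ := (hLb.and (h (1 - t) (by linarith) (by linarith))).exists
    refine hp.leftOuter_of hya hXa (t₁ := t) (t₂ := t) (by linarith) (by linarith)
      fun δ hδ => ?_
    obtain ⟨ε, h3, h4⟩ := (hLa.and (Ioo_mem_nhdsGT hδ)).exists
    exact ⟨t, ⟨le_rfl, le_rfl⟩, ε, h4, hout _ h1 _ h3 h2⟩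

end Drawing

/-! ### The sides that the outer face touches -/

/-- On the positive side of a side of a star-shaped quadrilateral lies its interior. -/
theorem StarQuad.eventually_mem_inside {o : ℂ} {C : ZMod 4 → ℂ}
    (hC : ∀ k, 0 < orient o (C k) (C (k + 1))) {k : ZMod 4} {r : ℝ} {z w : ℂ} (h0 : 0 < r)
    (h1 : r < 1) (hre : z.re = (C k).re + r * ((C (k + 1)).re - (C k).re))
    (him : z.im = (C k).im + r * ((C (k + 1)).im - (C k).im))
    (hw : 0 < det (C (k + 1) - C k) w) : ∀ᶠ σ : ℝ in 𝓝[>] 0, z + σ * w ∈ inside o C := by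
  have hcont : Continuous fun σ : ℝ => z + σ * w := by fun_prop
  have e1 : orient o (C k) z = r * orient o (C k) (C (k + 1)) := by
    simp only [orient_def, hre, him]; ring
  have e2 : orient o z (C (k + 1)) = (1 - r) * orient o (C k) (C (k + 1)) := by
    simp only [orient_def, hre, him]; ring
  have hz : z + ((0 : ℝ) : ℂ) * w = z := by simp
  have t1 := ((continuous_orient_right o (C k)).comp hcont).tendsto 0
  have t2 := ((continuous_orient_mid o (C (k + 1))).comp hcont).tendsto 0
  simp only [Function.comp_def, hz, e1, e2] at t1 t2
  filter_upwards [nhdsWithin_le_nhds (t1 (Ioi_mem_nhds (mul_pos h0 (hC k)))),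
    nhdsWithin_le_nhds (t2 (Ioi_mem_nhds (mul_pos (sub_pos.2 h1) (hC k)))),
    self_mem_nhdsWithin] with σ k1 k2 k3
  refine mem_inside_of hC ⟨le_of_lt k1, le_of_lt k2⟩ ?_
  have : orient (C k) (C (k + 1)) (z + σ * w) = σ * det (C (k + 1) - C k) w := by
    simp only [orient_def, det, Complex.add_re, Complex.add_im, Complex.re_ofReal_mul,
      Complex.im_ofReal_mul, Complex.sub_re, Complex.sub_im, hre, him]
    ring
  rw [this]
  exact mul_pos k3 hw

theorem isBounded_carrier {V : Type*} [Finite V] (H : SimpleGraph V) (p : V → ℂ) :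
    Bornology.IsBounded (carrier H p) := by
  refine (Set.finite_range p).isCompact_convexHull (𝕜 := ℝ) |>.isBounded.subset ?_
  rintro z ⟨u, v, -, hz⟩
  exact segment_subset_convexHull (Set.mem_range_self u) (Set.mem_range_self v) hz

theorem IsGluedPair.finite {V : Type*} {H : SimpleGraph V} {o o' : V} {c d : ZMod 8 → V}
    (g : IsGluedPair H o c o' d) : Finite V := by
  refine Set.finite_univ_iff.1 (((Set.finite_range c).union (Set.finite_range d)).insert o'
    |>.insert o |>.subset fun v _ => ?_)
  rcases g.cover v with rfl | rfl | ⟨m, rfl⟩ | ⟨m, rfl⟩ <;> simp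

/-- There is a direction such that the line through a given vertex in this direction contains no
other vertex. -/
theorem exists_direction {V : Type*} [Finite V] {p : V → ℂ} (hp : Function.Injective p) (o : V) :
    ∃ w : ℂ, w ≠ 0 ∧ ∀ v, v ≠ o → det w (p v - p o) ≠ 0 := by
  obtain ⟨x, hx⟩ :=
    (Set.finite_range fun v => (p v - p o).im / (p v - p o).re).infinite_compl.nonempty
  refine ⟨⟨1, x⟩, fun e => one_ne_zero (congrArg Complex.re e), fun v hv h => ?_⟩
  simp only [det, one_mul] at h
  by_cases h0 : (p v - p o).re = 0
  · rw [h0, mul_zero, sub_zero] at h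
    exact hv (hp (sub_eq_zero.1 (Complex.ext h0 h)))
  · exact hx ⟨v, by rw [div_eq_iff h0]; linarith⟩

namespace IsPairDrawing

variable {V : Type*} {H : SimpleGraph V} {p : V → ℂ} {o o' : V} {c d : ZMod 8 → V}
  {u v x y x' y' : V} {z w : ℂ} {t : ℝ}

/-- The link stays in the region of the first copy up to its crossing, and then in that of the
second one. -/
theorem pointOn_link (P : IsPairDrawing H p o c o' d) (h0 : 0 < t) (h1 : t < 1) :
    pointOn p (c 1) (d 1) t ∈ StarQuad.inside (p o) (corner p c) ∨
      pointOn p (c 1) (d 1) t ∈ StarQuad.inside (p o') (corner p d) ∨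
      pointOn p (c 1) (d 1) t ∈ segment ℝ (p (c 0)) (p (c 2)) := by
  obtain ⟨s, r, D, hs0, hs1, hr0, hr1, hD, -, -, -, e1, e2, e3, e4⟩ :=
    P.rac.cross_param P.link_crosses
  -- the parameter of a common point is determined
  have hs : ∀ a, pointOn p (c 1) (d 1) a ∈ segment ℝ (p (c 0)) (p (c 2)) → a = s := by
    intro a ha
    obtain ⟨b, -, -, k1, k2⟩ := mem_segment_iff.1 ha
    have e0 : orient (p (c 0)) (p (c 2)) (pointOn p (c 1) (d 1) a) = 0 := by
      simp only [orient_def, k1, k2]; ring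
    have e5 : orient (p (c 0)) (p (c 2)) (pointOn p (c 1) (d 1) a) =
        (1 - a) * orient (p (c 0)) (p (c 2)) (p (c 1)) +
          a * orient (p (c 0)) (p (c 2)) (p (d 1)) := by
      simp only [orient_def, pointOn_re, pointOn_im]; ring
    rw [e0, e1, e2] at e5
    have := mul_left_cancel₀ hD (show D * a = D * s by linarith)
    exact this
  have hodd : p (c 1) ∈ StarQuad.inside (p o) (corner p c) := by simpa using P.odd_mem_inside 0
  have hodd' : p (d 1) ∈ StarQuad.inside (p o') (corner p d) := by
    simpa using P.symm.odd_mem_inside 0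
  rcases lt_trichotomy t s with hlt | rfl | hlt
  · left
    refine P.pointOn_mem_inside P.link_crosses.1 hodd h0 h1 fun _ a _ hat ha => ?_
    linarith [hs a ha]
  · right; right
    exact mem_segment_iff.2 ⟨r, hr0.le, hr1.le, by rw [pointOn_re, e3], by rw [pointOn_im, e4]⟩
  · right; left
    rw [← pointOn_swap]
    refine P.symm.pointOn_mem_inside P.link_crosses.1.symm hodd' (by linarith) (by linarith)
      fun _ a _ hat ha => ?_
    rw [← P.two_eq, ← P.zero_eq, segment_symm, ← pointOn_swap] at ha
    linarith [hs _ ha]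

/-- The edges lie in the regions covered by the two copies, apart from the sides of the outer
quadrilaterals. -/
theorem location (P : IsPairDrawing H p o c o' d) (huv : H.Adj u v) (h0 : 0 < t) (h1 : t < 1) :
    pointOn p u v t ∈ StarQuad.inside (p o) (corner p c) ∨
      pointOn p u v t ∈ StarQuad.inside (p o') (corner p d) ∨
      (∃ m, s(u, v) = s(c (2 * m), c (2 * m + 2))) ∨
      (∃ m, s(u, v) = s(d (2 * m), d (2 * m + 2))) ∨
      (s(u, v) = s(c 1, d 1) ∧ pointOn p u v t ∈ segment ℝ (p (c 0)) (p (c 2))) := by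
  have key : ∀ {o o' : V} {c d : ZMod 8 → V}, IsPairDrawing H p o c o' d → IsCopyEdge o c u v →
      s(u, v) ≠ s(c 1, d 1) → pointOn p u v t ∈ StarQuad.inside (p o) (corner p c) ∨
      ∃ m, s(u, v) = s(c (2 * m), c (2 * m + 2)) := by
    intro o o' c d P hcopy hne
    have hend : (p u ∈ StarQuad.inside (p o) (corner p c) ∨
        p v ∈ StarQuad.inside (p o) (corner p c)) →
        pointOn p u v t ∈ StarQuad.inside (p o) (corner p c) := by
      rintro (h | h)
      · exact P.pointOn_mem_inside huv h h0 h1 fun e => absurd e hne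
      · rw [← pointOn_swap]
        exact P.pointOn_mem_inside huv.symm h (by linarith) (by linarith)
          fun e => absurd (Sym2.eq_swap.trans e) hne
    have hcen := StarQuad.center_mem P.star
    have hodd := P.odd_mem_inside
    have hof : ∀ a b, s(u, v) = s(a, b) → (p a ∈ StarQuad.inside (p o) (corner p c) ∨
        p b ∈ StarQuad.inside (p o) (corner p c)) →
        pointOn p u v t ∈ StarQuad.inside (p o) (corner p c) := by
      intro a b e h
      rcases Sym2.eq_iff.1 e with ⟨rfl, rfl⟩ | ⟨rfl, rfl⟩
      exacts [hend h, hend h.symm]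
    rcases hcopy with ⟨m, e⟩ | ⟨m, e⟩ | ⟨m, e⟩
    · exact Or.inl (hof _ _ e (Or.inl hcen))
    · left
      rcases zmod_eight_parity m with ⟨k, rfl⟩ | ⟨k, rfl⟩
      · exact hof _ _ e (Or.inr (hodd k))
      · refine hof _ _ e (Or.inl ?_)
        rw [show 2 * k - 1 = 2 * (k - 1) + 1 by ring]
        exact hodd _
    · rcases zmod_eight_parity m with ⟨k, rfl⟩ | ⟨k, rfl⟩
      · exact Or.inr ⟨k, e⟩
      · refine Or.inl (hof _ _ e (Or.inl ?_))
        rw [show 2 * k - 1 = 2 * (k - 1) + 1 by ring]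
        exact hodd _
  by_cases hl : s(u, v) = s(c 1, d 1)
  · have := P.pointOn_link h0 h1
    have h2 := P.pointOn_link (t := 1 - t) (by linarith) (by linarith)
    rcases Sym2.eq_iff.1 hl with ⟨rfl, rfl⟩ | ⟨rfl, rfl⟩
    · tauto
    · rw [pointOn_swap] at h2
      tauto
  · rcases P.glued.edge_cases u v huv with h | h | h
    · have := key P h hl
      tauto
    · have := key P.symm h (by rwa [Sym2.eq_swap (a := d 1)])
      tauto
    · exact absurd h hl

/-- A ray that leaves the drawing through a side of an outer quadrilateral shows that the outer face
is on the other side of it. -/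
theorem leftOuter_of_exit (P : IsPairDrawing H p o c o' d) {m : ZMod 8} (h0 : 0 < t) (h1 : t < 1)
    (hw : det (p (c (2 * m + 2)) - p (c (2 * m))) w ≠ 0)
    (h : ∀ σ : ℝ, 0 < σ → pointOn p (c (2 * m)) (c (2 * m + 2)) t + σ * w ∈ outerFace H p) :
    2 * m ≠ 0 ∧ LeftOuter H p (c (2 * m + 2)) (c (2 * m)) := by
  have := P.glued.finite
  have hin : ∀ {o o' : V} {c d : ZMod 8 → V} {m : ZMod 8} {t : ℝ}, IsPairDrawing H p o c o' d →
      0 < t → t < 1 →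
      (∀ σ : ℝ, 0 < σ → pointOn p (c (2 * m)) (c (2 * m + 2)) t + σ * w ∈ outerFace H p) →
      ¬ 0 < det (p (c (2 * m + 2)) - p (c (2 * m))) w := by
    intro o o' c d m t P h0 h1 h hw
    obtain ⟨k, hk⟩ := exists_double m
    rw [hk, ← double_add_one] at h hw
    obtain ⟨σ, hσ, hσ0⟩ := ((StarQuad.eventually_mem_inside P.star (k := k) h0 h1
      (pointOn_re _ _ _ _) (pointOn_im _ _ _ _) hw).and self_mem_nhdsWithin).exists
    exact P.notMem_outerFace hσ (h σ hσ0)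
  have hneg : 0 < det (p (c (2 * m)) - p (c (2 * m + 2))) w := by
    have h2 := lt_of_le_of_ne (not_lt.1 (hin P h0 h1 h)) hw
    simp only [det, Complex.sub_re, Complex.sub_im] at h2 ⊢
    linarith
  have hm : 2 * m ≠ 0 := by
    intro hm
    rw [hm, zero_add, P.zero_eq, P.two_eq] at h hneg
    refine hin (m := 0) (t := 1 - t) P.symm (by linarith) (by linarith) ?_ (by simpa using hneg)
    simpa only [mul_zero, zero_add, pointOn_swap] using h
  refine ⟨hm, P.rac.leftOuter_of_ray (P.outer_adj m).symm (fun a b hc => hm ?_)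
    (t := 1 - t) (by linarith) (by linarith) hneg (by simpa only [pointOn_swap] using h)⟩
  exact (P.outer_crosses hc.swap_left).1

/-- The outer face touches some side of one of the outer quadrilaterals. -/
theorem exists_leftOuter (P : IsPairDrawing H p o c o' d) :
    (∃ m, 2 * m ≠ 0 ∧ LeftOuter H p (c (2 * m + 2)) (c (2 * m))) ∨
      ∃ m, 2 * m ≠ 0 ∧ LeftOuter H p (d (2 * m + 2)) (d (2 * m)) := by
  have := P.glued.finite
  obtain ⟨w, hw0, hw⟩ := exists_direction P.rac.injective o
  have hcont : Continuous fun s : ℝ => p o + s * w := by fun_prop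
  have hclosed : IsClosed (carrier H p) := isClosed_edges p H.Adj
  -- the last point of the drawing on the ray from the vertex `o` in the direction of `w`
  obtain ⟨s₀, ⟨hs₀, hz⟩, hmax⟩ : ∃ s, IsGreatest {s : ℝ | 0 ≤ s ∧ p o + s * w ∈ carrier H p} s := by
    refine IsCompact.exists_isGreatest (Metric.isCompact_of_isClosed_isBounded
      (isClosed_Ici.inter (hclosed.preimage hcont)) ?_) ⟨0, le_rfl, ?_⟩
    · obtain ⟨R, hR⟩ := (isBounded_carrier H p).subset_closedBall (p o)
      refine (Metric.isBounded_Icc 0 (R / ‖w‖)).subset ?_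
      rintro s ⟨hs, hs'⟩
      have := hR hs'
      rw [Metric.mem_closedBall, dist_eq_norm, add_sub_cancel_left, norm_mul, Complex.norm_real,
        Real.norm_of_nonneg hs] at this
      exact ⟨hs, (le_div_iff₀ (norm_pos_iff.2 hw0)).2 this⟩
    · exact ⟨o, c 0, P.glued.left.spoke 0, by simpa using left_mem_segment ℝ _ _⟩
  set z := p o + s₀ * w with hzdef
  have hout : ∀ σ : ℝ, 0 < σ → z + σ * w ∈ outerFace H p := by
    intro σ hσ
    have hrw : ∀ r : ℝ, z + σ * w + r * w = p o + ((s₀ + σ + r : ℝ) : ℂ) * w := by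
      intro r; rw [hzdef]; push_cast; ring
    have hray : (fun r : ℝ => z + σ * w + r * w) '' Set.Ici 0 ⊆ (carrier H p)ᶜ := by
      rintro _ ⟨r, hr, rfl⟩ h
      simp only [hrw] at h
      have hr : 0 ≤ r := hr
      have := hmax ⟨by positivity, h⟩
      linarith
    have hmem : z + σ * w ∈ (fun r : ℝ => z + σ * w + r * w) '' Set.Ici 0 :=
      ⟨0, Set.self_mem_Ici, by simp⟩
    exact ⟨hray hmem, not_isBounded_component (isPreconnected_ray _ _) hmem hray
      (not_isBounded_ray _ hw0)⟩
  have hopen : ∀ {o o' : V} {c d : ZMod 8 → V}, IsPairDrawing H p o c o' d →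
      z ∉ StarQuad.inside (p o) (corner p c) := by
    intro o o' c d P h
    have ht : Filter.Tendsto (fun σ : ℝ => z + σ * w) (𝓝 0) (𝓝 z) := by
      have : Continuous fun σ : ℝ => z + σ * w := by fun_prop
      simpa using this.tendsto 0
    have hev : ∀ᶠ σ : ℝ in 𝓝[>] 0, z + σ * w ∈ StarQuad.inside (p o) (corner p c) :=
      nhdsWithin_le_nhds (ht (StarQuad.isOpen_inside.mem_nhds h))
    obtain ⟨σ, h1, h2⟩ := (hev.and self_mem_nhdsWithin).exists
    exact P.notMem_outerFace h1 (hout σ h2)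
  have hvert : ∀ v, z ≠ p v := by
    intro v e
    by_cases hv : v = o
    · refine hopen P ?_
      rw [e, hv]
      exact StarQuad.center_mem P.star
    · apply hw v hv
      rw [← e, hzdef]
      simp only [det, Complex.sub_re, Complex.sub_im, Complex.add_re, Complex.add_im,
        Complex.re_ofReal_mul, Complex.im_ofReal_mul]
      ring
  have hparam : ∀ u v, z ∈ segment ℝ (p u) (p v) → ∃ t, 0 < t ∧ t < 1 ∧ z = pointOn p u v t := by
    intro u v h
    obtain ⟨t, h0, h1, e⟩ := mem_segment_iff_pointOn.1 h
    refine ⟨t, lt_of_le_of_ne h0 ?_, lt_of_le_of_ne h1 ?_, e⟩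
    · rintro rfl
      exact hvert u (by rw [e, pointOn_zero])
    · rintro rfl
      exact hvert v (by rw [e, pointOn_one])
  have hside : ∀ {o₁ o₂ : V} {c d : ZMod 8 → V}, IsPairDrawing H p o₁ c o₂ d → (∀ n, c n ≠ o) →
      ∀ m, z ∈ segment ℝ (p (c (2 * m))) (p (c (2 * m + 2))) →
      ∃ m, 2 * m ≠ 0 ∧ LeftOuter H p (c (2 * m + 2)) (c (2 * m)) := by
    intro o₁ o₂ c d P hne m h
    obtain ⟨t, h0, h1, e⟩ := hparam _ _ h
    refine ⟨m, P.leftOuter_of_exit h0 h1 (w := w) (fun hd => hw _ (hne (2 * m)) ?_)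
      (by rwa [← e])⟩
    have e1 := congrArg Complex.re e
    have e2 := congrArg Complex.im e
    rw [pointOn_re, hzdef, Complex.add_re, Complex.re_ofReal_mul] at e1
    rw [pointOn_im, hzdef, Complex.add_im, Complex.im_ofReal_mul] at e2
    simp only [det, Complex.sub_re, Complex.sub_im] at hd ⊢
    linear_combination w.im * e1 - w.re * e2 + t * hd
  obtain ⟨u, v, huv, h⟩ := hz
  obtain ⟨t, h0, h1, e⟩ := hparam u v h
  have hc : ∀ n, c n ≠ o := fun n => (P.glued.left.center_ne n).symm
  have hd : ∀ n, d n ≠ o := fun n => (P.glued.right_ne n).symm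
  have hof : ∀ {a b : V}, s(u, v) = s(a, b) → z ∈ segment ℝ (p a) (p b) := by
    intro a b e
    rcases Sym2.eq_iff.1 e with ⟨rfl, rfl⟩ | ⟨rfl, rfl⟩
    exacts [h, by rwa [segment_symm]]
  rcases P.location huv h0 h1 with h2 | h2 | ⟨m, h2⟩ | ⟨m, h2⟩ | ⟨-, h2⟩
  · exact absurd (e ▸ h2) (hopen P)
  · exact absurd (e ▸ h2) (hopen P.symm)
  · exact Or.inl (hside P hc m (hof h2))
  · exact Or.inr (hside P.symm hd m (hof h2))
  · exact Or.inl (hside P hc 0 (by simpa [e] using h2))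

end IsPairDrawing

/-! ### The combinatorial data of a drawing -/

/-- The last and the first member of a list of all edges at `u` in counterclockwise order bound a
sector. -/
theorem isSector_of_triplewise {V : Type*} {H : SimpleGraph V} {p : V → ℂ} {u x y : V} {L : List V}
    (hadj : ∀ z, H.Adj u z → z ∈ (x :: L) ++ [y])
    (hL : ((x :: L) ++ [y]).Triplewise (CyclicAt p u)) : IsSector H p u y x := by
  intro z hz hy hx
  have hzL : z ∈ L := by
    have := hadj z hz
    simp only [List.cons_append, List.mem_cons, List.mem_append, List.not_mem_nil] at this
    tauto
  rw [List.cons_append, List.triplewise_cons] at hL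
  exact ((List.pairwise_append.1 hL.1).2.2 z hzL y (by simp)).rotate.rotate

namespace IsPairDrawing

variable {V : Type*} {H : SimpleGraph V} {p q : V → ℂ} {o o' : V} {c d : ZMod 8 → V}
  {u v x y x' y' : V} {z w : ℂ} {t : ℝ}

/-- At an unshared vertex of an outer quadrilateral, the outer face passes from one of its sides
there to the other one. -/
theorem leftOuter_even_iff (P : IsPairDrawing H p o c o' d) {m : ZMod 8} (h0 : 2 * m ≠ 0)
    (h2 : 2 * m ≠ 2) :
    LeftOuter H p (c (2 * m)) (c (2 * m - 2)) ↔ LeftOuter H p (c (2 * m + 2)) (c (2 * m)) := by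
  have := P.glued.finite
  have w := P.glued.left
  refine P.rac.leftOuter_iff (w.adj (by revert m; decide)) (w.adj (by revert m; decide))
    (w.ne (by revert m; decide)) (fun a b h => ?_) (fun a b h => ?_)
    (isSector_of_triplewise (fun z hz => P.glued.mem_of_adj_even h0 h2 hz) (P.triplewise_even m))
  · refine h2 (sub_eq_zero.1 ?_)
    rw [show 2 * m - 2 = 2 * (m - 1) by ring]
    refine (P.outer_crosses (h.swap_left.congr ?_ rfl)).1
    rw [show 2 * m - 2 = 2 * (m - 1) by ring, show 2 * (m - 1) + 2 = 2 * m by ring]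
  · exact h0 (P.outer_crosses h.swap_left).1

/-- At a shared vertex, the outer face passes from a side of one outer quadrilateral to a side of
the other one. -/
theorem leftOuter_shared_iff (P : IsPairDrawing H p o c o' d) :
    LeftOuter H p (c 0) (c 6) ↔ LeftOuter H p (d 4) (d 2) := by
  have := P.glued.finite
  have w := P.glued.left
  have w' := P.glued.right
  rw [← P.zero_eq]
  refine P.rac.leftOuter_iff (w.adj (by decide)) (by rw [P.zero_eq]; exact w'.adj (by decide))
    (fun e => absurd (P.glued.eq_of_eq _ _ e).1 (by decide)) (fun a b h => ?_) (fun a b h => ?_)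
    (isSector_of_triplewise (fun z hz => P.glued.mem_of_adj_shared P.zero_eq P.two_eq hz)
      P.triplewise_shared)
  · refine absurd (P.outer_crosses (m := 3) (x := a) (y := b) (h.swap_left.congr ?_ rfl)).1
      (by decide)
    rw [show (2 : ZMod 8) * 3 = 6 by decide, show (6 : ZMod 8) + 2 = 0 by decide]
  · refine absurd (P.symm.outer_crosses (m := 1) (x := a) (y := b) (h.swap_left.congr ?_ rfl)).1
      (by decide)
    rw [P.zero_eq, show (2 : ZMod 8) * 1 = 2 by decide, show (2 : ZMod 8) + 2 = 4 by decide]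

/-- The outer face lies on the outer side of each of the six unshared sides of the outer
quadrilaterals: it is on one of them, and it passes from one to the next. -/
theorem leftOuter (P : IsPairDrawing H p o c o' d) {m : ZMod 8} (hm : 2 * m ≠ 0) :
    LeftOuter H p (c (2 * m + 2)) (c (2 * m)) ∧ LeftOuter H p (d (2 * m + 2)) (d (2 * m)) := by
  have h4 := P.leftOuter_even_iff (m := 2) (by decide) (by decide)
  have h6 := P.leftOuter_even_iff (m := 3) (by decide) (by decide)
  have h4' := P.symm.leftOuter_even_iff (m := 2) (by decide) (by decide)
  have h6' := P.symm.leftOuter_even_iff (m := 3) (by decide) (by decide)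
  have h0 := P.leftOuter_shared_iff
  simp only [show (2 : ZMod 8) * 2 = 4 by decide, show (2 : ZMod 8) * 3 = 6 by decide,
    show (4 : ZMod 8) - 2 = 2 by decide, show (4 : ZMod 8) + 2 = 6 by decide,
    show (6 : ZMod 8) - 2 = 4 by decide, show (6 : ZMod 8) + 2 = 0 by decide] at h4 h6 h4' h6'
  have key : ∀ m : ZMod 8, 2 * m = 0 ∨ (2 * m = 2 ∧ 2 * m + 2 = 4) ∨ (2 * m = 4 ∧ 2 * m + 2 = 6) ∨
      (2 * m = 6 ∧ 2 * m + 2 = 0) := by decide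
  have k1 := h4.symm
  have k2 := h6.symm.trans k1
  have k3 := h0.symm.trans k2
  have k4 := h4'.symm.trans k3
  have k5 := h6'.symm.trans k4
  have hone : LeftOuter H p (c 4) (c 2) := by
    rcases P.exists_leftOuter with ⟨n, hn, h⟩ | ⟨n, hn, h⟩ <;>
    rcases (key n).resolve_left hn with ⟨e, e'⟩ | ⟨e, e'⟩ | ⟨e, e'⟩ <;> rw [e', e] at h
    exacts [h, k1.1 h, k2.1 h, k3.1 h, k4.1 h, k5.1 h]
  rcases (key m).resolve_left hm with ⟨e, e'⟩ | ⟨e, e'⟩ | ⟨e, e'⟩ <;> rw [e', e]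
  exacts [⟨hone, k3.2 hone⟩, ⟨k1.2 hone, k4.2 hone⟩, ⟨k2.2 hone, k5.2 hone⟩]

/-- The outer face lies to the left of no other edge, or piece of an edge. -/
theorem eq_of_leftPoint_mem (P : IsPairDrawing H p o c o' d) (huv : H.Adj u v) (h0 : 0 < t)
    (h1 : t < 1) (hX : ∀ x y, Crosses H p u v x y → pointOn p u v t ∉ segment ℝ (p x) (p y))
    (hev : ∀ᶠ ε : ℝ in 𝓝[>] 0, leftPoint p u v t ε ∈ outerFace H p) :
    ∃ m, 2 * m ≠ 0 ∧
      ((u = c (2 * m + 2) ∧ v = c (2 * m)) ∨ (u = d (2 * m + 2) ∧ v = d (2 * m))) := by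
  have hcont : Filter.Tendsto (fun ε : ℝ => leftPoint p u v t ε) (𝓝 0) (𝓝 (pointOn p u v t)) := by
    have := ((continuous_leftPoint p u v).comp (Continuous.prodMk_right t)).tendsto 0
    simpa [Function.comp_def, leftPoint] using this
  have hopen : ∀ {o o' : V} {c d : ZMod 8 → V}, IsPairDrawing H p o c o' d →
      pointOn p u v t ∉ StarQuad.inside (p o) (corner p c) := by
    intro o o' c d P h
    have hev' : ∀ᶠ ε : ℝ in 𝓝[>] 0, leftPoint p u v t ε ∈ StarQuad.inside (p o) (corner p c) :=
      nhdsWithin_le_nhds (hcont (StarQuad.isOpen_inside.mem_nhds h))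
    obtain ⟨ε, e1, e2⟩ := (hev.and hev').exists
    exact P.notMem_outerFace e2 e1
  -- the side of an outer quadrilateral in the positive sense has the quadrilateral on its left
  have hpos : ∀ {o o' : V} {c d : ZMod 8 → V}, IsPairDrawing H p o c o' d → ∀ m,
      ¬ (u = c (2 * m) ∧ v = c (2 * m + 2)) := by
    rintro o o' c d P m ⟨rfl, rfl⟩
    obtain ⟨k, hk⟩ := exists_double m
    rw [hk, ← double_add_one] at hev huv
    have hN := normSq_pos P.rac huv
    have hin := StarQuad.eventually_mem_inside P.star (k := k) h0 h1
      (pointOn_re _ _ _ _) (pointOn_im _ _ _ _)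
      (w := Complex.I * (p (c (double (k + 1))) - p (c (double k)))) (by
        simp only [corner, det, Complex.sub_re, Complex.sub_im, Complex.mul_re, Complex.mul_im,
          Complex.I_re, Complex.I_im]
        linarith)
    obtain ⟨ε, e1, e2⟩ := (hev.and hin).exists
    exact P.notMem_outerFace e2 e1
  have hside : ∀ {o o' : V} {c d : ZMod 8 → V}, IsPairDrawing H p o c o' d → ∀ m,
      s(u, v) = s(c (2 * m), c (2 * m + 2)) → 2 * m ≠ 0 ∧ u = c (2 * m + 2) ∧ v = c (2 * m) := by
    intro o o' c d P m e
    rcases Sym2.eq_iff.1 e with h | ⟨rfl, rfl⟩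
    · exact absurd h (hpos P m)
    · refine ⟨fun hm => hpos P.symm 0 ?_, rfl, rfl⟩
      rw [hm, mul_zero, zero_add, P.zero_eq, P.two_eq]
      exact ⟨rfl, rfl⟩
  rcases P.location huv h0 h1 with h | h | ⟨m, h⟩ | ⟨m, h⟩ | ⟨h, h'⟩
  · exact absurd h (hopen P)
  · exact absurd h (hopen P.symm)
  · obtain ⟨hm, h⟩ := hside P m h
    exact ⟨m, hm, Or.inl h⟩
  · obtain ⟨hm, h⟩ := hside P.symm m h
    exact ⟨m, hm, Or.inr h⟩
  · exact absurd h' (hX _ _ (P.link_crosses.congr h.symm rfl))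

theorem not_crosses_side (P : IsPairDrawing H p o c o' d) {m : ZMod 8} (hm : 2 * m ≠ 0) :
    ¬ Crosses H p (c (2 * m + 2)) (c (2 * m)) x y :=
  fun h => hm (P.outer_crosses h.swap_left).1

/-- The combinatorial data of a drawing of this shape are determined by the numbering. -/
theorem planeData_eq (P : IsPairDrawing H p o c o' d) (Q : IsPairDrawing H q o c o' d) :
    planeData H p = planeData H q := by
  -- every edge has one crossing at most, so that there is nothing to order
  have horder : ∀ {p : V → ℂ}, IsPairDrawing H p o c o' d → ∀ u v x y x' y',
      ¬ (planeData H p).order u v x y x' y' := by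
    rintro p P u v x y x' y' ⟨h, h', s, t, hs, hst, ht, hx, hx'⟩
    have e := P.crossing_unique h h'
    have hx' : pointOn p u v t ∈ segment ℝ (p x) (p y) := by
      rcases Sym2.eq_iff.1 e with ⟨rfl, rfl⟩ | ⟨rfl, rfl⟩
      exacts [hx', by rwa [segment_symm]]
    obtain ⟨r, -, D, -, -, -, -, hD, hDe, -⟩ := P.rac.cross_param h
    obtain ⟨a, -, -, a1, a2⟩ := mem_segment_iff.1 hx
    obtain ⟨b, -, -, b1, b2⟩ := mem_segment_iff.1 hx'
    rw [pointOn_re] at a1 b1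
    rw [pointOn_im] at a2 b2
    simp only [det, Complex.sub_re, Complex.sub_im] at hDe
    have : (t - s) * D = 0 := by
      rw [hDe]
      linear_combination ((p y).im - (p x).im) * (b1 - a1) - ((p y).re - (p x).re) * (b2 - a2)
    exact mul_ne_zero (sub_pos.2 hst).ne' hD this
  -- the edges which the outer face touches are uncrossed, and hence consist of a single piece
  have houter : ∀ {p q : V → ℂ}, IsPairDrawing H p o c o' d → IsPairDrawing H q o c o' d →
      ∀ u v S, (planeData H p).outerLeft u v S → (planeData H q).outerLeft u v S := by
    rintro p q P Q u v S ⟨huv, t, h0, h1, hX, hS, hev⟩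
    obtain ⟨m, hm, h⟩ := P.eq_of_leftPoint_mem huv h0 h1 hX hev
    have hcr : (∀ x y, ¬ Crosses H p u v x y) ∧ (∀ x y, ¬ Crosses H q u v x y) ∧
        LeftOuter H q u v := by
      rcases h with ⟨rfl, rfl⟩ | ⟨rfl, rfl⟩
      · exact ⟨fun x y => P.not_crosses_side hm, fun x y => Q.not_crosses_side hm,
          (Q.leftOuter hm).1⟩
      · exact ⟨fun x y => P.symm.not_crosses_side hm, fun x y => Q.symm.not_crosses_side hm,
          (Q.leftOuter hm).2⟩
    refine ⟨huv, t, h0, h1, fun x y h => absurd h (hcr.2.1 x y), ?_, hcr.2.2 t h0 h1⟩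
    rw [hS]
    ext e
    exact ⟨fun h => absurd h.1 (hcr.1 _ _), fun h => absurd h.1 (hcr.2.1 _ _)⟩
  have himp : ∀ {p q : V → ℂ}, IsPairDrawing H p o c o' d → IsPairDrawing H q o c o' d →
      ∀ u v x y, Crosses H p u v x y → Crosses H q u v x y ∧
      (0 < det (p v - p u) (p y - p x) → 0 < det (q v - q u) (q y - q x)) :=
    fun P Q _ _ _ _ h => crossing_congr P Q h
  ext
  · exact ⟨fun h => (himp P Q _ _ _ _ h).1, fun h => (himp Q P _ _ _ _ h).1⟩
  · exact ⟨fun h => absurd h (horder P _ _ _ _ _ _), fun h => absurd h (horder Q _ _ _ _ _ _)⟩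
  · exact ⟨fun ⟨h1, h2, h3, h⟩ => ⟨h1, h2, h3, P.rotation_congr Q h1 h2 h3 h⟩,
      fun ⟨h1, h2, h3, h⟩ => ⟨h1, h2, h3, Q.rotation_congr P h1 h2 h3 h⟩⟩
  · exact ⟨fun h => ⟨(himp P Q _ _ _ _ h.1).1, (himp P Q _ _ _ _ h.1).2 h.2⟩,
      fun h => ⟨(himp Q P _ _ _ _ h.1).1, (himp Q P _ _ _ _ h.1).2 h.2⟩⟩
  · exact ⟨houter P Q _ _ _, houter Q P _ _ _⟩

end IsPairDrawing

/-! ### Mirror images -/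

/-- The numbering of the vertices of an antiprism in the reverse order, such that the places of the
shared vertices are exchanged. -/
def rev {V : Type*} (c : ZMod 8 → V) : ZMod 8 → V := fun m => c (2 - m)

theorem rev_rev {V : Type*} (c : ZMod 8 → V) : rev (rev c) = c :=
  funext fun m => by simp [rev]

section Mirror

variable {V : Type*} {H : SimpleGraph V} {p q : V → ℂ} {o o' : V} {c d : ZMod 8 → V} {u v x y : V}

theorem mirror_mirror (p : V → ℂ) : mirror (mirror p) = p :=
  funext fun v => Complex.conj_conj (p v)

theorem orient_mirror (p : V → ℂ) (u v w : V) :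
    orient (mirror p u) (mirror p v) (mirror p w) = orient (p u) (p w) (p v) := by
  simp only [orient_def, mirror, Complex.conj_re, Complex.conj_im]; ring

theorem Crosses.mirror (h : Crosses H p u v x y) : Crosses H (mirror p) u v x y := by
  obtain ⟨h1, h2, h3, z, hz, hz'⟩ := h
  refine ⟨h1, h2, h3, (starRingEnd ℂ) z, ?_, ?_⟩
  · obtain ⟨t, h0, h1, e1, e2⟩ := mem_openSegment_iff.1 hz
    exact mem_openSegment_iff.2
      ⟨t, h0, h1, by simp [RAC.mirror, e1], by simp [RAC.mirror, e2]; ring⟩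
  · obtain ⟨t, h0, h1, e1, e2⟩ := mem_openSegment_iff.1 hz'
    exact mem_openSegment_iff.2
      ⟨t, h0, h1, by simp [RAC.mirror, e1], by simp [RAC.mirror, e2]; ring⟩

theorem IsRACDrawing.mirror (hp : IsRACDrawing H p) : IsRACDrawing H (mirror p) where
  injective := (starRingEnd ℂ).injective.comp hp.injective
  vertex_edge u v w huv hw := by
    obtain ⟨t, h0, h1, e1, e2⟩ := mem_segment_iff.1 hw
    refine hp.vertex_edge u v w huv (mem_segment_iff.2 ⟨t, h0, h1, ?_, ?_⟩)
    · simpa [RAC.mirror] using e1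
    · simp [RAC.mirror] at e2
      linarith
  right_angle u v x y h := by
    have h' := h.mirror
    rw [mirror_mirror] at h'
    have := hp.right_angle u v x y h'
    rw [inner_eq] at this ⊢
    simp only [RAC.mirror, Complex.sub_re, Complex.sub_im, Complex.conj_re,
      Complex.conj_im] at this ⊢
    linarith

theorem combinatorialEmbedding_mirror (H : SimpleGraph V) (p : V → ℂ) :
    combinatorialEmbedding H (mirror p) = combinatorialEmbedding H p := by
  rw [combinatorialEmbedding, combinatorialEmbedding, mirror_mirror, Sym2.eq_swap]

theorem IsAntiprism.Pos.mirror (h : IsAntiprism.Pos o c p) :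
    IsAntiprism.Pos o (rev c) (mirror p) := by
  intro m n hn
  rw [orient_mirror]
  exact h (2 - n) (2 - m) (by rw [hn]; ring)

theorem IsGluedPair.reflect (g : IsGluedPair H o c o' d) :
    IsGluedPair H o (rev c) o' (rev d) := g.reflect_left.symm.reflect_left.symm

theorem IsPairDrawing.mirror (P : IsPairDrawing H p o c o' d) :
    IsPairDrawing H (mirror p) o (rev c) o' (rev d) :=
  P.glued.reflect.pairDrawing P.rac.mirror P.left.pos.mirror P.right.pos.mirror

/-- In a drawing with the first copy in the positive sense, the second one is drawn in this sense
as well, if the shared vertices are numbered accordingly. -/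
theorem IsGluedPair.pairDrawing_of_pos (g : IsGluedPair H o c o' d) (h0 : c 0 = d 2)
    (hp : IsRACDrawing H p) (hl : IsAntiprism.Pos o c p) : IsPairDrawing H p o c o' d := by
  rcases g.right.pos_or_pos hp 2 with hr | hr
  · exact g.pairDrawing hp hl hr
  · have e := (g.symm.reflect_left.symm.pairDrawing hp hl hr).zero_eq
    simp only [sub_self] at e
    exact absurd (g.right.injective (h0.symm.trans e)) (by decide)

/-- Every drawing is of the same shape, up to reflection. -/
theorem IsGluedPair.pairDrawing_or (g : IsGluedPair H o c o' d) (h0 : c 0 = d 2) (h2 : c 2 = d 0)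
    (hp : IsRACDrawing H p) :
    IsPairDrawing H p o c o' d ∨ IsPairDrawing H p o (rev c) o' (rev d) := by
  rcases g.left.pos_or_pos hp 2 with hl | hl
  · exact Or.inl (g.pairDrawing_of_pos h0 hp hl)
  · exact Or.inr (g.reflect.pairDrawing_of_pos (by simpa [rev] using h2) hp hl)

theorem IsPairDrawing.combinatorialEmbedding_eq (P : IsPairDrawing H p o c o' d)
    (Q : IsPairDrawing H q o c o' d) :
    combinatorialEmbedding H p = combinatorialEmbedding H q := by
  rw [combinatorialEmbedding, combinatorialEmbedding, P.planeData_eq Q,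
    P.mirror.planeData_eq Q.mirror]

/-- All drawings have the same combinatorial embedding. -/
theorem IsGluedPair.combinatorialEmbedding_eq (g : IsGluedPair H o c o' d) (h0 : c 0 = d 2)
    (h2 : c 2 = d 0) (hp : IsRACDrawing H p) (hq : IsRACDrawing H q) :
    combinatorialEmbedding H p = combinatorialEmbedding H q := by
  have key : ∀ p, IsRACDrawing H p → ∃ q, IsPairDrawing H q o c o' d ∧
      combinatorialEmbedding H p = combinatorialEmbedding H q := by
    intro p hp
    rcases g.pairDrawing_or h0 h2 hp with h | h
    · exact ⟨p, h, rfl⟩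
    · have := h.mirror
      rw [rev_rev, rev_rev] at this
      exact ⟨_, this, (combinatorialEmbedding_mirror H p).symm⟩
  obtain ⟨p', P, ep⟩ := key p hp
  obtain ⟨q', Q, eq⟩ := key q hq
  rw [ep, eq, P.combinatorialEmbedding_eq Q]

end Mirror

/-! ### A drawing with integer coordinates -/

namespace Model

/-- The vertices of a copy of the antiprism with centre `0`: the even ones on the axes, the odd ones
on the diagonals. -/
def vertex : ZMod 8 → ℤ × ℤ :=
  ![(3, 0), (1, 1), (0, 3), (-1, 1), (-3, 0), (-1, -1), (0, -3), (1, -1)]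

/-- The second copy is the image of the first one under the half-turn about the midpoint of the side
from `vertex 0` to `vertex 2`. -/
def vertex' (m : ZMod 8) : ℤ × ℤ := (3, 3) - vertex m

/-- The positions of the vertices. -/
def points : List (ℤ × ℤ) :=
  [(0, 0), (3, 3)] ++ (List.finRange 8).flatMap fun m => [vertex m, vertex' m]

/-- The ends of the edges. -/
def edges : List ((ℤ × ℤ) × (ℤ × ℤ)) :=
  (vertex 1, vertex' 1) :: (List.finRange 8).flatMap fun m : ZMod 8 =>
    [((0, 0), vertex m), (vertex m, vertex (m + 1)), (vertex m, vertex (m + 2)),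
      ((3, 3), vertex' m), (vertex' m, vertex' (m + 1)), (vertex' m, vertex' (m + 2))]

/-- The scalar product. -/
def dot (a b : ℤ × ℤ) : ℤ := a.1 * b.1 + a.2 * b.2

/-- The vector turned by a right angle. -/
def rot (a : ℤ × ℤ) : ℤ × ℤ := (-a.2, a.1)

/-- The open segments `e` and `f` are on different sides of a line orthogonal to `n`, which does not
contain both of them. -/
def Separates (n : ℤ × ℤ) (e f : (ℤ × ℤ) × (ℤ × ℤ)) : Prop :=
  (dot n e.1 ≤ dot n f.1 ∧ dot n e.1 ≤ dot n f.2 ∧ dot n e.2 ≤ dot n f.1 ∧ dot n e.2 ≤ dot n f.2) ∧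
    (dot n e.1 ≠ dot n f.1 ∨ dot n e.1 ≠ dot n e.2 ∨ dot n f.1 ≠ dot n f.2)

instance (n : ℤ × ℤ) (e f : (ℤ × ℤ) × (ℤ × ℤ)) : Decidable (Separates n e f) := by
  unfold Separates; infer_instance

/-- No vertex lies on an edge of which it is not an end: it is off the line, or beyond the ends. -/
theorem points_check : ∀ e ∈ edges, ∀ w ∈ points, w = e.1 ∨ w = e.2 ∨
    dot (rot (e.2 - e.1)) (w - e.1) ≠ 0 ∨ 0 < dot (w - e.1) (w - e.2) := by
  decide +kernel

/-- Any two edges are equal, perpendicular or separated. Segments on a common line are separated by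
a line perpendicular to it, which explains the third of the normals. -/
theorem edges_check : ∀ e ∈ edges, ∀ f ∈ edges, (e = f ∨ e = f.swap) ∨
    dot (e.2 - e.1) (f.2 - f.1) = 0 ∨
    ∃ n ∈ [rot (e.2 - e.1), rot (f.2 - f.1), e.2 - e.1], Separates n e f ∨ Separates (-n) e f := by
  decide +kernel

theorem mem_edges (m : ZMod 8) : ((0, 0), vertex m) ∈ edges ∧ (vertex m, vertex (m + 1)) ∈ edges ∧
    (vertex m, vertex (m + 2)) ∈ edges ∧ ((3, 3), vertex' m) ∈ edges ∧
    (vertex' m, vertex' (m + 1)) ∈ edges ∧ (vertex' m, vertex' (m + 2)) ∈ edges := by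
  rcases zmod_eight_cases m with rfl | rfl | rfl | rfl | rfl | rfl | rfl | rfl <;> decide +kernel

theorem mem_points (m : ZMod 8) : vertex m ∈ points ∧ vertex' m ∈ points := by
  revert m
  decide

theorem vertex_injective : Function.Injective vertex := by decide +kernel

theorem vertex_ne (m : ZMod 8) : vertex m ≠ (0, 0) ∧ vertex m ≠ (3, 3) ∧ vertex' m ≠ (0, 0) ∧
    vertex' m ≠ (3, 3) := by
  revert m
  decide

theorem vertex_eq_vertex' : ∀ m n : ZMod 8, vertex m = vertex' n ↔ (m = 0 ∧ n = 2) ∨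
    (m = 2 ∧ n = 0) := by
  decide +kernel

/-- The point of the plane with given integer coordinates. -/
def toPlane (a : ℤ × ℤ) : ℂ := ⟨a.1, a.2⟩

theorem toPlane_injective : Function.Injective toPlane := fun _ _ h =>
  Prod.ext (Int.cast_injective (congrArg Complex.re h)) (Int.cast_injective (congrArg Complex.im h))

theorem Separates.disjoint {n : ℤ × ℤ} {e f : (ℤ × ℤ) × (ℤ × ℤ)} (h : Separates n e f) :
    ¬ (openSegment ℝ (toPlane e.1) (toPlane e.2) ∩
      openSegment ℝ (toPlane f.1) (toPlane f.2)).Nonempty := by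
  rintro ⟨z, hz, hz'⟩
  obtain ⟨s, hs0, hs1, a1, a2⟩ := mem_openSegment_iff.1 hz
  obtain ⟨t, ht0, ht1, b1, b2⟩ := mem_openSegment_iff.1 hz'
  obtain ⟨⟨h1, h2, h3, h4⟩, h5⟩ := h
  have e0 : (1 - s) * (dot n e.1 : ℝ) + s * dot n e.2 =
      (1 - t) * (dot n f.1 : ℝ) + t * dot n f.2 := by
    simp only [toPlane] at a1 a2 b1 b2
    simp only [dot]
    push_cast
    linear_combination (n.1 : ℝ) * (b1 - a1) + (n.2 : ℝ) * (b2 - a2)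
  have h1 : (dot n e.1 : ℝ) ≤ dot n f.1 := by exact_mod_cast h1
  have h2 : (dot n e.1 : ℝ) ≤ dot n f.2 := by exact_mod_cast h2
  have h3 : (dot n e.2 : ℝ) ≤ dot n f.1 := by exact_mod_cast h3
  have h4 : (dot n e.2 : ℝ) ≤ dot n f.2 := by exact_mod_cast h4
  -- a convex combination of four nonnegative numbers, with positive coefficients, vanishes
  have k1 := mul_nonneg (mul_pos (sub_pos.2 hs1) (sub_pos.2 ht1)).le (sub_nonneg.2 h1)
  have k2 := mul_nonneg (mul_pos (sub_pos.2 hs1) ht0).le (sub_nonneg.2 h2)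
  have k3 := mul_nonneg (mul_pos hs0 (sub_pos.2 ht1)).le (sub_nonneg.2 h3)
  have k4 := mul_nonneg (mul_pos hs0 ht0).le (sub_nonneg.2 h4)
  have hsum : (1 - s) * (1 - t) * ((dot n f.1 : ℝ) - dot n e.1) +
      (1 - s) * t * ((dot n f.2 : ℝ) - dot n e.1) + s * (1 - t) * ((dot n f.1 : ℝ) - dot n e.2) +
      s * t * ((dot n f.2 : ℝ) - dot n e.2) = 0 := by
    linear_combination -e0
  have z1 := (mul_eq_zero.1 (show (1 - s) * (1 - t) * ((dot n f.1 : ℝ) - dot n e.1) = 0 by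
    linarith)).resolve_left (mul_pos (sub_pos.2 hs1) (sub_pos.2 ht1)).ne'
  have z2 := (mul_eq_zero.1 (show (1 - s) * t * ((dot n f.2 : ℝ) - dot n e.1) = 0 by
    linarith)).resolve_left (mul_pos (sub_pos.2 hs1) ht0).ne'
  have z3 := (mul_eq_zero.1 (show s * (1 - t) * ((dot n f.1 : ℝ) - dot n e.2) = 0 by
    linarith)).resolve_left (mul_pos hs0 (sub_pos.2 ht1)).ne'
  rcases h5 with h5 | h5 | h5 <;> apply h5
  · exact_mod_cast (by linarith : (dot n e.1 : ℝ) = dot n f.1)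
  · exact_mod_cast (by linarith : (dot n e.1 : ℝ) = dot n e.2)
  · exact_mod_cast (by linarith : (dot n f.1 : ℝ) = dot n f.2)

theorem Separates.swap {n : ℤ × ℤ} {e f : (ℤ × ℤ) × (ℤ × ℤ)} (h : Separates (-n) e f) :
    Separates n f e := by
  simp only [Separates, dot, Prod.fst_neg, Prod.snd_neg, neg_mul] at h ⊢
  omega

end Model

namespace IsGluedPair

variable {V : Type*} {H : SimpleGraph V} {o o' : V} {c d : ZMod 8 → V} {u v : V}

/-- The coordinates of the two copies agree at the shared vertices, and define positions of all
vertices. -/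
theorem exists_coordinates (g : IsGluedPair H o c o' d) (h0 : c 0 = d 2) (h2 : c 2 = d 0) :
    ∃ P : V → ℤ × ℤ, P o = (0, 0) ∧ P o' = (3, 3) ∧ (∀ m, P (c m) = Model.vertex m) ∧
      ∀ m, P (d m) = Model.vertex' m := by
  classical
  have hc := g.left.injective
  have hd := g.right.injective
  refine ⟨Function.extend c Model.vertex (Function.extend d Model.vertex'
    fun v => if v = o then (0, 0) else (3, 3)), ?_, ?_, fun m => hc.extend_apply _ _ m, ?_⟩
  · rw [Function.extend_apply', Function.extend_apply', if_pos rfl]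
    · rintro ⟨m, e⟩
      exact g.right_ne m e.symm
    · rintro ⟨m, e⟩
      exact g.left.center_ne m e.symm
  · rw [Function.extend_apply', Function.extend_apply', if_neg g.center_ne.symm]
    · rintro ⟨m, e⟩
      exact g.right.center_ne m e.symm
    · rintro ⟨m, e⟩
      exact g.left_ne m e.symm
  · intro m
    by_cases hm : ∃ k, c k = d m
    · obtain ⟨k, e⟩ := hm
      rw [← e, hc.extend_apply, Model.vertex_eq_vertex']
      rcases (g.eq_of_eq k m e).1 with rfl | rfl
      · exact Or.inl ⟨rfl, hd (e.symm.trans h0)⟩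
      · exact Or.inr ⟨rfl, hd (e.symm.trans h2)⟩
    · rw [Function.extend_apply' _ _ _ hm, hd.extend_apply]

theorem exists_drawing (g : IsGluedPair H o c o' d) (h0 : c 0 = d 2) (h2 : c 2 = d 0) :
    ∃ p : V → ℂ, IsRACDrawing H p := by
  obtain ⟨P, ho, ho', hc, hd⟩ := g.exists_coordinates h0 h2
  have hinj : Function.Injective P := by
    have hcd : ∀ m n, Model.vertex m = Model.vertex' n → c m = d n := by
      intro m n e
      rcases (Model.vertex_eq_vertex' m n).1 e with ⟨rfl, rfl⟩ | ⟨rfl, rfl⟩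
      exacts [h0, h2]
    have hn := Model.vertex_ne
    intro v w e
    rcases g.cover v with rfl | rfl | ⟨m, rfl⟩ | ⟨m, rfl⟩ <;>
      rcases g.cover w with rfl | rfl | ⟨n, rfl⟩ | ⟨n, rfl⟩ <;>
      simp only [ho, ho', hc, hd] at e
    · rfl
    · exact absurd e (by decide)
    · exact absurd e.symm (hn n).1
    · exact absurd e.symm (hn n).2.2.1
    · exact absurd e (by decide)
    · rfl
    · exact absurd e.symm (hn n).2.1
    · exact absurd e.symm (hn n).2.2.2
    · exact absurd e (hn m).1
    · exact absurd e (hn m).2.1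
    · rw [Model.vertex_injective e]
    · exact hcd m n e
    · exact absurd e (hn m).2.2.1
    · exact absurd e (hn m).2.2.2
    · exact (hcd n m e.symm).symm
    · rw [Model.vertex_injective (sub_right_injective e)]
  have hpt : ∀ v, P v ∈ Model.points := by
    intro v
    rcases g.cover v with rfl | rfl | ⟨m, rfl⟩ | ⟨m, rfl⟩
    · rw [ho]; decide
    · rw [ho']; decide
    · rw [hc]; exact (Model.mem_points m).1
    · rw [hd]; exact (Model.mem_points m).2
  have hedge : ∀ u v, H.Adj u v → (P u, P v) ∈ Model.edges ∨ (P v, P u) ∈ Model.edges := by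
    intro u v huv
    have key : ∀ a b, s(u, v) = s(a, b) → (P a, P b) ∈ Model.edges →
        (P u, P v) ∈ Model.edges ∨ (P v, P u) ∈ Model.edges := by
      intro a b e h
      rcases Sym2.eq_iff.1 e with ⟨rfl, rfl⟩ | ⟨rfl, rfl⟩
      exacts [Or.inl h, Or.inr h]
    rcases g.edge_cases u v huv with (⟨m, h⟩ | ⟨m, h⟩ | ⟨m, h⟩) | (⟨m, h⟩ | ⟨m, h⟩ | ⟨m, h⟩) | h <;>
      refine key _ _ h ?_ <;> simp only [ho, ho', hc, hd]
    · exact (Model.mem_edges m).1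
    · exact (Model.mem_edges m).2.1
    · exact (Model.mem_edges m).2.2.1
    · exact (Model.mem_edges m).2.2.2.1
    · exact (Model.mem_edges m).2.2.2.2.1
    · exact (Model.mem_edges m).2.2.2.2.2
    · exact List.mem_cons_self
  refine ⟨fun v => Model.toPlane (P v), Model.toPlane_injective.comp hinj, ?_, ?_⟩
  · have key : ∀ u v w, (P u, P v) ∈ Model.edges →
        Model.toPlane (P w) ∈ segment ℝ (Model.toPlane (P u)) (Model.toPlane (P v)) →
        w = u ∨ w = v := by
      intro u v w h hw
      obtain ⟨t, ht0, ht1, e1, e2⟩ := mem_segment_iff.1 hw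
      simp only [Model.toPlane] at e1 e2
      rcases Model.points_check _ h _ (hpt w) with h' | h' | h' | h'
      · exact Or.inl (hinj h')
      · exact Or.inr (hinj h')
      · refine absurd ?_ h'
        have : ((Model.dot (Model.rot (P v - P u)) (P w - P u) : ℤ) : ℝ) = 0 := by
          simp only [Model.dot, Model.rot, Prod.fst_sub, Prod.snd_sub]
          push_cast
          rw [e1, e2]
          ring
        exact_mod_cast this
      · have h3 : (0 : ℝ) < (Model.dot (P w - P u) (P w - P v) : ℤ) := by exact_mod_cast h'
        simp only [Model.dot, Prod.fst_sub, Prod.snd_sub] at h3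
        push_cast at h3
        rw [e1, e2] at h3
        have : 0 ≤ t * (1 - t) := mul_nonneg ht0 (by linarith)
        nlinarith [mul_nonneg this (sq_nonneg (((P v).1 : ℝ) - (P u).1)),
          mul_nonneg this (sq_nonneg (((P v).2 : ℝ) - (P u).2))]
    intro u v w huv hw
    rcases hedge u v huv with h | h
    · exact key u v w h hw
    · rw [segment_symm] at hw
      exact (key v u w h hw).symm
  · have key : ∀ u v x y, (P u, P v) ∈ Model.edges → (P x, P y) ∈ Model.edges →
        Crosses H (fun v => Model.toPlane (P v)) u v x y →
        inner ℝ (Model.toPlane (P v) - Model.toPlane (P u))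
          (Model.toPlane (P y) - Model.toPlane (P x)) = 0 := by
      intro u v x y h1 h2 hX
      rcases Model.edges_check _ h1 _ h2 with (h | h) | h | ⟨n, -, h | h⟩
      · rw [Prod.mk.injEq] at h
        exact absurd (by rw [hinj h.1, hinj h.2]) hX.2.2.1
      · rw [Prod.swap, Prod.mk.injEq] at h
        exact absurd (by rw [hinj h.1, hinj h.2, Sym2.eq_swap]) hX.2.2.1
      · have h' : ((Model.dot (P v - P u) (P y - P x) : ℤ) : ℝ) = 0 := by exact_mod_cast h
        rw [inner_eq]
        simp only [Model.dot, Prod.fst_sub, Prod.snd_sub] at h'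
        push_cast at h'
        simpa [Model.toPlane] using h'
      · exact absurd hX.2.2.2 h.disjoint
      · exact absurd hX.symm.2.2.2 h.swap.disjoint
    have hneg : ∀ a b x y : ℂ, inner ℝ (a - b) (x - y) = 0 → inner ℝ (b - a) (x - y) = 0 := by
      intro a b x y h
      rw [← neg_sub a b, inner_neg_left, h, neg_zero]
    have hneg' : ∀ a b x y : ℂ, inner ℝ (a - b) (x - y) = 0 → inner ℝ (a - b) (y - x) = 0 := by
      intro a b x y h
      rw [← neg_sub x y, inner_neg_right, h, neg_zero]
    intro u v x y hX
    rcases hedge _ _ hX.1 with h1 | h1 <;> rcases hedge _ _ hX.2.1 with h2 | h2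
    · exact key _ _ _ _ h1 h2 hX
    · exact hneg' _ _ _ _ (key _ _ _ _ h1 h2 hX.swap_right)
    · exact hneg _ _ _ _ (key _ _ _ _ h1 h2 hX.swap_left)
    · exact hneg' _ _ _ _ (hneg _ _ _ _ (key _ _ _ _ h1 h2 hX.swap_left.swap_right))

end IsGluedPair

/-! ### Extensions of the augmented square antiprism graph -/

open AntiprismVertex

/-- The vertices of the antiprism other than the centre, numbered along the cycle
`top i`, `bot i`, `top (i + 1)`, `bot (i + 1)`, …. -/
def rimVertex (i : ZMod 4) (m : ZMod 8) : AntiprismVertex :=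
  if m.val % 2 = 0 then top (i + (m.val / 2 : ℕ)) else bot (i + (m.val / 2 : ℕ))

theorem rimVertex_double (i k : ZMod 4) : rimVertex i (double k) = top (i + k) := by
  have : ∀ k : ZMod 4, (double k).val % 2 = 0 ∧ (((double k).val / 2 : ℕ) : ZMod 4) = k := by decide
  rw [rimVertex, if_pos (this k).1, (this k).2]

theorem rimVertex_double_add_one (i k : ZMod 4) : rimVertex i (double k + 1) = bot (i + k) := by
  have : ∀ k : ZMod 4, ¬ (double k + 1).val % 2 = 0 ∧
    (((double k + 1).val / 2 : ℕ) : ZMod 4) = k := by decide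
  rw [rimVertex, if_neg (this k).1, (this k).2]

theorem eq_double_or (m : ZMod 8) : (∃ k, m = double k) ∨ ∃ k, m = double k + 1 := by
  decide +revert

theorem rimVertex_injective (i : ZMod 4) : Function.Injective (rimVertex i) := by
  intro m n h
  rcases eq_double_or m with ⟨k, rfl⟩ | ⟨k, rfl⟩ <;>
    rcases eq_double_or n with ⟨l, rfl⟩ | ⟨l, rfl⟩ <;>
    simp only [rimVertex_double, rimVertex_double_add_one, top.injEq, bot.injEq, reduceCtorEq,
      add_right_inj] at h <;> rw [h]

theorem rimVertex_ne_center (i : ZMod 4) (m : ZMod 8) : rimVertex i m ≠ center := by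
  unfold rimVertex
  split_ifs <;> simp

theorem top_eq_rimVertex (i k : ZMod 4) : top k = rimVertex i (double (k - i)) := by
  rw [rimVertex_double, add_sub_cancel]

theorem bot_eq_rimVertex (i k : ZMod 4) : bot k = rimVertex i (double (k - i) + 1) := by
  rw [rimVertex_double_add_one, add_sub_cancel]

theorem exists_rimVertex (i : ZMod 4) (a : AntiprismVertex) :
    a = center ∨ ∃ m, a = rimVertex i m := by
  cases a with
  | center => exact Or.inl rfl
  | top k => exact Or.inr ⟨_, top_eq_rimVertex i k⟩
  | bot k => exact Or.inr ⟨_, bot_eq_rimVertex i k⟩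

/-- The relation is contained in the adjacency; only loops have to be excluded. -/
theorem antiprism_adj {a b : AntiprismVertex} (h : antiprismRel a b) (hne : a ≠ b) :
    augmentedSquareAntiprism.Adj a b := (SimpleGraph.fromRel_adj _ _ _).2 ⟨hne, Or.inl h⟩

theorem adj_rimVertex (i : ZMod 4) (m : ZMod 8) :
    augmentedSquareAntiprism.Adj center (rimVertex i m) ∧
      augmentedSquareAntiprism.Adj (rimVertex i m) (rimVertex i (m + 1)) ∧
      augmentedSquareAntiprism.Adj (rimVertex i m) (rimVertex i (m + 2)) := by
  refine ⟨antiprism_adj trivial (rimVertex_ne_center i m).symm, ?_, ?_⟩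
  · have hne : rimVertex i m ≠ rimVertex i (m + 1) := fun e =>
      absurd (rimVertex_injective i e) ((by decide : ∀ m : ZMod 8, m ≠ m + 1) m)
    rcases eq_double_or m with ⟨k, rfl⟩ | ⟨k, rfl⟩
    · refine (antiprism_adj ?_ hne.symm).symm
      rw [rimVertex_double, rimVertex_double_add_one]
      exact Or.inl rfl
    · refine antiprism_adj ?_ hne
      rw [add_assoc, one_add_one_eq_two, ← double_add_one, rimVertex_double,
        rimVertex_double_add_one]
      exact Or.inr (add_assoc _ _ _).symm
  · have hne : rimVertex i m ≠ rimVertex i (m + 2) := fun e =>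
      absurd (rimVertex_injective i e) ((by decide : ∀ m : ZMod 8, m ≠ m + 2) m)
    refine antiprism_adj ?_ hne
    rcases eq_double_or m with ⟨k, rfl⟩ | ⟨k, rfl⟩
    · rw [← double_add_one, rimVertex_double, rimVertex_double]
      exact (add_assoc _ _ _).symm
    · rw [add_right_comm, ← double_add_one, rimVertex_double_add_one, rimVertex_double_add_one]
      exact (add_assoc _ _ _).symm

section

variable {V : Type*} {H : SimpleGraph V} {φ φ' : AntiprismVertex ↪ V} {i j : ZMod 4} {u v : V}

/-- The edges of the antiprism join the centre to the other vertices, and those at distance one or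
two in the cyclic numbering. -/
theorem isCopyEdge_of_adj (i : ZMod 4) {a b : AntiprismVertex}
    (h : augmentedSquareAntiprism.Adj a b) :
    IsCopyEdge (φ center) (fun m => φ (rimVertex i m)) (φ a) (φ b) := by
  have key : ∀ a b, a ≠ b → antiprismRel a b →
      IsCopyEdge (φ center) (fun m => φ (rimVertex i m)) (φ a) (φ b) := by
    intro a b hne h
    cases a with
    | center =>
      obtain ⟨m, rfl⟩ := (exists_rimVertex i b).resolve_left hne.symm
      exact Or.inl ⟨m, rfl⟩
    | top k =>
      cases b with
      | top l =>
        obtain rfl : l = k + 1 := h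
        refine Or.inr (Or.inr ⟨double (k - i), ?_⟩)
        simp only [← double_add_one, rimVertex_double]
        rw [show i + (k - i) = k by ring, show i + (k - i + 1) = k + 1 by ring]
      | center => exact h.elim
      | bot l => exact h.elim
    | bot k =>
      cases b with
      | center => exact h.elim
      | bot l =>
        obtain rfl : l = k + 1 := h
        refine Or.inr (Or.inr ⟨double (k - i) + 1, ?_⟩)
        simp only [add_right_comm _ (1 : ZMod 8) 2, ← double_add_one, rimVertex_double_add_one]
        rw [show i + (k - i) = k by ring, show i + (k - i + 1) = k + 1 by ring]
      | top l =>
        rcases (h : l = k ∨ l = k + 1) with rfl | rfl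
        · refine Or.inr (Or.inl ⟨double (l - i), ?_⟩)
          simp only [rimVertex_double, rimVertex_double_add_one]
          rw [show i + (l - i) = l by ring, Sym2.eq_swap]
        · refine Or.inr (Or.inl ⟨double (k - i) + 1, ?_⟩)
          simp only [add_assoc _ (1 : ZMod 8) 1, one_add_one_eq_two, ← double_add_one,
            rimVertex_double, rimVertex_double_add_one]
          rw [show i + (k - i) = k by ring, show i + (k - i + 1) = k + 1 by ring]
  obtain ⟨hne, h | h⟩ := (SimpleGraph.fromRel_adj _ _ _).1 h
  · exact key a b hne h
  · have := key b a hne.symm h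
    unfold IsCopyEdge at this ⊢
    rwa [Sym2.eq_swap]

theorem isAntiprism_of_map_le (i : ZMod 4) (h : augmentedSquareAntiprism.map φ ≤ H) :
    IsAntiprism H (φ center) fun m => φ (rimVertex i m) := by
  have hadj : ∀ a b, augmentedSquareAntiprism.Adj a b → H.Adj (φ a) (φ b) := fun a b hab =>
    h (SimpleGraph.map_adj_apply.2 hab)
  exact ⟨φ.injective.comp (rimVertex_injective i), fun m => hadj _ _ (adj_rimVertex i m).1,
    fun m => hadj _ _ (adj_rimVertex i m).2.1, fun m => hadj _ _ (adj_rimVertex i m).2.2⟩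

theorem rimVertex_zero (i : ZMod 4) : rimVertex i 0 = top i := by
  rw [show (0 : ZMod 8) = double 0 by decide, rimVertex_double, add_zero]

theorem rimVertex_one (i : ZMod 4) : rimVertex i 1 = bot i := by
  rw [show (1 : ZMod 8) = double 0 + 1 by decide, rimVertex_double_add_one, add_zero]

theorem rimVertex_two (i : ZMod 4) : rimVertex i 2 = top (i + 1) := by
  rw [show (2 : ZMod 8) = double 1 by decide, rimVertex_double]

theorem IsExtension.isGluedPair (h : IsExtension H φ φ' i j) :
    IsGluedPair H (φ center) (fun m => φ (rimVertex i m)) (φ' center)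
      (fun m => φ' (rimVertex j m)) := by
  have hleft : augmentedSquareAntiprism.map φ ≤ H := by
    rw [h.graph]; exact le_sup_left.trans le_sup_left
  have hright : augmentedSquareAntiprism.map φ' ≤ H := by
    rw [h.graph]; exact le_sup_right.trans le_sup_left
  have hmem : ∀ a b, φ a = φ' b →
      (a = top i ∨ a = top (i + 1)) ∧ (b = top j ∨ b = top (j + 1)) := by
    intro a b e
    have h1 : φ a ∈ ({φ (top i), φ (top (i + 1))} : Set V) := by
      rw [← h.shared]
      exact ⟨⟨a, rfl⟩, ⟨b, e.symm⟩⟩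
    have h2 : φ' b ∈ ({φ' (top j), φ' (top (j + 1))} : Set V) := by
      rwa [← e, ← h.glue]
    simpa only [Set.mem_insert_iff, Set.mem_singleton_iff, φ.injective.eq_iff,
      φ'.injective.eq_iff] using And.intro h1 h2
  have heq : ∀ m n, φ (rimVertex i m) = φ' (rimVertex j n) → (m = 0 ∨ m = 2) ∧ (n = 0 ∨ n = 2) := by
    intro m n e
    have := hmem _ _ e
    rw [← rimVertex_zero i, ← rimVertex_zero j, ← rimVertex_two i, ← rimVertex_two j] at this
    simpa only [(rimVertex_injective _).eq_iff] using this
  refine ⟨isAntiprism_of_map_le i hleft, isAntiprism_of_map_le j hright, ?_, ?_, ?_, ?_,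
    heq, ?_, ?_, ?_⟩
  · simp only [rimVertex_zero, rimVertex_two]
    exact Set.pair_eq_pair_iff.1 h.glue
  · intro e
    simpa using (hmem _ _ e).1
  · intro m e
    simpa using (hmem _ _ e.symm).2
  · intro m e
    simpa using (hmem _ _ e).1
  · simp only [rimVertex_one]
    rw [h.graph]
    refine Or.inr ((SimpleGraph.edge_adj _ _ _ _).2 ⟨Or.inl ⟨rfl, rfl⟩, fun e => ?_⟩)
    simpa using (hmem _ _ e).1
  · intro v
    have hv : v ∈ Set.range φ ∪ Set.range φ' := by rw [h.cover]; trivial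
    rcases hv with ⟨a, rfl⟩ | ⟨a, rfl⟩
    · rcases exists_rimVertex i a with rfl | ⟨m, rfl⟩
      exacts [Or.inl rfl, Or.inr (Or.inr (Or.inl ⟨m, rfl⟩))]
    · rcases exists_rimVertex j a with rfl | ⟨m, rfl⟩
      exacts [Or.inr (Or.inl rfl), Or.inr (Or.inr (Or.inr ⟨m, rfl⟩))]
  · intro u v huv
    rw [h.graph] at huv
    rcases huv with (huv | huv) | huv
    · obtain ⟨-, a, b, hab, rfl, rfl⟩ := huv
      exact Or.inl (isCopyEdge_of_adj i hab)
    · obtain ⟨-, a, b, hab, rfl, rfl⟩ := huv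
      exact Or.inr (Or.inl (isCopyEdge_of_adj j hab))
    · right; right
      simp only [rimVertex_one]
      rcases ((SimpleGraph.edge_adj _ _ _ _).1 huv).1 with ⟨rfl, rfl⟩ | ⟨rfl, rfl⟩
      exacts [rfl, Sym2.eq_swap]

/-- The numbers of the vertices of a copy are compatible with its outer quadrilateral: the vertices
`c (2 * m)` are those of the quadrilateral `top`, in one of its two cyclic orders. -/
structure IsNumbering (φ : AntiprismVertex ↪ V) (c : ZMod 8 → V) : Prop where
  exists_side : ∀ k, ∃ m, s(φ (top k), φ (top (k + 1))) = s(c (2 * m), c (2 * m + 2))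
  exists_top : ∀ m, ∃ k, s(c (2 * m), c (2 * m + 2)) = s(φ (top k), φ (top (k + 1)))
  exists_bot : ∀ k, ∃ m, φ (bot k) = c (2 * m + 1)

theorem isNumbering (φ : AntiprismVertex ↪ V) (i : ZMod 4) :
    IsNumbering φ fun m => φ (rimVertex i m) where
  exists_side k := by
    refine ⟨((k - i).val : ZMod 8), ?_⟩
    change _ = s(φ (rimVertex i (double (k - i))), φ (rimVertex i (double (k - i) + 2)))
    rw [← double_add_one, rimVertex_double, rimVertex_double,
      show i + (k - i) = k by ring, show i + (k - i + 1) = k + 1 by ring]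
  exists_top m := by
    obtain ⟨k, hk⟩ := exists_double m
    refine ⟨i + k, ?_⟩
    rw [hk, ← double_add_one, rimVertex_double, rimVertex_double, add_assoc]
  exists_bot k := ⟨((k - i).val : ZMod 8), congrArg φ (bot_eq_rimVertex i k)⟩

theorem IsNumbering.rev {c : ZMod 8 → V} (h : IsNumbering φ c) : IsNumbering φ (rev c) where
  exists_side k := by
    obtain ⟨m, e⟩ := h.exists_side k
    refine ⟨-m, ?_⟩
    rw [e, RAC.rev, RAC.rev, show 2 - 2 * -m = 2 * m + 2 by ring,
      show 2 - (2 * -m + 2) = 2 * m by ring, Sym2.eq_swap]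
  exists_top m := by
    obtain ⟨k, e⟩ := h.exists_top (-m)
    refine ⟨k, ?_⟩
    rw [← e, RAC.rev, RAC.rev, show 2 - 2 * m = 2 * -m + 2 by ring,
      show 2 - (2 * m + 2) = 2 * -m by ring, Sym2.eq_swap]
  exists_bot k := by
    obtain ⟨m, e⟩ := h.exists_bot k
    exact ⟨-m, by rw [e, RAC.rev, show 2 - (2 * -m + 1) = 2 * m + 1 by ring]⟩

variable {p : V → ℂ} {o o' : V} {c d : ZMod 8 → V}

theorem IsNumbering.topQuad_eq (h : IsNumbering φ c) (p : V → ℂ) :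
    topQuad φ p = StarQuad.boundary (corner p c) := by
  have hseg : ∀ {a b a' b' : V}, s(a, b) = s(a', b') →
      segment ℝ (p a) (p b) = segment ℝ (p a') (p b') := by
    intro a b a' b' e
    rcases Sym2.eq_iff.1 e with ⟨rfl, rfl⟩ | ⟨rfl, rfl⟩
    exacts [rfl, segment_symm _ _ _]
  ext z
  rw [IsPairDrawing.mem_boundary_iff, topQuad, Set.mem_iUnion]
  constructor
  · rintro ⟨k, hk⟩
    obtain ⟨m, e⟩ := h.exists_side k
    exact ⟨m, by rwa [← hseg e]⟩
  · rintro ⟨m, hm⟩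
    obtain ⟨k, e⟩ := h.exists_top m
    exact ⟨k, by rwa [← hseg e]⟩

theorem IsPairDrawing.enclosed_topQuad (P : IsPairDrawing H p o c o' d) (h : IsNumbering φ c) :
    enclosed (topQuad φ p) = StarQuad.inside (p o) (corner p c) := by
  rw [h.topQuad_eq, StarQuad.enclosed_boundary P.star]

theorem IsPairDrawing.topIsOuter (P : IsPairDrawing H p (φ center) c o' d) (h : IsNumbering φ c) :
    TopIsOuter H φ p where
  planar k l hX := by
    obtain ⟨m, e⟩ := h.exists_side k
    obtain ⟨n, e'⟩ := h.exists_side l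
    have := (P.outer_crosses (hX.congr e rfl)).2
    rw [e'] at this
    have hinj := P.glued.left.injective
    rcases Sym2.eq_iff.1 this with ⟨h, -⟩ | ⟨-, h⟩
    · exact absurd (hinj h) ((by decide : ∀ n : ZMod 8, 2 * n ≠ 1) n)
    · exact absurd (hinj h) ((by decide : ∀ n : ZMod 8, 2 * n + 2 ≠ 1) n)
  center_mem := by
    rw [P.enclosed_topQuad h]
    exact StarQuad.center_mem P.star
  bot_mem k := by
    rw [P.enclosed_topQuad h]
    obtain ⟨m, e⟩ := h.exists_bot k
    rw [e]
    exact P.odd_mem_inside m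

/-- The copies can be numbered in such a way that the shared vertices correspond to each other in
the opposite order. -/
theorem IsExtension.exists_numbering (h : IsExtension H φ φ' i j) :
    ∃ c d, IsGluedPair H (φ center) c (φ' center) d ∧ c 0 = d 2 ∧ c 2 = d 0 ∧
      IsNumbering φ c ∧ IsNumbering φ' d := by
  have g := h.isGluedPair
  rcases g.shared with ⟨e0, e2⟩ | ⟨e0, e2⟩
  · exact ⟨_, _, g.symm.reflect_left.symm, by simpa using e0, by simpa using e2, isNumbering φ i,
      (isNumbering φ' j).rev⟩
  · exact ⟨_, _, g, e0, e2, isNumbering φ i, isNumbering φ' j⟩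

end

end RAC

theorem mainTheorem2 {V : Type*} (H : SimpleGraph V) (φ φ' : RAC.AntiprismVertex ↪ V)
    (i j : ZMod 4) (hH : RAC.IsExtension H φ φ' i j) :
    (∃! E : Sym2 (RAC.PlaneData V), E ∈ RAC.racEmbeddings H) ∧
      ∀ p : V → ℂ, RAC.IsRACDrawing H p →
        RAC.TopIsOuter H φ p ∧ RAC.TopIsOuter H φ' p ∧
          Disjoint (RAC.enclosed (RAC.topQuad φ p)) (RAC.enclosed (RAC.topQuad φ' p)) := by
  obtain ⟨c, d, g, h0, h2, hc, hd⟩ := hH.exists_numbering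
  refine ⟨?_, fun p hp => ?_⟩
  · obtain ⟨p, hp⟩ := g.exists_drawing h0 h2
    refine ⟨_, ⟨p, hp, rfl⟩, ?_⟩
    rintro _ ⟨q, hq, rfl⟩
    exact g.combinatorialEmbedding_eq h0 h2 hq hp
  · have key : ∀ {c d}, RAC.IsPairDrawing H p (φ .center) c (φ' .center) d → RAC.IsNumbering φ c →
        RAC.IsNumbering φ' d → RAC.TopIsOuter H φ p ∧ RAC.TopIsOuter H φ' p ∧
          Disjoint (RAC.enclosed (RAC.topQuad φ p)) (RAC.enclosed (RAC.topQuad φ' p)) := by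
      intro c d P hc hd
      refine ⟨P.topIsOuter hc, P.symm.topIsOuter hd, ?_⟩
      rw [P.enclosed_topQuad hc, P.symm.enclosed_topQuad hd]
      exact P.disjoint_inside
    rcases g.pairDrawing_or h0 h2 hp with P | P
    · exact key P hc hd
    · exact key P hc.rev hd.rev
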